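/- **Lemma (Scott–Zhang interpolant).** Let $d\ge 1$ and let $D\subset\mathbb R^d$ be a bounded open set with Lipschitz boundary. For a function $v$ on $D$ let $\tilde v$ be its extension by zero, and for $r\ge 0$ let $\widetilde H^r(D)$ be the set of all $v$ with $\tilde v\in H^r(\mathbb R^d)$, with norm $$\|v\|_{\widetilde H^r(D)}=\|\tilde v\|_{H^r(\mathbb R^d)}=\Big(\int_{\mathbb R^d}(1+|\zeta|^2)^{r}\,|\mathcal F(\tilde v)(\zeta)|^2\,d\zeta\Big)^{1/2},$$ where $\mathcal F$ is the unitary Fourier transform in the angular frequency $\zeta$. Let $\beta\in(1,3/2)$ and $\sigma,\rho\in\mathbb R$. Then there is a constant $C$, depending only on $d,D,\beta,\sigma,\rho$, such that the following holds for every finite conforming subdivision $\mathcal T_h$ of $\overline D$ into $d$-simplices, of mesh size $h=\max_{T\in\mathcal T_h}\operatorname{diam}(T)\le 1$, that is shape regular and quasi-uniform: $$\frac{\operatorname{diam}(T)}{r(T)}\le\sigma,\qquad \operatorname{diam}(T)\le\rho\,\operatorname{diam}(T')\qquad\text{for all }T,T'\in\mathcal T_h,$$ where $r(T)$ is the radius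 of the largest ball contained in $T$. For every vertex $z$ of $\mathcal T_h$ choose a $(d-1)$-dimensional face $F_z\ni z$ of the mesh, with $F_z\subset\partial D$ whenever $z\in\partial D$. Let $\psi_z$ be the affine function on $F_z$ with $\int_{F_z}\psi_z\,p=p(z)$ for all affine $p$ (the integral is taken over the $(d-1)$-dimensional measure; for $d=1$ it is evaluation at $z$). The Scott–Zhang interpolant $\pi_h^{sz}v$ of $v\in\widetilde H^\beta(D)$ is the continuous function on $\overline D$ that is affine on each $T\in\mathcal T_h$ and satisfies $\pi_h^{sz}v(z)=\int_{F_z}\psi_z v$ at each vertex $z$, where $v$ on $F_z$ is understood in the sense of traces of $\tilde v\in H^1(\mathbb R^d)$. Then, for every such choice of faces and every $v\in\widetilde H^\beta(D)$, the interpolant $\pi_h^{sz}v$ exists, is unique on $\overline D$, vanishes on $\partial D$, and satisfies $$\|\pi_h^{sz}v\|_{\widetilde H^\beta(D)}\le C\,\|v\|_{\widetilde H^\beta(D)}$$ and, for all $s\in[0,1]$, $$\|\pi_h^{sz}v-v\|_{\widetilde H^s(D)}\le C\,h^{\beta-s}\,\|v\|_{\widetilde H^\beta(D)}.$$ -/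

import Mathlib

open MeasureTheory Filter Topology Set
open scoped ENNReal NNReal FourierTransform

noncomputable section

namespace ScottZhang

/-- The norm of `H^r(ℝ^d)`, extended by `∞` to functions outside `H^r(ℝ^d)`:
`(∫ (1 + |ζ|²)^r |f^(ζ)|² dζ)^(1/2)` for `f` in `L²`, with the Plancherel Fourier transform.
Mathlib's transform uses the kernel `exp (-2πi x·ξ)`, so that the angular frequency is `ζ = 2πξ`
and `(1 + |ζ|²)^r` becomes `(1 + |2πξ|²)^r`. -/
def sobolevENorm {d : ℕ} (r : ℝ) (f : EuclideanSpace ℝ (Fin d) → ℝ) : ℝ≥0∞ :=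
  open Classical in
  if hf : MemLp (fun x => (f x : ℂ)) 2 (volume : Measure (EuclideanSpace ℝ (Fin d))) then
    (∫⁻ ξ, ENNReal.ofReal ((1 + (2 * Real.pi * ‖ξ‖) ^ 2) ^ r) *
      ‖(𝓕 (hf.toLp (fun x => (f x : ℂ))) :
        Lp ℂ 2 (volume : Measure (EuclideanSpace ℝ (Fin d)))) ξ‖ₑ ^ 2) ^ (1 / 2 : ℝ)
  else ∞

/-- The norm of `H̃^r(D)`: the `H^r(ℝ^d)` norm of the extension by zero. -/
def tildeENorm {d : ℕ} (D : Set (EuclideanSpace ℝ (Fin d))) (r : ℝ)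
    (v : EuclideanSpace ℝ (Fin d) → ℝ) : ℝ≥0∞ :=
  sobolevENorm r (D.indicator v)

/-- `v ∈ H̃^r(D)`: the extension by zero of `v|_D` belongs to `H^r(ℝ^d)`. -/
def MemTilde {d : ℕ} (D : Set (EuclideanSpace ℝ (Fin d))) (r : ℝ)
    (v : EuclideanSpace ℝ (Fin d) → ℝ) : Prop :=
  tildeENorm D r v < ∞

/-- `D` has a Lipschitz boundary: near each boundary point, `D` is the strict epigraph of a
Lipschitz function, in the direction of some unit vector `e`, over the hyperplane `e^⊥`. -/
def HasLipschitzBoundary {d : ℕ} (D : Set (EuclideanSpace ℝ (Fin d))) : Prop :=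
  ∀ x ∈ frontier D, ∃ e : EuclideanSpace ℝ (Fin d), ‖e‖ = 1 ∧
    ∃ (L : ℝ≥0) (γ : EuclideanSpace ℝ (Fin d) → ℝ), LipschitzWith L γ ∧
      ∃ U ∈ 𝓝 x, ∀ y ∈ U, (y ∈ D ↔ γ (y - (inner ℝ e y) • e) < inner ℝ e y)

/-- The elements of a mesh: its `d`-dimensional simplices, given by their sets of vertices. -/
def cells {d : ℕ} (K : Geometry.SimplicialComplex ℝ (EuclideanSpace ℝ (Fin d))) :
    Set (Finset (EuclideanSpace ℝ (Fin d))) :=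
  {T | T ∈ K.faces ∧ T.card = d + 1}

/-- `K` is a conforming subdivision of `D` into `d`-simplices. -/
structure IsTriangulation {d : ℕ} (D : Set (EuclideanSpace ℝ (Fin d)))
    (K : Geometry.SimplicialComplex ℝ (EuclideanSpace ℝ (Fin d))) : Prop where
  finite : K.faces.Finite
  pure : ∀ S ∈ K.faces, ∃ T ∈ cells K, S ⊆ T
  space_eq : K.space = closure D

/-- The diameter of the simplex with vertex set `T`. -/
def simplexDiam {d : ℕ} (T : Finset (EuclideanSpace ℝ (Fin d))) : ℝ :=
  Metric.diam (convexHull ℝ (T : Set (EuclideanSpace ℝ (Fin d))))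

/-- The radius of the largest ball contained in the simplex with vertex set `T`. -/
def inradius {d : ℕ} (T : Finset (EuclideanSpace ℝ (Fin d))) : ℝ :=
  sSup {r : ℝ | ∃ c, Metric.closedBall c r ⊆
    convexHull ℝ (T : Set (EuclideanSpace ℝ (Fin d)))}

/-- The mesh size `h`: the maximal diameter of the elements. -/
def meshSize {d : ℕ} (K : Geometry.SimplicialComplex ℝ (EuclideanSpace ℝ (Fin d))) : ℝ :=
  sSup (simplexDiam '' cells K)

/-- Shape regularity with constant `σ`: `diam(T) / r(T) ≤ σ` for every element `T`. -/
def ShapeRegular {d : ℕ} (σ : ℝ)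
    (K : Geometry.SimplicialComplex ℝ (EuclideanSpace ℝ (Fin d))) : Prop :=
  ∀ T ∈ cells K, simplexDiam T ≤ σ * inradius T

/-- Quasi-uniformity with constant `ρ`: `max diam(T) / min diam(T) ≤ ρ`. -/
def QuasiUniform {d : ℕ} (ρ : ℝ)
    (K : Geometry.SimplicialComplex ℝ (EuclideanSpace ℝ (Fin d))) : Prop :=
  ∀ T ∈ cells K, ∀ T' ∈ cells K, simplexDiam T ≤ ρ * simplexDiam T'

/-- Continuous functions on `|K|` that are affine on each element. -/
def lagrangeSpace {d : ℕ} (K : Geometry.SimplicialComplex ℝ (EuclideanSpace ℝ (Fin d))) :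
    Set (EuclideanSpace ℝ (Fin d) → ℝ) :=
  {w | ContinuousOn w K.space ∧ ∀ T ∈ cells K, ∃ p : EuclideanSpace ℝ (Fin d) →ᵃ[ℝ] ℝ,
    EqOn w p (convexHull ℝ (T : Set (EuclideanSpace ℝ (Fin d))))}

/-- The finite element space `𝕍_h(D)`: continuous piecewise linear functions vanishing on
`∂D`. -/
def femSpace {d : ℕ} (D : Set (EuclideanSpace ℝ (Fin d)))
    (K : Geometry.SimplicialComplex ℝ (EuclideanSpace ℝ (Fin d))) :
    Set (EuclideanSpace ℝ (Fin d) → ℝ) :=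
  {w | w ∈ lagrangeSpace K ∧ ∀ x ∈ frontier D, w x = 0}

/-- The `(d-1)`-dimensional surface measure on the simplex with vertex set `S` (meant for
`(d-1)`-simplices; a point mass for `d = 1`). -/
def faceMeasure {d : ℕ} (S : Finset (EuclideanSpace ℝ (Fin d))) :
    Measure (EuclideanSpace ℝ (Fin d)) :=
  (Measure.hausdorffMeasure ((d : ℝ) - 1)).restrict
    (convexHull ℝ (S : Set (EuclideanSpace ℝ (Fin d))))

/-- `g ∈ L²(S)` is the trace on the `(d-1)`-simplex `S` of the function `f ∈ H¹(ℝ^d)`: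
it is the limit in `L²(S)` of the restrictions to `S` of test functions that tend to `f` in
`H¹(ℝ^d)`. -/
def HasTrace {d : ℕ} (f : EuclideanSpace ℝ (Fin d) → ℝ)
    (S : Finset (EuclideanSpace ℝ (Fin d))) (g : EuclideanSpace ℝ (Fin d) → ℝ) : Prop :=
  MemLp g 2 (faceMeasure S) ∧
    ∃ u : ℕ → EuclideanSpace ℝ (Fin d) → ℝ,
      (∀ n, ContDiff ℝ (⊤ : ℕ∞) (u n) ∧ HasCompactSupport (u n)) ∧
      Tendsto (fun n => sobolevENorm 1 (fun x => u n x - f x)) atTop (𝓝 0) ∧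
      Tendsto (fun n => eLpNorm (fun x => u n x - g x) 2 (faceMeasure S)) atTop (𝓝 0)

/-- A Scott-Zhang choice of faces: each vertex `z` is assigned a `(d-1)`-dimensional face `F z`
of the mesh that contains `z` and that lies in `∂D` if `z` does. -/
structure IsFaceChoice {d : ℕ} (D : Set (EuclideanSpace ℝ (Fin d)))
    (K : Geometry.SimplicialComplex ℝ (EuclideanSpace ℝ (Fin d)))
    (F : EuclideanSpace ℝ (Fin d) → Finset (EuclideanSpace ℝ (Fin d))) : Prop where
  mem_faces : ∀ z ∈ K.vertices, F z ∈ K.faces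
  card_eq : ∀ z ∈ K.vertices, (F z).card = d
  mem : ∀ z ∈ K.vertices, z ∈ F z
  boundary : ∀ z ∈ K.vertices, z ∈ frontier D →
    convexHull ℝ (F z : Set (EuclideanSpace ℝ (Fin d))) ⊆ frontier D

/-- `ψ` is the `L²(S)`-dual basis function of the vertex `z` of the `(d-1)`-simplex `S`: an affine
function with `∫_S ψ p = p(z)` for all affine `p`. Since the nodal basis `λ_y`, `y ∈ S`,
spans the affine functions on `S`, this says that `∫_S ψ λ_y` is `1` for `y = z` and `0`
otherwise. -/
def IsDualFunction {d : ℕ} (S : Finset (EuclideanSpace ℝ (Fin d)))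
    (z : EuclideanSpace ℝ (Fin d)) (ψ : EuclideanSpace ℝ (Fin d) →ᵃ[ℝ] ℝ) : Prop :=
  ∀ p : EuclideanSpace ℝ (Fin d) →ᵃ[ℝ] ℝ, ∫ x, ψ x * p x ∂(faceMeasure S) = p z

/-- `w` is the Scott-Zhang interpolant of `v ∈ H¹₀(D)` for the choice of faces `F`: the continuous
piecewise linear function whose value at each vertex `z` is `∫_{F z} ψ_z v`, with the dual basis
function `ψ_z` and the trace of `v` on `F z`. -/
def IsInterpolant {d : ℕ} (D : Set (EuclideanSpace ℝ (Fin d)))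
    (K : Geometry.SimplicialComplex ℝ (EuclideanSpace ℝ (Fin d)))
    (F : EuclideanSpace ℝ (Fin d) → Finset (EuclideanSpace ℝ (Fin d)))
    (v w : EuclideanSpace ℝ (Fin d) → ℝ) : Prop :=
  w ∈ lagrangeSpace K ∧ ∀ z ∈ K.vertices,
    ∃ (g : EuclideanSpace ℝ (Fin d) → ℝ) (ψ : EuclideanSpace ℝ (Fin d) →ᵃ[ℝ] ℝ),
      HasTrace (D.indicator v) (F z) g ∧ IsDualFunction (F z) z ψ ∧
        w z = ∫ x, ψ x * g x ∂(faceMeasure (F z))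

end ScottZhang

end

open scoped SchwartzMap Convolution

/-! ### The Fourier transform on `L¹ ∩ L²` -/

namespace ScottZhang

/-! The function `v` is handled on the Fourier side and the interpolant `w` by elementary geometry
of the mesh. Write `f` for the zero extension of `v` and `h` for the mesh size.

Local approximation. Truncate the transform of `f` to `2π|ξ|h ≤ 1`; let `a` be the real part of the
resulting function and `b` that of its gradient. For each shift `|y| ≤ 6h`, Plancherel turns `x ↦
f(x+y) - a(x) - b(x)y` into a multiplier of size `O((h|ξ|)^β)`: Taylor's formula for the exponential
below the cutoff, a trivial bound above it. So its squared `L²` norm is `O(h^(2β))` times the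
squared `H^β` norm of `f`, and `h` times the gradient error obeys the same bound
(`exists_weakGradient`). Each `x` thus has an affine function `p_x` close to `f` on the ball of
radius `6h`, and the integral over `x` of the local errors is under control.

Nodal values. The functional at `z` reproduces affine functions, so `w(z) - p(z)` is the integral of
`ψ_z (g - p)` with `g` the trace. Cauchy-Schwarz, an inverse inequality for `ψ_z` and a trace
inequality on a cylinder over the face bound it by the local error (`nodal_value_estimate`).
Convexity extends this from vertices to cells, which gives the `L²` error
(`MeshApprox.lintegral_sub_le`).

Stability. Frequencies up to order `1/h` are compared with those of `f`; higher ones are seen by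
second differences with steps `h 2^(-k)` along the coordinate axes (`sobolevENorm_sq_le_secDiff`). A
second difference of `w` with step `y` vanishes unless one of its three points lies within `2|y|` of
the boundary of a cell, a strip of relative volume `O(|y|/h)`. There it is at most a multiple of
`|y|/h` times the local error, because `w - p_x` is Lipschitz along segments. The squared `L²` norm
is therefore `O((|y|/h)³ h^(2β))` times that of `f` in `H^β`. Against the weight `|y|^(-2β)` the
dyadic sum is geometric with ratio `2^(2β-3)`, which is below one exactly when `β < 3/2`
(`MeshApprox.lintegral_secDiff_le`, `MeshApprox.stability`). The errors for `s ∈ [0,1]` follow by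
splitting frequencies at `1/h`.

Boundary. The Lipschitz condition enters in three ways. Exterior balls, on which `f = 0`, control
`p_x` where a segment leaves `D`. A direction transversal to a boundary face and pointing outwards
shows that traces vanish there. Finally, no boundary point is interior to the closure of `D`, so
that each boundary point lies in a mesh face with all vertices on the boundary, and `w` vanishes
there. -/

/-- Euclidean `d`-space. -/
abbrev Eu (d : ℕ) := EuclideanSpace ℝ (Fin d)

variable {d : ℕ}

/-- Both sides define the same tempered distribution: the `L²` transform agrees with the
distributional one, and for integrable functions the transform can be moved from one factor of a
pairing to the other. Testing with smooth compactly supported functions identifies them. This links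
the Plancherel transform in `sobolevENorm` to Fourier integrals. -/
theorem fourier_toLp_ae_eq {φ : Eu d → ℂ} (h1 : Integrable φ)
    (h2 : MemLp φ 2) :
    (𝓕 (h2.toLp φ) : Lp ℂ 2 (volume : Measure (Eu d))) =ᵐ[volume] 𝓕 φ := by
  have hcont : Continuous (𝓕 φ) :=
    VectorFourier.fourierIntegral_continuous Real.continuous_fourierChar
      (innerSL ℝ).continuous₂ h1
  refine ae_eq_of_integral_contDiff_smul_eq
    ((Lp.memLp _).locallyIntegrable (by norm_num)) hcont.locallyIntegrable ?_
  intro g hg hgc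
  have hg1 : HasCompactSupport (fun x => (g x : ℂ)) := hgc.comp_left Complex.ofReal_zero
  have hg2 : ContDiff ℝ (⊤ : ℕ∞) (fun x => (g x : ℂ)) :=
    Complex.ofRealCLM.contDiff.comp hg
  set g' : 𝓢(Eu d, ℂ) := hg1.toSchwartzMap hg2 with hg'
  have hgi : Integrable (g' : Eu d → ℂ) := g'.integrable
  have key := congrArg (fun T => T g')
    (Lp.fourier_toTemperedDistribution_eq (h2.toLp φ))
  simp only [TemperedDistribution.fourier_apply, Lp.toTemperedDistribution_apply] at key
  change ∫ x, g' x • (𝓕 (h2.toLp φ) : Lp ℂ 2 (volume : Measure (Eu d))) x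
    = ∫ x, g' x • (𝓕 φ : Eu d → ℂ) x
  calc ∫ x, g' x • (𝓕 (h2.toLp φ) : Lp ℂ 2 (volume : Measure (Eu d))) x
      = ∫ x, (𝓕 g') x • (h2.toLp φ) x := key.symm
    _ = ∫ x, (𝓕 (g' : Eu d → ℂ)) x • φ x := by
        refine integral_congr_ae ?_
        filter_upwards [h2.coeFn_toLp] with x hx
        rw [hx, SchwartzMap.fourier_coe]
    _ = ∫ x, g' x • (𝓕 φ : Eu d → ℂ) x := by
        simpa using! (VectorFourier.integral_fourierIntegral_smul_eq_flip
          (L := innerₗ (Eu d))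
          Real.continuous_fourierChar continuous_inner hgi h1)

/-- The same duality with the sign of the kernel reversed. It gives pointwise meaning to
frequency-truncated functions, which are later translated. -/
theorem fourierInv_toLp_ae_eq {φ : Eu d → ℂ} (h1 : Integrable φ)
    (h2 : MemLp φ 2) :
    (𝓕⁻ (h2.toLp φ) : Lp ℂ 2 (volume : Measure (Eu d))) =ᵐ[volume] 𝓕⁻ φ := by
  have hcont : Continuous (𝓕⁻ φ) :=
    VectorFourier.fourierIntegral_continuous Real.continuous_fourierChar
      (L := (-innerₗ (Eu d))) (by
        exact continuous_inner.neg) h1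
  refine ae_eq_of_integral_contDiff_smul_eq
    ((Lp.memLp _).locallyIntegrable (by norm_num)) hcont.locallyIntegrable ?_
  intro g hg hgc
  have hg1 : HasCompactSupport (fun x => (g x : ℂ)) := hgc.comp_left Complex.ofReal_zero
  have hg2 : ContDiff ℝ (⊤ : ℕ∞) (fun x => (g x : ℂ)) :=
    Complex.ofRealCLM.contDiff.comp hg
  set g' : 𝓢(Eu d, ℂ) := hg1.toSchwartzMap hg2 with hg'
  have hgi : Integrable (g' : Eu d → ℂ) := g'.integrable
  have key := congrArg (fun T => T g')
    (Lp.fourierInv_toTemperedDistribution_eq (h2.toLp φ))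
  simp only [TemperedDistribution.fourierInv_apply, Lp.toTemperedDistribution_apply] at key
  change ∫ x, g' x • (𝓕⁻ (h2.toLp φ) : Lp ℂ 2 (volume : Measure (Eu d))) x
    = ∫ x, g' x • (𝓕⁻ φ : Eu d → ℂ) x
  calc ∫ x, g' x • (𝓕⁻ (h2.toLp φ) : Lp ℂ 2 (volume : Measure (Eu d))) x
      = ∫ x, (𝓕⁻ g') x • (h2.toLp φ) x := key.symm
    _ = ∫ x, (𝓕⁻ (g' : Eu d → ℂ)) x • φ x := by
        refine integral_congr_ae ?_
        filter_upwards [h2.coeFn_toLp] with x hx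
        rw [hx, SchwartzMap.fourierInv_coe]
    _ = ∫ x, g' x • (𝓕⁻ φ : Eu d → ℂ) x := by
        have hfl : (-innerₗ (Eu d)).flip
            = -innerₗ (Eu d) := by
          ext x y; simp [real_inner_comm]
        have := (VectorFourier.integral_fourierIntegral_smul_eq_flip
          (L := -innerₗ (Eu d)) (μ := volume) (ν := volume)
          Real.continuous_fourierChar (by
        exact continuous_inner.neg) hgi h1)
        rw [hfl] at this
        exact this

end ScottZhang

/-! ### Sobolev norms -/

namespace ScottZhang

variable {d : ℕ}

theorem Lp_lintegral_enorm_sq {X : Type*} [MeasurableSpace X] {μ : Measure X} (Φ : Lp ℂ 2 μ) :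
    ∫⁻ x, ‖Φ x‖ₑ ^ 2 ∂μ = ‖Φ‖ₑ ^ 2 := by
  rw [Lp.enorm_def, eLpNorm_eq_lintegral_rpow_enorm_toReal (by norm_num) (by norm_num)]
  simp only [ENNReal.toReal_ofNat, one_div]
  rw [← ENNReal.rpow_natCast, ← ENNReal.rpow_mul]
  norm_num

theorem lintegral_enorm_sq_fourier (Φ : Lp ℂ 2 (volume : Measure (Eu d))) :
    ∫⁻ x, ‖(𝓕 Φ : Lp ℂ 2 (volume : Measure (Eu d))) x‖ₑ ^ 2 = ∫⁻ x, ‖Φ x‖ₑ ^ 2 := by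
  rw [Lp_lintegral_enorm_sq, Lp_lintegral_enorm_sq, ← ofReal_norm, ← ofReal_norm,
    Lp.norm_fourier_eq]

theorem lintegral_enorm_sq_fourierInv (Φ : Lp ℂ 2 (volume : Measure (Eu d))) :
    ∫⁻ x, ‖(𝓕⁻ Φ : Lp ℂ 2 (volume : Measure (Eu d))) x‖ₑ ^ 2 = ∫⁻ x, ‖Φ x‖ₑ ^ 2 := by
  rw [← lintegral_enorm_sq_fourier, FourierTransform.fourier_fourierInv_eq]

theorem memLp_two_of_lintegral_lt_top {X F : Type*} [MeasurableSpace X] {μ : Measure X}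
    [NormedAddCommGroup F] {f : X → F} (hf : AEStronglyMeasurable f μ)
    (h : ∫⁻ x, ‖f x‖ₑ ^ 2 ∂μ < ∞) : MemLp f 2 μ := by
  refine ⟨hf, (eLpNorm_lt_top_iff_lintegral_rpow_enorm_lt_top (by norm_num) (by norm_num)).2 ?_⟩
  simpa using h

theorem MemLp.lintegral_sq_lt_top {X F : Type*} [MeasurableSpace X] {μ : Measure X}
    [NormedAddCommGroup F] {f : X → F} (hf : MemLp f 2 μ) : ∫⁻ x, ‖f x‖ₑ ^ 2 ∂μ < ∞ := by
  simpa using (eLpNorm_lt_top_iff_lintegral_rpow_enorm_lt_top (by norm_num) (by norm_num)).1 hf.2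

theorem memLp_ofReal_iff {X : Type*} [MeasurableSpace X] {μ : Measure X} {f : X → ℝ} :
    MemLp (fun x => (f x : ℂ)) 2 μ ↔ MemLp f 2 μ := by
  refine ⟨fun h => ?_, fun h => h.ofReal⟩
  simpa using h.re

theorem sobolevENorm_sq {r : ℝ} {f : Eu d → ℝ} (hf : MemLp (fun x => (f x : ℂ)) 2) :
    sobolevENorm r f ^ 2 = ∫⁻ ξ, ENNReal.ofReal ((1 + (2 * Real.pi * ‖ξ‖) ^ 2) ^ r) *
      ‖(𝓕 (hf.toLp (fun x => (f x : ℂ))) : Lp ℂ 2 (volume : Measure (Eu d))) ξ‖ₑ ^ 2 := by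
  unfold sobolevENorm
  rw [dif_pos hf, ← ENNReal.rpow_natCast, ← ENNReal.rpow_mul]
  norm_num

theorem memLp_of_sobolevENorm_lt_top {r : ℝ} {f : Eu d → ℝ} (hf : sobolevENorm r f < ∞) :
    MemLp (fun x => (f x : ℂ)) 2 := by
  by_contra h
  simp [sobolevENorm, h] at hf

theorem lintegral_fourier_toLp {f : Eu d → ℝ} (hf : MemLp (fun x => (f x : ℂ)) 2) :
    ∫⁻ ξ, ‖(𝓕 (hf.toLp (fun x => (f x : ℂ))) : Lp ℂ 2 (volume : Measure (Eu d))) ξ‖ₑ ^ 2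
      = ∫⁻ x, ‖f x‖ₑ ^ 2 := by
  rw [lintegral_enorm_sq_fourier]
  refine lintegral_congr_ae ?_
  filter_upwards [hf.coeFn_toLp] with x hx
  rw [hx, ← ofReal_norm, ← ofReal_norm, Complex.norm_real]

/-- The threshold is `1 + x² = h⁻²`. Below it the first summand dominates; above it `h² (1 + x²) ≥
1` may be raised to the power `β - s`. -/
theorem one_add_sq_rpow_le {h s β x : ℝ} (hh : 0 < h) (hs : 0 ≤ s) (hsβ : s ≤ β) :
    (1 + x ^ 2) ^ s ≤ (h ^ 2) ^ (-s) + (h ^ 2) ^ (β - s) * (1 + x ^ 2) ^ β := by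
  have h1 : 0 < 1 + x ^ 2 := by positivity
  rcases le_total (1 + x ^ 2) ((h ^ 2)⁻¹) with hx | hx
  · have : (1 + x ^ 2) ^ s ≤ (h ^ 2) ^ (-s) := by
      rw [Real.rpow_neg (by positivity), ← Real.inv_rpow (by positivity)]
      exact Real.rpow_le_rpow h1.le hx hs
    have h3 : 0 ≤ (h ^ 2) ^ (β - s) * (1 + x ^ 2) ^ β := by positivity
    linarith
  · have : (1 + x ^ 2) ^ s ≤ (h ^ 2) ^ (β - s) * (1 + x ^ 2) ^ β := by
      have e : (1 + x ^ 2) ^ β = (1 + x ^ 2) ^ (β - s) * (1 + x ^ 2) ^ s := by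
        rw [← Real.rpow_add h1]; ring_nf
      rw [e, ← mul_assoc, ← Real.mul_rpow (by positivity) h1.le]
      have : 1 ≤ (h ^ 2 * (1 + x ^ 2)) ^ (β - s) := by
        apply Real.one_le_rpow _ (by linarith)
        have := mul_le_mul_of_nonneg_left hx (by positivity : 0 ≤ h ^ 2)
        rwa [mul_inv_cancel₀ (by positivity)] at this
      exact le_mul_of_one_le_left (by positivity) this
    have h3 : 0 ≤ (h ^ 2) ^ (-s) := by positivity
    linarith

/-- Interpolation between `L²` and `H^β` with a scale parameter `h`. -/
theorem sobolevENorm_sq_le_interp {h s β : ℝ} (hh : 0 < h) (hs : 0 ≤ s) (hsβ : s ≤ β)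
    {g : Eu d → ℝ} (hg : MemLp (fun x => (g x : ℂ)) 2) :
    sobolevENorm s g ^ 2 ≤ ENNReal.ofReal ((h ^ 2) ^ (-s)) * (∫⁻ x, ‖g x‖ₑ ^ 2) +
      ENNReal.ofReal ((h ^ 2) ^ (β - s)) * sobolevENorm β g ^ 2 := by
  rw [sobolevENorm_sq hg, sobolevENorm_sq hg, ← lintegral_fourier_toLp hg,
    ← lintegral_const_mul' _ _ ENNReal.ofReal_ne_top,
    ← lintegral_const_mul' _ _ ENNReal.ofReal_ne_top, ← lintegral_add_left']
  · refine lintegral_mono fun ξ => ?_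
    simp only
    rw [← mul_assoc, ← add_mul, ← ENNReal.ofReal_mul (by positivity),
      ← ENNReal.ofReal_add (by positivity) (by positivity)]
    gcongr
    exact one_add_sq_rpow_le hh hs hsβ
  · exact ((Lp.aestronglyMeasurable _).enorm.pow_const 2).const_mul _

/-- A quadratic Taylor bound valid for all real `θ`: the series gives it for `|θ| ≤ 1`, and beyond
that the triangle inequality gives `2|θ| ≤ 2θ²`. -/
theorem norm_exp_I_sub_one_sub_le (θ : ℝ) :
    ‖Complex.exp (Complex.I * θ) - 1 - Complex.I * θ‖ ≤ 2 * θ ^ 2 := by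
  have hn : ‖Complex.I * (θ : ℂ)‖ = |θ| := by simp
  rcases le_total |θ| 1 with h | h
  · have := Complex.norm_exp_sub_one_sub_id_le (x := Complex.I * θ) (by rw [hn]; exact h)
    rw [hn, sq_abs] at this
    nlinarith [sq_nonneg θ]
  · have h1 := Real.norm_exp_I_mul_ofReal_sub_one_le (x := θ)
    calc _ ≤ ‖Complex.exp (Complex.I * θ) - 1‖ + ‖Complex.I * (θ : ℂ)‖ := norm_sub_le _ _
      _ ≤ |θ| + |θ| := by rw [hn]; exact add_le_add h1 le_rfl
      _ ≤ 2 * θ ^ 2 := by rw [← sq_abs θ]; nlinarith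

theorem norm_clm_sq_le_sum (L : Eu d →L[ℝ] ℝ) :
    ‖L‖ ^ 2 ≤ ∑ j, (L (EuclideanSpace.single j 1)) ^ 2 := by
  have hL : ‖L‖ ≤ √(∑ j, (L (EuclideanSpace.single j 1)) ^ 2) := by
    refine L.opNorm_le_bound (Real.sqrt_nonneg _) fun x => ?_
    have hx : x = ∑ j, x j • EuclideanSpace.single j (1 : ℝ) := by
      ext i; simp [Finset.sum_apply, Pi.single_apply]
    have : L x = ∑ j, x j * L (EuclideanSpace.single j 1) := by
      conv_lhs => rw [hx]
      simp [map_sum]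
    rw [this, EuclideanSpace.norm_eq, mul_comm, Real.norm_eq_abs]
    simp only [Real.norm_eq_abs, sq_abs]
    rw [← Real.sqrt_mul (Finset.sum_nonneg fun i _ => sq_nonneg _)]
    exact Real.abs_le_sqrt (Finset.sum_mul_sq_le_sq_mul_sq _ _ _)
  calc ‖L‖ ^ 2 ≤ (√(∑ j, (L (EuclideanSpace.single j 1)) ^ 2)) ^ 2 := by gcongr
    _ = _ := Real.sq_sqrt (Finset.sum_nonneg fun i _ => sq_nonneg _)

theorem enorm_clm_sq_le_sum (L : Eu d →L[ℝ] ℝ) :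
    ‖L‖ₑ ^ 2 ≤ ∑ j, ‖L (EuclideanSpace.single j 1)‖ₑ ^ 2 := by
  simp_rw [← ofReal_norm, ← ENNReal.ofReal_pow (norm_nonneg _)]
  rw [← ENNReal.ofReal_sum_of_nonneg (fun i _ => by positivity)]
  apply ENNReal.ofReal_le_ofReal
  simpa using norm_clm_sq_le_sum L

theorem fourierInv_translate (ψ : Eu d → ℂ) (x y : Eu d) :
    (𝓕⁻ ψ : Eu d → ℂ) (x - y) = (𝓕⁻ (fun ξ => Complex.exp (Complex.I *
      ((-(2 * Real.pi * inner ℝ ξ y) : ℝ))) * ψ ξ) : Eu d → ℂ) x := by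
  rw [Real.fourierInv_eq', Real.fourierInv_eq']
  congr 1
  ext v
  simp only [smul_eq_mul]
  rw [← mul_assoc, ← Complex.exp_add]
  congr 2
  rw [inner_sub_right]
  push_cast
  ring

end ScottZhang

/-! ### Symbols of derivatives and cutoffs -/

namespace ScottZhang

variable {d : ℕ}

/-- Plancherel for a difference in which only the second function is an honest Fourier integral; `Φ`
need not be integrable. -/
theorem lintegral_fourierInv_sub {Φ : Eu d → ℂ} (hΦ : MemLp Φ 2) {ψ : Eu d → ℂ}
    (h1 : Integrable ψ) (h2 : MemLp ψ 2) :
    ∫⁻ x, ‖(𝓕⁻ (hΦ.toLp Φ) : Lp ℂ 2 (volume : Measure (Eu d))) x - (𝓕⁻ ψ : Eu d → ℂ) x‖ₑ ^ 2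
      = ∫⁻ ξ, ‖Φ ξ - ψ ξ‖ₑ ^ 2 := by
  have e1 : ∫⁻ x, ‖(𝓕⁻ (hΦ.toLp Φ) : Lp ℂ 2 (volume : Measure (Eu d))) x
      - (𝓕⁻ ψ : Eu d → ℂ) x‖ₑ ^ 2 =
      ∫⁻ x, ‖(𝓕⁻ (hΦ.toLp Φ - h2.toLp ψ) : Lp ℂ 2 (volume : Measure (Eu d))) x‖ₑ ^ 2 := by
    refine lintegral_congr_ae ?_
    have hsub : (𝓕⁻ (hΦ.toLp Φ - h2.toLp ψ) : Lp ℂ 2 (volume : Measure (Eu d))) =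
        𝓕⁻ (hΦ.toLp Φ) - 𝓕⁻ (h2.toLp ψ) :=
      (Lp.fourierTransformₗᵢ (Eu d) ℂ).symm.map_sub _ _
    filter_upwards [fourierInv_toLp_ae_eq h1 h2, Lp.coeFn_sub
      (𝓕⁻ (hΦ.toLp Φ) : Lp ℂ 2 (volume : Measure (Eu d))) (𝓕⁻ (h2.toLp ψ))] with x hx hx2
    rw [hsub, hx2, Pi.sub_apply, hx]
  rw [e1, lintegral_enorm_sq_fourierInv]
  refine lintegral_congr_ae ?_
  filter_upwards [hΦ.coeFn_toLp, h2.coeFn_toLp, Lp.coeFn_sub (hΦ.toLp Φ) (h2.toLp ψ)]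
    with x hx hx2 hx3
  rw [hx3, Pi.sub_apply, hx, hx2]

/-- The gradient multiplier `2πiξ_j`. -/
noncomputable def gradSymbol (j : Fin d) (ξ : Eu d) : ℂ := Complex.I * ((2 * Real.pi * ξ j : ℝ))

theorem continuous_gradSymbol (j : Fin d) : Continuous (gradSymbol j) := by
  unfold gradSymbol
  fun_prop

theorem sum_enorm_gradSymbol_sq (ξ : Eu d) :
    ∑ j, ‖gradSymbol j ξ‖ₑ ^ 2 = ENNReal.ofReal ((2 * Real.pi * ‖ξ‖) ^ 2) := by
  have : ∀ j, ‖gradSymbol j ξ‖ₑ ^ 2 = ENNReal.ofReal ((2 * Real.pi * ξ j) ^ 2) := by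
    intro j
    rw [← ofReal_norm, ← ENNReal.ofReal_pow (norm_nonneg _), gradSymbol, norm_mul,
      Complex.norm_I, one_mul, Complex.norm_real, Real.norm_eq_abs, sq_abs]
  simp_rw [this]
  rw [← ENNReal.ofReal_sum_of_nonneg (fun i _ => sq_nonneg _)]
  congr 1
  simp_rw [mul_pow]
  rw [← Finset.mul_sum, EuclideanSpace.norm_sq_eq]
  simp

theorem fourier_ofReal_fderiv {u : Eu d → ℝ} (hu : ContDiff ℝ (⊤ : ℕ∞) u)
    (hc : HasCompactSupport u) (j : Fin d) (ξ : Eu d) :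
    (𝓕 (fun x => ((fderiv ℝ u x (EuclideanSpace.single j 1) : ℝ) : ℂ)) : Eu d → ℂ) ξ
      = gradSymbol j ξ * (𝓕 (fun x => (u x : ℂ)) : Eu d → ℂ) ξ := by
  set U : Eu d → ℂ := fun x => (u x : ℂ) with hU
  have hUs : ContDiff ℝ (⊤ : ℕ∞) U := Complex.ofRealCLM.contDiff.comp hu
  have hUc : HasCompactSupport U := hc.comp_left Complex.ofReal_zero
  have hUd : Differentiable ℝ U := hUs.differentiable (by simp)
  have hUi : Integrable U := hUs.continuous.integrable_of_hasCompactSupport hUc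
  have hfc : Continuous (fderiv ℝ U) := hUs.continuous_fderiv (by simp)
  have hfi : Integrable (fderiv ℝ U) :=
    hfc.integrable_of_hasCompactSupport (hUc.fderiv (𝕜 := ℝ))
  have hder : ∀ x, ((fderiv ℝ u x (EuclideanSpace.single j 1) : ℝ) : ℂ)
      = fderiv ℝ U x (EuclideanSpace.single j 1) := by
    intro x
    have h1 : HasFDerivAt u (fderiv ℝ u x) x := (hu.differentiable (by simp) x).hasFDerivAt
    have h2 : HasFDerivAt U (Complex.ofRealCLM.comp (fderiv ℝ u x)) x :=
      (Complex.ofRealCLM.hasFDerivAt (x := u x)).comp x h1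
    rw [h2.fderiv]
    rfl
  simp_rw [hder]
  rw [← Real.fourier_continuousLinearMap_apply hfi, Real.fourier_fderiv hUi hUd hfi]
  have hin : innerSL ℝ ξ (EuclideanSpace.single j (1 : ℝ)) = ξ j := by
    rw [innerSL_apply_apply, EuclideanSpace.inner_single_right]; simp
  simp only [VectorFourier.fourierSMulRight_apply, gradSymbol, neg_apply, smul_eq_mul]
  simp [hin]
  ring

/-- The `j`-th partial derivative in `L²` of a function in `H¹`, given by its Fourier transform
`Φ`. -/
theorem memLp_gradSymbol_mul {Φ : Eu d → ℂ} (hΦ : AEStronglyMeasurable Φ volume)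
    (h : ∫⁻ ξ, ENNReal.ofReal ((2 * Real.pi * ‖ξ‖) ^ 2) * ‖Φ ξ‖ₑ ^ 2 < ∞) (j : Fin d) :
    MemLp (fun ξ => gradSymbol j ξ * Φ ξ) 2 := by
  refine memLp_two_of_lintegral_lt_top
    ((continuous_gradSymbol j).aestronglyMeasurable.mul hΦ) (lt_of_le_of_lt ?_ h)
  refine lintegral_mono fun ξ => ?_
  simp only
  rw [enorm_mul, mul_pow, ← sum_enorm_gradSymbol_sq]
  gcongr
  exact Finset.single_le_sum (f := fun j => ‖gradSymbol j ξ‖ₑ ^ 2) (fun _ _ => zero_le)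
    (Finset.mem_univ j)

/-- The linear functional with given coordinates. -/
noncomputable def clmOfCoord (c : Fin d → ℝ) : Eu d →L[ℝ] ℝ :=
  ∑ j, c j • (EuclideanSpace.proj j : Eu d →L[ℝ] ℝ)

theorem clmOfCoord_apply (c : Fin d → ℝ) (y : Eu d) : clmOfCoord c y = ∑ j, c j * y j := by
  simp [clmOfCoord]

theorem clmOfCoord_single (c : Fin d → ℝ) (i : Fin d) :
    clmOfCoord c (EuclideanSpace.single i 1) = c i := by
  simp [clmOfCoord_apply]

theorem measurable_clmOfCoord {c : Eu d → Fin d → ℝ} (hc : ∀ j, Measurable fun x => c x j) :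
    Measurable fun x => clmOfCoord (c x) := by
  unfold clmOfCoord
  exact Finset.measurable_sum _ fun j _ => (hc j).smul_const _

theorem enorm_re_le (z : ℂ) : ‖z.re‖ₑ ≤ ‖z‖ₑ := by
  rw [← ofReal_norm, ← ofReal_norm]
  exact ENNReal.ofReal_le_ofReal (Complex.abs_re_le_norm z)

/-- Here `t` stands for `2π|ξ|h` and `θ` for the phase of a shift. Below the cutoff the symbol is,
up to a unimodular factor, a second-order Taylor remainder, so its square is at most `4R⁴t⁴`, and `β
≤ 2` allows `t⁴ ≤ t^(2β)`. Above the cutoff it equals one, which `t^(2β)` dominates. -/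
theorem cutoff_symbol_bound {R t θ β : ℝ} (hR : 1 ≤ R) (ht : 0 ≤ t) (hβ : 0 ≤ β) (hβ2 : β ≤ 2)
    (hθ : |θ| ≤ R * t) :
    ‖1 - (if t ≤ 1 then Complex.exp (Complex.I * ((-θ : ℝ))) * (1 + Complex.I * θ) else 0)‖ ^ 2
      ≤ 4 * R ^ 4 * t ^ (2 * β) := by
  have hR4 : 1 ≤ R ^ 4 := one_le_pow₀ hR
  split_ifs with h
  · have e : (1 : ℂ) - Complex.exp (Complex.I * ((-θ : ℝ))) * (1 + Complex.I * θ) =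
        Complex.exp (Complex.I * ((-θ : ℝ))) *
          (Complex.exp (Complex.I * θ) - 1 - Complex.I * θ) := by
      have : Complex.exp (Complex.I * ((-θ : ℝ))) * Complex.exp (Complex.I * θ) = 1 := by
        rw [← Complex.exp_add]; simp
      linear_combination -this
    have hn : ‖Complex.exp (Complex.I * ((-θ : ℝ)))‖ = 1 := by
      rw [mul_comm]; exact Complex.norm_exp_ofReal_mul_I _
    rw [e, norm_mul, hn, one_mul]
    have h1 : θ ^ 2 ≤ (R * t) ^ 2 := by rw [← sq_abs θ]; gcongr
    calc ‖Complex.exp (Complex.I * θ) - 1 - Complex.I * θ‖ ^ 2 ≤ (2 * (R * t) ^ 2) ^ 2 := by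
          gcongr; exact (norm_exp_I_sub_one_sub_le θ).trans (by linarith)
      _ = 4 * R ^ 4 * t ^ 4 := by ring
      _ ≤ 4 * R ^ 4 * t ^ (2 * β) := by
          gcongr
          rw [← Real.rpow_natCast]
          rcases ht.eq_or_lt with rfl | ht
          · rcases hβ.eq_or_lt with rfl | hβ
            · norm_num
            · rw [Real.zero_rpow (by norm_num), Real.zero_rpow (by positivity)]
          · exact Real.rpow_le_rpow_of_exponent_ge ht h (by push_cast; linarith)
  · rw [sub_zero, norm_one, one_pow]
    have : 1 ≤ t ^ (2 * β) := Real.one_le_rpow (by linarith) (by linarith)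
    nlinarith

/-- One order less of Taylor expansion, compensated by the factor `t²` of the gradient. Above the
cutoff `t² ≤ t^(2β)` requires `β ≥ 1`. -/
theorem cutoff_grad_bound {R t θ β : ℝ} (hR : 1 ≤ R) (ht : 0 ≤ t) (hβ : 1 ≤ β) (hβ2 : β ≤ 2)
    (hθ : |θ| ≤ R * t) :
    t ^ 2 * ‖1 - (if t ≤ 1 then Complex.exp (Complex.I * ((-θ : ℝ))) else 0)‖ ^ 2
      ≤ 4 * R ^ 4 * t ^ (2 * β) := by
  have hR4 : 1 ≤ R ^ 4 := one_le_pow₀ hR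
  split_ifs with h
  · have hn : ‖(1 : ℂ) - Complex.exp (Complex.I * ((-θ : ℝ)))‖ ≤ R * t := by
      rw [norm_sub_rev]
      refine Real.norm_exp_I_mul_ofReal_sub_one_le.trans ?_
      simpa using hθ
    have hR2 : R ^ 2 ≤ R ^ 4 := pow_le_pow_right₀ hR (by norm_num)
    calc t ^ 2 * ‖(1 : ℂ) - Complex.exp (Complex.I * ((-θ : ℝ)))‖ ^ 2 ≤ t ^ 2 * (R * t) ^ 2 := by
          gcongr
      _ = R ^ 2 * t ^ 4 := by ring
      _ ≤ 4 * R ^ 4 * t ^ 4 := by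
          have : 0 ≤ t ^ 4 := by positivity
          nlinarith
      _ ≤ 4 * R ^ 4 * t ^ (2 * β) := by
          gcongr
          rw [← Real.rpow_natCast]
          rcases ht.eq_or_lt with rfl | ht
          · rw [Real.zero_rpow (by norm_num), Real.zero_rpow (by positivity)]
          · exact Real.rpow_le_rpow_of_exponent_ge ht h (by push_cast; linarith)
  · rw [sub_zero, norm_one, one_pow, mul_one]
    have : t ^ 2 ≤ t ^ (2 * β) := by
      rw [← Real.rpow_natCast]
      exact Real.rpow_le_rpow_of_exponent_le (by linarith) (by push_cast; linarith)
    have h0 : 0 ≤ t ^ (2 * β) := by positivity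
    nlinarith

end ScottZhang

/-! ### Weak gradients and first order approximations -/

namespace ScottZhang

variable {d : ℕ}

theorem sum_mul_gradSymbol (ξ y : Eu d) :
    ∑ j, (y j : ℂ) * gradSymbol j ξ = Complex.I * ((2 * Real.pi * inner ℝ ξ y : ℝ) : ℂ) := by
  have h : (inner ℝ ξ y : ℝ) = ∑ j, y j * ξ j := by simp [PiLp.inner_apply]
  rw [h, Finset.mul_sum]
  push_cast
  rw [Finset.mul_sum]
  refine Finset.sum_congr rfl fun j _ => ?_
  simp only [gradSymbol]
  push_cast
  ring

set_option maxHeartbeats 1000000 in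
/-- `G` is the weak gradient of `f`, in the sense that it is the `L²`-limit of the gradients of
test functions tending to `f` in `H¹`, with affine approximations of `f` at each scale. -/
theorem exists_weakGradient {f : Eu d → ℝ} (hf : MemLp (fun x => (f x : ℂ)) 2)
    (hf1 : sobolevENorm 1 f < ∞) :
    ∃ G : Eu d → (Eu d →L[ℝ] ℝ), Measurable G ∧
      (∀ u : Eu d → ℝ, ContDiff ℝ (⊤ : ℕ∞) u → HasCompactSupport u →
        ∫⁻ x, ‖fderiv ℝ u x - G x‖ₑ ^ 2 ≤ sobolevENorm 1 (fun x => u x - f x) ^ 2) ∧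
      ∀ (β R h : ℝ), 1 ≤ β → β ≤ 2 → 1 ≤ R → 0 < h →
        ∃ (a : Eu d → ℝ) (b : Eu d → (Eu d →L[ℝ] ℝ)), Measurable a ∧ Measurable b ∧
          ∀ y, ‖y‖ ≤ R * h →
            ∫⁻ x, ‖f (x + y) - a x - b x y‖ₑ ^ 2 ≤
              ENNReal.ofReal (4 * R ^ 4 * h ^ (2 * β)) * sobolevENorm β f ^ 2 ∧
            ∫⁻ x, ‖G (x + y) - b x‖ₑ ^ 2 ≤
              ENNReal.ofReal (4 * R ^ 4 * h ^ (2 * β - 2)) * sobolevENorm β f ^ 2 := by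
  set Φ : Lp ℂ 2 (volume : Measure (Eu d)) := 𝓕 (hf.toLp (fun x => (f x : ℂ))) with hΦ
  have hΦm : MemLp (Φ : Eu d → ℂ) 2 := Lp.memLp Φ
  have hfin : ∫⁻ ξ, ENNReal.ofReal ((2 * Real.pi * ‖ξ‖) ^ 2) * ‖Φ ξ‖ₑ ^ 2 < ∞ := by
    refine lt_of_le_of_lt ?_ (ENNReal.pow_lt_top hf1 : sobolevENorm 1 f ^ 2 < ∞)
    rw [sobolevENorm_sq hf]
    refine lintegral_mono fun ξ => ?_
    simp only [Real.rpow_one]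
    gcongr
    linarith
  have hg := memLp_gradSymbol_mul hΦm.1 hfin
  -- The partial derivatives of `f`, as `L²` inverse transforms. Below only real parts are used:
  -- passing to them cannot increase an error against a real function, so the inverse transforms
  -- need not be shown to be real.
  set g : Fin d → Lp ℂ 2 (volume : Measure (Eu d)) := fun j =>
    (𝓕⁻ ((hg j).toLp _) : Lp ℂ 2 (volume : Measure (Eu d))) with hgdef
  have hgm : ∀ j, Measurable fun x => (g j x).re := fun j =>
    Complex.measurable_re.comp (Lp.stronglyMeasurable (g j)).measurable
  set G : Eu d → (Eu d →L[ℝ] ℝ) := fun x => clmOfCoord fun j => (g j x).re with hG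
  have hGmeas : Measurable G := measurable_clmOfCoord hgm
  have hΦinv : (𝓕⁻ ((hΦm).toLp (Φ : Eu d → ℂ)) : Lp ℂ 2 (volume : Measure (Eu d)))
      =ᵐ[volume] fun x => (f x : ℂ) := by
    rw [Lp.toLp_coeFn, hΦ, FourierTransform.fourierInv_fourier_eq]
    exact hf.coeFn_toLp
  refine ⟨G, hGmeas, ?_, ?_⟩
  · intro u hu hc
    have hU2 : MemLp (fun x => (u x : ℂ)) 2 :=
      memLp_ofReal_iff.2 (hu.continuous.memLp_of_hasCompactSupport hc)
    have hU1 : Integrable (fun x => (u x : ℂ)) :=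
      (hu.continuous.integrable_of_hasCompactSupport hc).ofReal
    have hdc : ∀ j : Fin d, Continuous fun x => fderiv ℝ u x (EuclideanSpace.single j 1) :=
      fun j => (hu.continuous_fderiv (by simp)).clm_apply continuous_const
    have hds : ∀ j : Fin d, HasCompactSupport fun x => fderiv ℝ u x (EuclideanSpace.single j 1) :=
      fun j => hc.fderiv_apply (𝕜 := ℝ) _
    have hd1 : ∀ j : Fin d, Integrable
        fun x => ((fderiv ℝ u x (EuclideanSpace.single j 1) : ℝ) : ℂ) := fun j =>
      ((hdc j).integrable_of_hasCompactSupport (hds j)).ofReal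
    have hd2 : ∀ j : Fin d, MemLp
        (fun x => ((fderiv ℝ u x (EuclideanSpace.single j 1) : ℝ) : ℂ)) 2 := fun j =>
      memLp_ofReal_iff.2 ((hdc j).memLp_of_hasCompactSupport (hds j))
    have huf : MemLp (fun x => ((u x - f x : ℝ) : ℂ)) 2 := by
      have e : (fun x => ((u x - f x : ℝ) : ℂ)) = (fun x => (u x : ℂ)) - fun x => (f x : ℂ) := by
        ext x; simp
      rw [e]; exact hU2.sub hf
    have hsub : (𝓕 (huf.toLp _) : Lp ℂ 2 (volume : Measure (Eu d)))
        =ᵐ[volume] fun ξ => (𝓕 (fun x => (u x : ℂ)) : Eu d → ℂ) ξ - Φ ξ := by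
      have e : huf.toLp _ = hU2.toLp _ - hf.toLp _ := by
        rw [← MemLp.toLp_sub]
        congr 1
        ext x; simp
      have e2 : (𝓕 (huf.toLp _) : Lp ℂ 2 (volume : Measure (Eu d)))
          = 𝓕 (hU2.toLp _) - Φ := by
        rw [e]; exact (Lp.fourierTransformₗᵢ (Eu d) ℂ).map_sub _ _
      rw [e2]
      filter_upwards [Lp.coeFn_sub (𝓕 (hU2.toLp _) : Lp ℂ 2 (volume : Measure (Eu d))) Φ,
        fourier_toLp_ae_eq hU1 hU2] with ξ h1 h2
      rw [h1, Pi.sub_apply, h2]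
    have hcomp : ∀ j : Fin d,
        ∫⁻ x, ‖fderiv ℝ u x (EuclideanSpace.single j 1) - (g j x).re‖ₑ ^ 2 ≤
        ∫⁻ ξ, ‖gradSymbol j ξ‖ₑ ^ 2 *
          ‖(𝓕 (huf.toLp _) : Lp ℂ 2 (volume : Measure (Eu d))) ξ‖ₑ ^ 2 := by
      intro j
      calc ∫⁻ x, ‖fderiv ℝ u x (EuclideanSpace.single j 1) - (g j x).re‖ₑ ^ 2
          ≤ ∫⁻ x, ‖((hd2 j).toLp _ - g j : Lp ℂ 2 (volume : Measure (Eu d))) x‖ₑ ^ 2 := by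
            refine lintegral_mono_ae ?_
            filter_upwards [(hd2 j).coeFn_toLp, Lp.coeFn_sub ((hd2 j).toLp _) (g j)]
              with x h1 h2
            rw [h2, Pi.sub_apply, h1]
            gcongr
            refine le_trans (le_of_eq ?_) (enorm_re_le _)
            simp
        _ = ∫⁻ ξ, ‖(𝓕 ((hd2 j).toLp _) - (hg j).toLp _ :
              Lp ℂ 2 (volume : Measure (Eu d))) ξ‖ₑ ^ 2 := by
            rw [← lintegral_enorm_sq_fourier]
            have : (𝓕 ((hd2 j).toLp _ - g j) : Lp ℂ 2 (volume : Measure (Eu d)))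
                = 𝓕 ((hd2 j).toLp _) - 𝓕 (g j) :=
              (Lp.fourierTransformₗᵢ (Eu d) ℂ).map_sub _ _
            rw [this, hgdef]
            simp only [FourierTransform.fourier_fourierInv_eq]
        _ = _ := by
            refine lintegral_congr_ae ?_
            filter_upwards [hsub, (hg j).coeFn_toLp, fourier_toLp_ae_eq (hd1 j) (hd2 j),
              Lp.coeFn_sub (𝓕 ((hd2 j).toLp _) : Lp ℂ 2 (volume : Measure (Eu d)))
                ((hg j).toLp _)] with ξ h1 h2 h3 h4
            rw [h4, Pi.sub_apply, h3, h2, h1, fourier_ofReal_fderiv hu hc, ← mul_sub, enorm_mul,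
              mul_pow]
    calc ∫⁻ x, ‖fderiv ℝ u x - G x‖ₑ ^ 2
        ≤ ∫⁻ x, ∑ j, ‖fderiv ℝ u x (EuclideanSpace.single j 1) - (g j x).re‖ₑ ^ 2 := by
          refine lintegral_mono fun x => ?_
          refine (enorm_clm_sq_le_sum _).trans (le_of_eq ?_)
          simp only [sub_apply, hG, clmOfCoord_single]
      _ = ∑ j, ∫⁻ x, ‖fderiv ℝ u x (EuclideanSpace.single j 1) - (g j x).re‖ₑ ^ 2 := by
          refine lintegral_finsetSum _ fun j _ => ?_
          exact (((hdc j).measurable.sub (hgm j)).enorm).pow_const 2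
      _ ≤ ∑ j, ∫⁻ ξ, ‖gradSymbol j ξ‖ₑ ^ 2 *
          ‖(𝓕 (huf.toLp _) : Lp ℂ 2 (volume : Measure (Eu d))) ξ‖ₑ ^ 2 :=
          Finset.sum_le_sum fun j _ => hcomp j
      _ = ∫⁻ ξ, ∑ j, ‖gradSymbol j ξ‖ₑ ^ 2 *
          ‖(𝓕 (huf.toLp _) : Lp ℂ 2 (volume : Measure (Eu d))) ξ‖ₑ ^ 2 := by
          refine (lintegral_finsetSum _ fun j _ => ?_).symm
          exact (((continuous_gradSymbol j).measurable.enorm).pow_const 2).mul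
            ((Lp.stronglyMeasurable _).measurable.enorm.pow_const 2)
      _ ≤ _ := by
          rw [sobolevENorm_sq huf]
          refine lintegral_mono fun ξ => ?_
          simp only
          rw [← Finset.sum_mul, sum_enorm_gradSymbol_sq, Real.rpow_one]
          gcongr
          linarith
  · intro β R h hβ hβ2 hR hh
    -- The frequencies up to `1/h`. They form a bounded set, so the truncated symbols are integrable
    -- and their inverse transforms are continuous functions that can be shifted pointwise.
    set S : Set (Eu d) := {ξ | 2 * Real.pi * ‖ξ‖ * h ≤ 1} with hS
    have hSm : MeasurableSet S :=
      measurableSet_le (by fun_prop) measurable_const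
    have hSb : S ⊆ Metric.closedBall 0 (1 / (2 * Real.pi * h)) := by
      intro ξ hξ
      rw [mem_closedBall_zero_iff, le_div_iff₀ (by positivity)]
      have : 2 * Real.pi * ‖ξ‖ * h ≤ 1 := hξ
      linarith
    have hSf : volume S < ∞ := (measure_mono hSb).trans_lt measure_closedBall_lt_top
    have hind : ∀ {ψ : Eu d → ℂ}, MemLp ψ 2 →
        MemLp (S.indicator ψ) 2 ∧ Integrable (S.indicator ψ) := by
      intro ψ hψ
      have h1 : MemLp (S.indicator ψ) 2 := hψ.indicator hSm
      refine ⟨h1, ?_⟩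
      rw [integrable_indicator_iff hSm]
      have : IsFiniteMeasure (volume.restrict S) := ⟨by simpa using hSf⟩
      exact memLp_one_iff_integrable.1 ((hψ.restrict S).mono_exponent (by norm_num))
    set ψ0 : Eu d → ℂ := S.indicator Φ with hψ0
    set ψ : Fin d → Eu d → ℂ := fun j => S.indicator (fun ξ => gradSymbol j ξ * Φ ξ) with hψ
    have hψ0m := hind hΦm
    have hψm := fun j => hind (hg j)
    have hcont : ∀ {φ : Eu d → ℂ}, Integrable φ → Continuous (𝓕⁻ φ : Eu d → ℂ) := by
      intro φ h1
      exact VectorFourier.fourierIntegral_continuous Real.continuous_fourierChar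
        (L := (-innerₗ (Eu d))) continuous_inner.neg h1
    set a : Eu d → ℝ := fun x => ((𝓕⁻ ψ0 : Eu d → ℂ) x).re with ha
    set b : Eu d → (Eu d →L[ℝ] ℝ) := fun x => clmOfCoord fun j => ((𝓕⁻ (ψ j) : Eu d → ℂ) x).re
      with hb
    have hbm : ∀ j, Measurable fun x => ((𝓕⁻ (ψ j) : Eu d → ℂ) x).re := fun j =>
      Complex.measurable_re.comp (hcont (hψm j).2).measurable
    refine ⟨a, b, Complex.measurable_re.comp (hcont hψ0m.2).measurable,
      measurable_clmOfCoord hbm, ?_⟩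
    intro y hy
    -- the phase
    set θ : Eu d → ℝ := fun ξ => 2 * Real.pi * inner ℝ ξ y with hθ
    set e : Eu d → ℂ := fun ξ => Complex.exp (Complex.I * ((-(2 * Real.pi * inner ℝ ξ y) : ℝ)))
      with he
    have hec : Continuous e := by simp only [he]; fun_prop
    have hen : ∀ ξ, ‖e ξ‖ = 1 := fun ξ => by
      simp only [he]; rw [mul_comm]; exact Complex.norm_exp_ofReal_mul_I _
    have hemul : ∀ {φ : Eu d → ℂ}, (MemLp φ 2 ∧ Integrable φ) →
        MemLp (fun ξ => e ξ * φ ξ) 2 ∧ Integrable (fun ξ => e ξ * φ ξ) := by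
      intro φ hφ
      refine ⟨hφ.1.of_le (hec.aestronglyMeasurable.mul hφ.1.1) (ae_of_all _ fun ξ => ?_),
        hφ.2.mono (hec.aestronglyMeasurable.mul hφ.1.1) (ae_of_all _ fun ξ => ?_)⟩ <;>
      rw [norm_mul, hen, one_mul]
    have hθb : ∀ ξ, |θ ξ| ≤ R * (2 * Real.pi * ‖ξ‖ * h) := by
      intro ξ
      have h1 : |inner ℝ ξ y| ≤ ‖ξ‖ * ‖y‖ := abs_real_inner_le_norm ξ y
      have h2 : ‖ξ‖ * ‖y‖ ≤ ‖ξ‖ * (R * h) := by gcongr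
      simp only [hθ]
      rw [abs_mul, abs_of_pos (by positivity)]
      calc 2 * Real.pi * |inner ℝ ξ y| ≤ 2 * Real.pi * (‖ξ‖ * (R * h)) := by
            gcongr; exact h1.trans h2
        _ = _ := by ring
    have hpow : ∀ ξ : Eu d, (2 * Real.pi * ‖ξ‖ * h) ^ (2 * β) ≤
        h ^ (2 * β) * (1 + (2 * Real.pi * ‖ξ‖) ^ 2) ^ β := by
      intro ξ
      rw [Real.mul_rpow (by positivity) hh.le, mul_comm]
      gcongr
      rw [Real.rpow_mul (by positivity)]
      refine Real.rpow_le_rpow (by positivity) ?_ (by linarith)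
      rw [Real.rpow_two]; linarith
    constructor
    · have hψy : ∀ j, MemLp (fun ξ => (y j : ℂ) * ψ j ξ) 2 ∧ Integrable fun ξ => (y j : ℂ) * ψ j ξ :=
        fun j => ⟨(hψm j).1.const_mul _, (hψm j).2.const_mul _⟩
      -- The inverse transform of `χ` has real part `a + b y`; the phase `e` then shifts it by `y`.
      set χ : Eu d → ℂ := fun ξ => ψ0 ξ + ∑ j, (y j : ℂ) * ψ j ξ with hχ
      have hχm : MemLp χ 2 ∧ Integrable χ :=
        ⟨hψ0m.1.add (memLp_finsetSum _ fun j _ => (hψy j).1),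
          hψ0m.2.add (integrable_finsetSum _ fun j _ => (hψy j).2)⟩
      have hpt : ∀ x, ((𝓕⁻ (fun ξ => e ξ * χ ξ) : Eu d → ℂ) x).re = a (x - y) + b (x - y) y := by
        intro x
        rw [← fourierInv_translate]
        have hadd : (𝓕⁻ χ : Eu d → ℂ) (x - y) = (𝓕⁻ ψ0 : Eu d → ℂ) (x - y)
            + ∑ j, (y j : ℂ) * (𝓕⁻ (ψ j) : Eu d → ℂ) (x - y) := by
          simp only [Real.fourierInv_eq', smul_eq_mul, hχ]
          have hexpi : ∀ {φ : Eu d → ℂ}, Integrable φ → Integrable fun v : Eu d =>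
              Complex.exp (((2 * Real.pi * inner ℝ v (x - y) : ℝ) : ℂ) * Complex.I) * φ v := by
            intro φ hφ
            refine hφ.mono ((Continuous.aestronglyMeasurable (by fun_prop)).mul hφ.1)
              (ae_of_all _ fun v => ?_)
            rw [norm_mul, Complex.norm_exp_ofReal_mul_I, one_mul]
          simp_rw [mul_add, Finset.mul_sum]
          rw [integral_add (hexpi hψ0m.2) (integrable_finsetSum _ fun j _ => hexpi (hψy j).2),
            integral_finsetSum _ fun j _ => hexpi (hψy j).2]
          congr 1
          refine Finset.sum_congr rfl fun j _ => ?_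
          rw [← integral_const_mul]
          congr 1
          ext v
          ring
        rw [hadd]
        simp only [ha, hb, clmOfCoord_apply, Complex.add_re, Complex.re_sum, Complex.re_ofReal_mul]
        congr 1
        exact Finset.sum_congr rfl fun j _ => mul_comm _ _
      calc ∫⁻ x, ‖f (x + y) - a x - b x y‖ₑ ^ 2
          = ∫⁻ x, ‖f x - a (x - y) - b (x - y) y‖ₑ ^ 2 := by
            rw [← lintegral_sub_right_eq_self (fun x => ‖f (x + y) - a x - b x y‖ₑ ^ 2) y]
            simp
        _ ≤ ∫⁻ x, ‖(𝓕⁻ (hΦm.toLp Φ) : Lp ℂ 2 (volume : Measure (Eu d))) x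
              - (𝓕⁻ (fun ξ => e ξ * χ ξ) : Eu d → ℂ) x‖ₑ ^ 2 := by
            refine lintegral_mono_ae ?_
            filter_upwards [hΦinv] with x hx
            rw [hx, sub_sub, ← hpt x]
            gcongr
            refine le_trans (le_of_eq ?_) (enorm_re_le _)
            simp
        _ = ∫⁻ ξ, ‖Φ ξ - e ξ * χ ξ‖ₑ ^ 2 :=
            lintegral_fourierInv_sub hΦm (hemul hχm).2 (hemul hχm).1
        _ ≤ ∫⁻ ξ, ENNReal.ofReal (4 * R ^ 4 * h ^ (2 * β)) *
            (ENNReal.ofReal ((1 + (2 * Real.pi * ‖ξ‖) ^ 2) ^ β) * ‖Φ ξ‖ₑ ^ 2) := by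
            refine lintegral_mono fun ξ => ?_
            have hid : Φ ξ - e ξ * χ ξ = (1 - (if 2 * Real.pi * ‖ξ‖ * h ≤ 1 then
                Complex.exp (Complex.I * ((-θ ξ : ℝ))) * (1 + Complex.I * θ ξ) else 0)) * Φ ξ := by
              have hsum : ∑ j, (y j : ℂ) * gradSymbol j ξ = Complex.I * θ ξ :=
                sum_mul_gradSymbol ξ y
              by_cases hm : ξ ∈ S
              · have hm' : 2 * Real.pi * ‖ξ‖ * h ≤ 1 := hm
                simp only [hχ, hψ0, hψ, indicator_of_mem hm, if_pos hm', he]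
                simp_rw [← mul_assoc]
                rw [← Finset.sum_mul, hsum]
                ring
              · have hm' : ¬ 2 * Real.pi * ‖ξ‖ * h ≤ 1 := hm
                simp only [hχ, hψ0, hψ, indicator_of_notMem hm, if_neg hm']
                simp
            rw [hid, enorm_mul, mul_pow, ← mul_assoc, ← ENNReal.ofReal_mul (by positivity)]
            gcongr
            rw [← ofReal_norm, ← ENNReal.ofReal_pow (norm_nonneg _)]
            apply ENNReal.ofReal_le_ofReal
            refine (cutoff_symbol_bound hR (by positivity) (by linarith) hβ2 (hθb ξ)).trans ?_
            rw [mul_assoc (4 * R ^ 4)]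
            gcongr
            exact hpow ξ
        _ = _ := by
            rw [lintegral_const_mul' _ _ ENNReal.ofReal_ne_top, sobolevENorm_sq hf]
    · calc ∫⁻ x, ‖G (x + y) - b x‖ₑ ^ 2
          = ∫⁻ x, ‖G x - b (x - y)‖ₑ ^ 2 := by
            rw [← lintegral_sub_right_eq_self (fun x => ‖G (x + y) - b x‖ₑ ^ 2) y]
            simp
        _ ≤ ∫⁻ x, ∑ j, ‖g j x - (𝓕⁻ (fun ξ => e ξ * ψ j ξ) : Eu d → ℂ) x‖ₑ ^ 2 := by
            refine lintegral_mono fun x => ?_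
            refine (enorm_clm_sq_le_sum _).trans (Finset.sum_le_sum fun j _ => ?_)
            simp only [sub_apply, hG, hb, clmOfCoord_single]
            gcongr
            rw [← fourierInv_translate]
            refine le_trans (le_of_eq ?_) (enorm_re_le _)
            simp
        _ = ∑ j, ∫⁻ x, ‖g j x - (𝓕⁻ (fun ξ => e ξ * ψ j ξ) : Eu d → ℂ) x‖ₑ ^ 2 := by
            refine lintegral_finsetSum _ fun j _ => ?_
            exact ((Lp.stronglyMeasurable _).measurable.sub
              (hcont (hemul (hψm j)).2).measurable).enorm.pow_const 2
        _ = ∑ j, ∫⁻ ξ, ‖gradSymbol j ξ * Φ ξ - e ξ * ψ j ξ‖ₑ ^ 2 :=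
            Finset.sum_congr rfl fun j _ =>
              lintegral_fourierInv_sub (hg j) (hemul (hψm j)).2 (hemul (hψm j)).1
        _ = ∫⁻ ξ, ∑ j, ‖gradSymbol j ξ * Φ ξ - e ξ * ψ j ξ‖ₑ ^ 2 := by
            refine (lintegral_finsetSum' _ fun j _ => ?_).symm
            exact (((hg j).1.sub (hemul (hψm j)).1.1).enorm).pow_const 2
        _ ≤ ∫⁻ ξ, ENNReal.ofReal (4 * R ^ 4 * h ^ (2 * β - 2)) *
            (ENNReal.ofReal ((1 + (2 * Real.pi * ‖ξ‖) ^ 2) ^ β) * ‖Φ ξ‖ₑ ^ 2) := by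
            refine lintegral_mono fun ξ => ?_
            have hid : ∀ j, gradSymbol j ξ * Φ ξ - e ξ * ψ j ξ =
                gradSymbol j ξ * ((1 - (if 2 * Real.pi * ‖ξ‖ * h ≤ 1 then
                Complex.exp (Complex.I * ((-θ ξ : ℝ))) else 0)) * Φ ξ) := by
              intro j
              by_cases hm : ξ ∈ S
              · have hm' : 2 * Real.pi * ‖ξ‖ * h ≤ 1 := hm
                simp only [hψ, indicator_of_mem hm, if_pos hm', he, hθ]
                ring
              · have hm' : ¬ 2 * Real.pi * ‖ξ‖ * h ≤ 1 := hm
                simp only [hψ, indicator_of_notMem hm, if_neg hm']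
                ring
            simp_rw [hid, enorm_mul, mul_pow]
            rw [← Finset.sum_mul, sum_enorm_gradSymbol_sq, ← mul_assoc, ← mul_assoc,
              ← ENNReal.ofReal_mul (by positivity)]
            gcongr
            rw [← ofReal_norm, ← ENNReal.ofReal_pow (norm_nonneg _),
              ← ENNReal.ofReal_mul (by positivity)]
            apply ENNReal.ofReal_le_ofReal
            have hc := cutoff_grad_bound (t := 2 * Real.pi * ‖ξ‖ * h) hR (by positivity) hβ hβ2
              (hθb ξ)
            -- The symbol bound contains `t² = (2π|ξ|h)²` instead of the square of the gradient
            -- symbol, hence the loss of `h²`.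
            have hsplit : h ^ (2 * β - 2) = h ^ (2 * β) / h ^ 2 := by
              rw [Real.rpow_sub hh, Real.rpow_two]
            rw [hsplit]
            have h2 := mul_le_mul_of_nonneg_left (hpow ξ) (by positivity : 0 ≤ 4 * R ^ 4)
            rw [mul_div_assoc', div_mul_eq_mul_div, le_div_iff₀ (by positivity)]
            calc _ = (2 * Real.pi * ‖ξ‖ * h) ^ 2 * ‖1 - (if 2 * Real.pi * ‖ξ‖ * h ≤ 1 then
                Complex.exp (Complex.I * ((-θ ξ : ℝ))) else 0)‖ ^ 2 := by ring
              _ ≤ _ := hc.trans h2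
              _ = _ := by ring_nf
        _ = _ := by
            rw [lintegral_const_mul' _ _ ENNReal.ofReal_ne_top, sobolevENorm_sq hf]

end ScottZhang

/-! ### Second differences -/

namespace ScottZhang

variable {d : ℕ}

theorem fourier_toLp_sub_ae {u f : Eu d → ℝ} (hu : MemLp (fun x => (u x : ℂ)) 2)
    (hf : MemLp (fun x => (f x : ℂ)) 2) (huf : MemLp (fun x => ((u x - f x : ℝ) : ℂ)) 2) :
    (𝓕 (huf.toLp _) : Lp ℂ 2 (volume : Measure (Eu d))) =ᵐ[volume] fun ξ =>
      (𝓕 (hu.toLp _) : Lp ℂ 2 (volume : Measure (Eu d))) ξ -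
        (𝓕 (hf.toLp _) : Lp ℂ 2 (volume : Measure (Eu d))) ξ := by
  have e : huf.toLp _ = hu.toLp _ - hf.toLp _ := by
    rw [← MemLp.toLp_sub]
    congr 1
    ext x; simp
  have e2 : (𝓕 (huf.toLp _) : Lp ℂ 2 (volume : Measure (Eu d)))
      = 𝓕 (hu.toLp _) - 𝓕 (hf.toLp _) := by
    rw [e]; exact (Lp.fourierTransformₗᵢ (Eu d) ℂ).map_sub _ _
  rw [e2]
  exact Lp.coeFn_sub _ _

theorem memLp_ofReal_sub {u f : Eu d → ℝ} (hu : MemLp (fun x => (u x : ℂ)) 2)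
    (hf : MemLp (fun x => (f x : ℂ)) 2) : MemLp (fun x => ((u x - f x : ℝ) : ℂ)) 2 := by
  have e : (fun x => ((u x - f x : ℝ) : ℂ)) = (fun x => (u x : ℂ)) - fun x => (f x : ℂ) := by
    ext x; simp
  rw [e]; exact hu.sub hf

theorem integrable_ofReal {X : Type*} [MeasurableSpace X] {μ : Measure X} {f : X → ℝ}
    (hf : Integrable f μ) : Integrable (fun x => (f x : ℂ)) μ :=
  hf.ofReal

/-- The second difference of `w` with step `y`. -/
def secDiff (y : Eu d) (w : Eu d → ℝ) (x : Eu d) : ℝ := w (x + y) - 2 * w x + w (x - y)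

theorem fourier_translate (w : Eu d → ℂ) (y ξ : Eu d) :
    (𝓕 (fun x => w (x + y)) : Eu d → ℂ) ξ =
      Complex.exp (Complex.I * ((2 * Real.pi * inner ℝ ξ y : ℝ))) * (𝓕 w : Eu d → ℂ) ξ := by
  rw [Real.fourier_eq', Real.fourier_eq', ← integral_const_mul,
    ← integral_sub_right_eq_self _ y]
  congr 1
  ext x
  simp only [smul_eq_mul, sub_add_cancel]
  rw [← mul_assoc, ← Complex.exp_add]
  congr 2
  rw [inner_sub_left, real_inner_comm ξ y]
  push_cast
  ring

/-- Shifts by `y` and `-y` multiply the transform by conjugate phases, whose sum is twice a cosine.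
-/
theorem fourier_secDiff {w : Eu d → ℝ} (hw : Integrable w) (y ξ : Eu d) :
    (𝓕 (fun x => ((secDiff y w x : ℝ) : ℂ)) : Eu d → ℂ) ξ =
      ((2 * Real.cos (2 * Real.pi * inner ℝ ξ y) - 2 : ℝ) : ℂ) *
        (𝓕 (fun x => (w x : ℂ)) : Eu d → ℂ) ξ := by
  set W : Eu d → ℂ := fun x => (w x : ℂ) with hW
  have hWi : Integrable W := hw.ofReal
  have h1 : Integrable fun x => W (x + y) := hWi.comp_add_right y
  have h2 : Integrable fun x => W (x + -y) := hWi.comp_add_right (-y)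
  have h3 := fourier_translate W y ξ
  have h4 := fourier_translate W (-y) ξ
  have hexpi : ∀ {φ : Eu d → ℂ}, Integrable φ → Integrable fun v : Eu d =>
      Complex.exp (((-2 * Real.pi * inner ℝ v ξ : ℝ) : ℂ) * Complex.I) * φ v := by
    intro φ hφ
    refine hφ.mono ((Continuous.aestronglyMeasurable (by fun_prop)).mul hφ.1)
      (ae_of_all _ fun v => ?_)
    rw [norm_mul, Complex.norm_exp_ofReal_mul_I, one_mul]
  have e : (𝓕 (fun x => ((secDiff y w x : ℝ) : ℂ)) : Eu d → ℂ) ξ =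
      (𝓕 (fun x => W (x + y)) : Eu d → ℂ) ξ - 2 * (𝓕 W : Eu d → ℂ) ξ +
        (𝓕 (fun x => W (x + -y)) : Eu d → ℂ) ξ := by
    simp only [Real.fourier_eq', smul_eq_mul]
    have hs : Integrable fun v : Eu d =>
        Complex.exp (((-2 * Real.pi * inner ℝ v ξ : ℝ) : ℂ) * Complex.I) * W (v + y) -
        2 * (Complex.exp (((-2 * Real.pi * inner ℝ v ξ : ℝ) : ℂ) * Complex.I) * W v) :=
      (hexpi h1).sub ((hexpi hWi).const_mul 2)
    rw [← integral_const_mul, ← integral_sub (hexpi h1) ((hexpi hWi).const_mul 2),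
      ← integral_add hs (hexpi h2)]
    congr 1
    ext x
    simp only [secDiff, hW]
    rw [sub_eq_add_neg x y]
    push_cast
    ring
  rw [e, h3, h4, inner_neg_right]
  have hcos : Complex.exp (Complex.I * ((2 * Real.pi * inner ℝ ξ y : ℝ))) +
      Complex.exp (Complex.I * ((2 * Real.pi * -inner ℝ ξ y : ℝ))) =
      ((2 * Real.cos (2 * Real.pi * inner ℝ ξ y) : ℝ) : ℂ) := by
    push_cast
    rw [Complex.two_cos]
    congr 1 <;> congr 1 <;> ring
  push_cast at hcos ⊢
  linear_combination (𝓕 W : Eu d → ℂ) ξ * hcos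

theorem memLp_secDiff {w : Eu d → ℝ} (hw : MemLp w 2) (y : Eu d) : MemLp (secDiff y w) 2 := by
  have h1 : ∀ y : Eu d, MemLp (fun x => w (x + y)) 2 := fun y =>
    hw.comp_measurePreserving (measurePreserving_add_right volume y)
  have h2 := h1 (-y)
  simp only [← sub_eq_add_neg] at h2
  exact ((h1 y).sub (hw.const_mul 2)).add h2

theorem integrable_secDiff {w : Eu d → ℝ} (hw : Integrable w) (y : Eu d) :
    Integrable (secDiff y w) :=
  ((hw.comp_add_right y).sub (hw.const_mul 2)).add (hw.comp_sub_right y)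

theorem lintegral_secDiff {w : Eu d → ℝ} (hw : Integrable w) (hw2 : MemLp w 2) (y : Eu d) :
    ∫⁻ x, ‖secDiff y w x‖ₑ ^ 2 = ∫⁻ ξ,
      ENNReal.ofReal ((2 * Real.cos (2 * Real.pi * inner ℝ ξ y) - 2) ^ 2) *
      ‖(𝓕 ((memLp_ofReal_iff.2 hw2).toLp _) : Lp ℂ 2 (volume : Measure (Eu d))) ξ‖ₑ ^ 2 := by
  rw [← lintegral_fourier_toLp (memLp_ofReal_iff.2 (memLp_secDiff hw2 y))]
  refine lintegral_congr_ae ?_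
  filter_upwards [fourier_toLp_ae_eq (integrable_ofReal (integrable_secDiff hw y))
    (memLp_ofReal_iff.2 (memLp_secDiff hw2 y)),
    fourier_toLp_ae_eq (integrable_ofReal hw) (memLp_ofReal_iff.2 hw2)] with ξ h1 h2
  have h3 : (𝓕 (fun x => ((secDiff y w x : ℝ) : ℂ)) : Eu d → ℂ) ξ =
      ((2 * Real.cos (2 * Real.pi * inner ℝ ξ y) - 2 : ℝ) : ℂ) *
        (𝓕 ((memLp_ofReal_iff.2 hw2).toLp _) : Lp ℂ 2 (volume : Measure (Eu d))) ξ := by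
    rw [h2]; exact fourier_secDiff hw y ξ
  rw [h1]
  refine (congrArg (fun z : ℂ => ‖z‖ₑ ^ 2) h3).trans ?_
  simp only
  rw [enorm_mul, mul_pow]
  congr 1
  rw [← ofReal_norm, Complex.norm_real, ← ENNReal.ofReal_pow (norm_nonneg _), Real.norm_eq_abs,
    sq_abs]

/-- Take the `k` with `2^k ≤ 4ha < 2^(k+1)`; it exists because `4ha ≥ 1`. -/
theorem exists_dyadic_step {h a : ℝ} (ha : 1 / 4 ≤ h * a) :
    ∃ k : ℕ, 1 / 4 ≤ h / 2 ^ k * a ∧ h / 2 ^ k * a ≤ 1 / 2 := by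
  obtain ⟨n, h1, h2⟩ := exists_nat_pow_near (x := 4 * (h * a)) (y := (2 : ℝ)) (by linarith)
    (by norm_num)
  refine ⟨n, ?_, ?_⟩
  · rw [div_mul_eq_mul_div, le_div_iff₀ (by positivity)]; linarith
  · rw [div_mul_eq_mul_div, div_le_iff₀ (by positivity)]
    rw [pow_succ] at h2; linarith

/-- The phase lies between `π/2` and `π` in modulus, where the cosine is nonpositive; the square is
then even at least `4`. -/
theorem two_le_cos_symbol {s : ℝ} (h1 : 1 / 4 ≤ |s|) (h2 : |s| ≤ 1 / 2) :
    1 ≤ (2 * Real.cos (2 * Real.pi * s) - 2) ^ 2 := by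
  have hc : Real.cos (2 * Real.pi * |s|) ≤ 0 := by
    apply Real.cos_nonpos_of_pi_div_two_le_of_le <;> nlinarith [Real.pi_pos]
  have hc2 : Real.cos (2 * Real.pi * s) = Real.cos (2 * Real.pi * |s|) := by
    rw [← Real.cos_abs (2 * Real.pi * s), abs_mul, abs_of_pos (by positivity : 0 < 2 * Real.pi)]
  rw [hc2]
  nlinarith

/-- Frequencies are either at most of order `1/h`, or seen by a dyadic second difference. -/
theorem weight_cases (hd : 1 ≤ d) {β h : ℝ} (hβ : 0 ≤ β) (hh : 0 < h) (hh1 : h ≤ 1) (ξ : Eu d) :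
    (1 + (2 * Real.pi * ‖ξ‖) ^ 2) ^ β ≤ (1 + Real.pi ^ 2 * d) ^ β * (h ^ 2) ^ (-β) ∨
    ∃ (j : Fin d) (k : ℕ), (1 + (2 * Real.pi * ‖ξ‖) ^ 2) ^ β ≤
      (1 + Real.pi ^ 2 * d) ^ β * (((h / 2 ^ k) ^ 2) ^ (-β) *
      (2 * Real.cos (2 * Real.pi *
        inner ℝ ξ ((h / 2 ^ k) • EuclideanSpace.single j (1 : ℝ))) - 2) ^ 2) := by
  have : Nonempty (Fin d) := ⟨⟨0, hd⟩⟩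
  -- The largest coordinate carries at least `|ξ|/√d`, so differences along the axes suffice.
  obtain ⟨j, hj⟩ := Finite.exists_max fun j => |ξ j|
  have hn : ‖ξ‖ ^ 2 ≤ d * |ξ j| ^ 2 := by
    rw [EuclideanSpace.norm_sq_eq]
    calc ∑ i, ‖ξ i‖ ^ 2 ≤ ∑ _i : Fin d, |ξ j| ^ 2 :=
          Finset.sum_le_sum fun i _ => by
            rw [Real.norm_eq_abs]
            exact pow_le_pow_left₀ (abs_nonneg _) (hj i) 2
      _ = _ := by simp
  -- Here `(2π|ξ|t)² ≤ π²d`, and `t ≤ 1` absorbs the remaining summand `1`: this is the origin of `1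
  -- + π²d`.
  have key : ∀ t : ℝ, 0 < t → t ≤ 1 → t * |ξ j| ≤ 1 / 2 →
      (1 + (2 * Real.pi * ‖ξ‖) ^ 2) ^ β ≤ (1 + Real.pi ^ 2 * d) ^ β * (t ^ 2) ^ (-β) := by
    intro t ht ht1 hle
    rw [Real.rpow_neg (by positivity), ← Real.inv_rpow (by positivity),
      ← Real.mul_rpow (by positivity) (by positivity)]
    refine Real.rpow_le_rpow (by positivity) ?_ hβ
    rw [← div_eq_mul_inv, le_div_iff₀ (by positivity)]
    have h1 : (t * |ξ j|) ^ 2 ≤ (1 / 2) ^ 2 := pow_le_pow_left₀ (by positivity) hle 2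
    have h2 : t ^ 2 ≤ 1 := pow_le_one₀ ht.le ht1
    have h3 : ‖ξ‖ ^ 2 * t ^ 2 ≤ d * (1 / 4) := by
      calc ‖ξ‖ ^ 2 * t ^ 2 ≤ (d * |ξ j| ^ 2) * t ^ 2 := by gcongr
        _ = d * (t * |ξ j|) ^ 2 := by ring
        _ ≤ d * (1 / 4) := by gcongr; linarith
    have h4 : Real.pi ^ 2 * (‖ξ‖ ^ 2 * t ^ 2) ≤ Real.pi ^ 2 * (d * (1 / 4)) := by gcongr
    nlinarith
  by_cases hcase : h * |ξ j| < 1 / 4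
  · exact Or.inl (key h hh hh1 (by linarith))
  · obtain ⟨k, h1, h2⟩ := exists_dyadic_step (not_lt.1 hcase)
    refine Or.inr ⟨j, k, ?_⟩
    have ht : 0 < h / 2 ^ k := by positivity
    have ht1 : h / 2 ^ k ≤ 1 := (div_le_self hh.le (one_le_pow₀ (by norm_num))).trans hh1
    refine (key _ ht ht1 h2).trans ?_
    gcongr
    refine le_mul_of_one_le_right (by positivity) ?_
    have hin : inner ℝ ξ ((h / 2 ^ k) • EuclideanSpace.single j (1 : ℝ)) = h / 2 ^ k * ξ j := by
      rw [inner_smul_right, EuclideanSpace.inner_single_right]; simp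
    rw [hin]
    apply two_le_cos_symbol <;> rw [abs_mul, abs_of_pos ht] <;> assumption

theorem enorm_sq_le_two_mul (a b : ℂ) : ‖a‖ₑ ^ 2 ≤ 2 * ‖a - b‖ₑ ^ 2 + 2 * ‖b‖ₑ ^ 2 := by
  have h : ‖a‖ ^ 2 ≤ 2 * ‖a - b‖ ^ 2 + 2 * ‖b‖ ^ 2 := by
    have h1 : ‖a‖ ≤ ‖a - b‖ + ‖b‖ := by simpa using norm_add_le (a - b) b
    nlinarith [norm_nonneg a, norm_nonneg b, norm_nonneg (a - b), sq_nonneg (‖a - b‖ - ‖b‖)]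
  simp_rw [← ofReal_norm, ← ENNReal.ofReal_pow (norm_nonneg _)]
  rw [← ENNReal.ofReal_ofNat 2, ← ENNReal.ofReal_mul (by norm_num),
    ← ENNReal.ofReal_mul (by norm_num), ← ENNReal.ofReal_add (by positivity) (by positivity)]
  exact ENNReal.ofReal_le_ofReal h

/-- The `H^β` norm of `w` is controlled by an `H^β` function close to `w` at scale `h` and by second
differences below the scale `h`. -/
theorem sobolevENorm_sq_le_secDiff (hd : 1 ≤ d) {β h : ℝ} (hβ : 0 ≤ β) (hh : 0 < h) (hh1 : h ≤ 1)
    {w f : Eu d → ℝ} (hw : Integrable w) (hw2 : MemLp w 2)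
    (hf : MemLp (fun x => (f x : ℂ)) 2) :
    sobolevENorm β w ^ 2 ≤ ENNReal.ofReal (2 * (1 + Real.pi ^ 2 * d) ^ β) *
      (ENNReal.ofReal ((h ^ 2) ^ (-β)) * (∫⁻ x, ‖w x - f x‖ₑ ^ 2) + sobolevENorm β f ^ 2 +
      ∑ j, ∑' k : ℕ, ENNReal.ofReal (((h / 2 ^ k) ^ 2) ^ (-β)) *
        ∫⁻ x, ‖secDiff ((h / 2 ^ k) • EuclideanSpace.single j (1 : ℝ)) w x‖ₑ ^ 2) := by
  have hwC := memLp_ofReal_iff.2 hw2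
  have hwf := memLp_ofReal_sub hwC hf
  set C : ℝ := (1 + Real.pi ^ 2 * d) ^ β with hC
  have hC1 : 1 ≤ C := Real.one_le_rpow (by
    have : 0 ≤ Real.pi ^ 2 * d := by positivity
    linarith) hβ
  set W : Eu d → ℂ := ((𝓕 (hwC.toLp _) : Lp ℂ 2 (volume : Measure (Eu d))) : Eu d → ℂ) with hW
  set Fh : Eu d → ℂ := ((𝓕 (hf.toLp _) : Lp ℂ 2 (volume : Measure (Eu d))) : Eu d → ℂ) with hF
  have hWm : Measurable W := (Lp.stronglyMeasurable _).measurable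
  have hFm : Measurable Fh := (Lp.stronglyMeasurable _).measurable
  have hwfI : ∫⁻ x, ‖w x - f x‖ₑ ^ 2 = ∫⁻ ξ, ‖W ξ - Fh ξ‖ₑ ^ 2 := by
    rw [← lintegral_fourier_toLp hwf]
    refine lintegral_congr_ae ?_
    filter_upwards [fourier_toLp_sub_ae hwC hf hwf] with ξ hξ
    rw [hξ]
  set A : Fin d → ℕ → Eu d → ℝ := fun j k ξ => ((h / 2 ^ k) ^ 2) ^ (-β) *
      (2 * Real.cos (2 * Real.pi *
        inner ℝ ξ ((h / 2 ^ k) • EuclideanSpace.single j (1 : ℝ))) - 2) ^ 2 with hA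
  have hAm : ∀ j k, Measurable fun ξ => ENNReal.ofReal (A j k ξ) * ‖W ξ‖ₑ ^ 2 := by
    intro j k
    have : Continuous (A j k) := by simp only [hA]; fun_prop
    exact (ENNReal.measurable_ofReal.comp this.measurable).mul (hWm.enorm.pow_const 2)
  have hterm : ∀ (j : Fin d) (k : ℕ), ENNReal.ofReal (((h / 2 ^ k) ^ 2) ^ (-β)) *
        ∫⁻ x, ‖secDiff ((h / 2 ^ k) • EuclideanSpace.single j (1 : ℝ)) w x‖ₑ ^ 2 =
        ∫⁻ ξ, ENNReal.ofReal (A j k ξ) * ‖W ξ‖ₑ ^ 2 := by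
    intro j k
    rw [lintegral_secDiff hw hw2, ← lintegral_const_mul' _ _ ENNReal.ofReal_ne_top]
    refine lintegral_congr fun ξ => ?_
    rw [← mul_assoc, ← ENNReal.ofReal_mul (by positivity)]
  simp_rw [hterm]
  rw [sobolevENorm_sq hwC, sobolevENorm_sq hf, hwfI]
  have hsum : ∑ j, ∑' k : ℕ, ∫⁻ ξ, ENNReal.ofReal (A j k ξ) * ‖W ξ‖ₑ ^ 2 =
      ∫⁻ ξ, ∑ j, ∑' k : ℕ, ENNReal.ofReal (A j k ξ) * ‖W ξ‖ₑ ^ 2 := by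
    rw [lintegral_finsetSum _ fun j _ => Measurable.tsum fun k => hAm j k]
    refine Finset.sum_congr rfl fun j _ => ?_
    rw [lintegral_tsum fun k => (hAm j k).aemeasurable]
  have hm1 : Measurable fun ξ => ENNReal.ofReal ((h ^ 2) ^ (-β)) * ‖W ξ - Fh ξ‖ₑ ^ 2 :=
    ((hWm.sub hFm).enorm.pow_const 2).const_mul _
  rw [hsum, ← lintegral_const_mul' _ _ ENNReal.ofReal_ne_top, ← lintegral_add_left hm1, ← lintegral_add_right _
    (Finset.measurable_sum _ fun j _ => Measurable.tsum fun k => hAm j k),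
    ← lintegral_const_mul' _ _ ENNReal.ofReal_ne_top]
  refine lintegral_mono fun ξ => ?_
  simp only
  have h2C : ENNReal.ofReal (2 * C) = 2 * ENNReal.ofReal C := by
    rw [ENNReal.ofReal_mul (by norm_num)]; simp
  have h1C : 1 ≤ ENNReal.ofReal C := by simpa using ENNReal.ofReal_le_ofReal hC1
  -- At a low frequency `W` is split as `(W - Fh) + Fh`; at a high one a single term of the double
  -- sum already dominates.
  rcases weight_cases hd hβ hh hh1 ξ with hlow | ⟨j, k, hjk⟩
  · calc ENNReal.ofReal ((1 + (2 * Real.pi * ‖ξ‖) ^ 2) ^ β) * ‖W ξ‖ₑ ^ 2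
        ≤ ENNReal.ofReal ((1 + (2 * Real.pi * ‖ξ‖) ^ 2) ^ β) *
          (2 * ‖W ξ - Fh ξ‖ₑ ^ 2 + 2 * ‖Fh ξ‖ₑ ^ 2) := by
          gcongr; exact enorm_sq_le_two_mul _ _
      _ = 2 * (ENNReal.ofReal ((1 + (2 * Real.pi * ‖ξ‖) ^ 2) ^ β) * ‖W ξ - Fh ξ‖ₑ ^ 2) +
          2 * (1 * (ENNReal.ofReal ((1 + (2 * Real.pi * ‖ξ‖) ^ 2) ^ β) * ‖Fh ξ‖ₑ ^ 2)) := by ring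
      _ ≤ 2 * (ENNReal.ofReal (C * (h ^ 2) ^ (-β)) * ‖W ξ - Fh ξ‖ₑ ^ 2) +
          2 * (ENNReal.ofReal C *
            (ENNReal.ofReal ((1 + (2 * Real.pi * ‖ξ‖) ^ 2) ^ β) * ‖Fh ξ‖ₑ ^ 2)) := by
          gcongr
      _ = ENNReal.ofReal (2 * C) * (ENNReal.ofReal ((h ^ 2) ^ (-β)) * ‖W ξ - Fh ξ‖ₑ ^ 2 +
          ENNReal.ofReal ((1 + (2 * Real.pi * ‖ξ‖) ^ 2) ^ β) * ‖Fh ξ‖ₑ ^ 2) := by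
          rw [h2C, ENNReal.ofReal_mul (by positivity)]; ring
      _ ≤ _ := mul_le_mul' le_rfl le_self_add
  · calc ENNReal.ofReal ((1 + (2 * Real.pi * ‖ξ‖) ^ 2) ^ β) * ‖W ξ‖ₑ ^ 2
        ≤ ENNReal.ofReal (C * A j k ξ) * ‖W ξ‖ₑ ^ 2 := by gcongr
      _ = ENNReal.ofReal C * (ENNReal.ofReal (A j k ξ) * ‖W ξ‖ₑ ^ 2) := by
          rw [ENNReal.ofReal_mul (by positivity), mul_assoc]
      _ ≤ ENNReal.ofReal (2 * C) * (∑ j, ∑' k : ℕ, ENNReal.ofReal (A j k ξ) * ‖W ξ‖ₑ ^ 2) := by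
          gcongr
          · linarith
          · refine le_trans (ENNReal.le_tsum k) (Finset.single_le_sum
              (f := fun j => ∑' k : ℕ, ENNReal.ofReal (A j k ξ) * ‖W ξ‖ₑ ^ 2)
              (fun _ _ => zero_le) (Finset.mem_univ j))
      _ ≤ _ := mul_le_mul' le_rfl le_add_self

end ScottZhang

/-! ### Mollification -/

namespace ScottZhang

variable {d : ℕ}

theorem integrable_of_memLp_two_of_bounded {f : Eu d → ℝ} {D : Set (Eu d)} (hf : MemLp f 2)
    (hD : Bornology.IsBounded D) (hfD : ∀ x ∉ D, f x = 0) : Integrable f := by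
  obtain ⟨R, hR⟩ := hD.subset_closedBall 0
  have hfin : IsFiniteMeasure (volume.restrict (Metric.closedBall (0 : Eu d) R)) :=
    ⟨by simpa using measure_closedBall_lt_top⟩
  have h1 : IntegrableOn f (Metric.closedBall 0 R) :=
    memLp_one_iff_integrable.1 ((hf.restrict _).mono_exponent (by norm_num))
  refine h1.integrable_of_forall_notMem_eq_zero fun x hx => hfD x fun h => hx (hR h)

/-- Since `φ` is a probability density, the difference is an average of `e^(iτ) - 1` over phases `τ`
with `|τ| ≤ 2πr|ξ|`. -/
theorem norm_fourier_sub_one_le {φ : Eu d → ℝ} {r : ℝ} (hφ : Integrable φ) (h0 : ∀ x, 0 ≤ φ x)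
    (h1 : ∫ x, φ x = 1) (hr : ∀ x, φ x ≠ 0 → ‖x‖ ≤ r) (ξ : Eu d) :
    ‖(𝓕 (fun x => (φ x : ℂ)) : Eu d → ℂ) ξ - 1‖ ≤ 2 * Real.pi * r * ‖ξ‖ := by
  have hφC : Integrable fun x => (φ x : ℂ) := integrable_ofReal hφ
  have hI : Integrable fun v : Eu d =>
      Complex.exp (((-2 * Real.pi * inner ℝ v ξ : ℝ) : ℂ) * Complex.I) * (φ v : ℂ) := by
    refine hφC.mono ((Continuous.aestronglyMeasurable (by fun_prop)).mul hφC.1)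
      (ae_of_all _ fun v => ?_)
    rw [norm_mul, Complex.norm_exp_ofReal_mul_I, one_mul]
  have hone : (1 : ℂ) = ∫ x, (φ x : ℂ) := by rw [integral_complex_ofReal, h1]; simp
  rw [Real.fourier_eq', hone]
  simp only [smul_eq_mul]
  rw [← integral_sub hI hφC]
  calc ‖∫ v, (Complex.exp (((-2 * Real.pi * inner ℝ v ξ : ℝ) : ℂ) * Complex.I) * (φ v : ℂ)
        - (φ v : ℂ))‖ ≤ ∫ v, 2 * Real.pi * r * ‖ξ‖ * φ v := by
        refine norm_integral_le_of_norm_le (hφ.const_mul _) (ae_of_all _ fun v => ?_)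
        have e : Complex.exp (((-2 * Real.pi * inner ℝ v ξ : ℝ) : ℂ) * Complex.I) * (φ v : ℂ)
            - (φ v : ℂ) = (Complex.exp (Complex.I * ((-2 * Real.pi * inner ℝ v ξ : ℝ) : ℂ)) - 1) *
              (φ v : ℂ) := by rw [mul_comm Complex.I]; ring
        rw [e, norm_mul, Complex.norm_real, Real.norm_of_nonneg (h0 v)]
        by_cases hv : φ v = 0
        · simp [hv]
        · refine mul_le_mul_of_nonneg_right ?_ (h0 v)
          refine Real.norm_exp_I_mul_ofReal_sub_one_le.trans ?_
          rw [Real.norm_eq_abs, abs_mul, abs_mul, abs_neg, abs_two, abs_of_pos Real.pi_pos]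
          calc 2 * Real.pi * |inner ℝ v ξ| ≤ 2 * Real.pi * (‖v‖ * ‖ξ‖) := by
                gcongr; exact abs_real_inner_le_norm v ξ
            _ ≤ 2 * Real.pi * (r * ‖ξ‖) := by gcongr; exact hr v hv
            _ = _ := by ring
    _ = _ := by rw [integral_const_mul, h1, mul_one]

theorem norm_fourier_le_one {φ : Eu d → ℝ} (h0 : ∀ x, 0 ≤ φ x)
    (h1 : ∫ x, φ x = 1) (ξ : Eu d) : ‖(𝓕 (fun x => (φ x : ℂ)) : Eu d → ℂ) ξ‖ ≤ 1 := by
  refine (VectorFourier.norm_fourierIntegral_le_integral_norm _ _ _ _ _).trans (le_of_eq ?_)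
  rw [← h1]
  congr 1
  ext x
  rw [Complex.norm_real, Real.norm_of_nonneg (h0 x)]

/-- Mollification of an `H¹` function that vanishes outside a bounded set. -/
theorem exists_mollification {f : Eu d → ℝ} {D : Set (Eu d)} (hD : Bornology.IsBounded D)
    (hfD : ∀ x ∉ D, f x = 0) (hf1 : sobolevENorm 1 f < ∞) :
    ∃ u : ℕ → Eu d → ℝ, (∀ n, ContDiff ℝ (⊤ : ℕ∞) (u n) ∧ HasCompactSupport (u n)) ∧
      Tendsto (fun n => sobolevENorm 1 (fun x => u n x - f x)) atTop (𝓝 0) ∧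
      ∀ x ∉ closure D, ∀ᶠ n in atTop, u n =ᶠ[𝓝 x] 0 := by
  have hf := memLp_of_sobolevENorm_lt_top hf1
  have hf2 : MemLp f 2 := memLp_ofReal_iff.1 hf
  have hfi : Integrable f := integrable_of_memLp_two_of_bounded hf2 hD hfD
  have hfc : HasCompactSupport f := by
    obtain ⟨R, hR⟩ := hD.subset_closedBall 0
    exact HasCompactSupport.intro (isCompact_closedBall 0 R) fun x hx => hfD x fun h => hx (hR h)
  set φ : ℕ → ContDiffBump (0 : Eu d) := fun n =>
    ⟨1 / (2 * (n + 1)), 1 / (n + 1), by positivity, by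
      rw [div_lt_div_iff₀ (by positivity) (by positivity)]
      have : (0 : ℝ) ≤ n := by positivity
      linarith⟩ with hφ
  set η : ℕ → Eu d → ℝ := fun n => (φ n).normed volume with hη
  have hη0 : ∀ n x, 0 ≤ η n x := fun n x => (φ n).nonneg_normed x
  have hη1 : ∀ n, ∫ x, η n x = 1 := fun n => (φ n).integral_normed
  have hηs : ∀ n, ContDiff ℝ (⊤ : ℕ∞) (η n) := fun n => (φ n).contDiff_normed
  have hηc : ∀ n, HasCompactSupport (η n) := fun n => (φ n).hasCompactSupport_normed
  have hηi : ∀ n, Integrable (η n) := fun n => (φ n).integrable_normed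
  have hηr : ∀ n x, η n x ≠ 0 → ‖x‖ < 1 / ((n : ℝ) + 1) := by
    intro n x hx
    have : x ∈ Function.support ((φ n).normed volume) := hx
    rw [(φ n).support_normed_eq] at this
    exact mem_ball_zero_iff.1 this
  set u : ℕ → Eu d → ℝ := fun n => η n ⋆[ContinuousLinearMap.lsmul ℝ ℝ] f with hu
  have hus : ∀ n, ContDiff ℝ (⊤ : ℕ∞) (u n) := fun n =>
    (hηc n).contDiff_convolution_left _ (hηs n) hfi.locallyIntegrable
  have huc : ∀ n, HasCompactSupport (u n) := fun n => (hηc n).convolution _ hfc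
  refine ⟨u, fun n => ⟨hus n, huc n⟩, ?_, ?_⟩
  · have hU2 : ∀ n, MemLp (fun x => (u n x : ℂ)) 2 := fun n =>
      memLp_ofReal_iff.2 ((hus n).continuous.memLp_of_hasCompactSupport (huc n))
    have hU1 : ∀ n, Integrable (fun x => (u n x : ℂ)) := fun n =>
      integrable_ofReal ((hus n).continuous.integrable_of_hasCompactSupport (huc n))
    set Φ : Eu d → ℂ := ((𝓕 (hf.toLp _) : Lp ℂ 2 (volume : Measure (Eu d))) : Eu d → ℂ) with hΦ
    have hΦm : Measurable Φ := (Lp.stronglyMeasurable _).measurable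
    have hΦ1 := fourier_toLp_ae_eq (integrable_ofReal hfi) hf
    -- Mollification multiplies the transform by `m n`, which is bounded by one and tends to one
    -- pointwise. Dominated convergence applies with `|m n - 1|² ≤ 4`.
    set m : ℕ → Eu d → ℂ := fun n => (𝓕 (fun x => (η n x : ℂ)) : Eu d → ℂ) with hm
    have hmc : ∀ n, Continuous (m n) := fun n =>
      VectorFourier.fourierIntegral_continuous Real.continuous_fourierChar
        (innerSL ℝ).continuous₂ (integrable_ofReal (hηi n))
    have hconv : ∀ n ξ, (𝓕 (fun x => (u n x : ℂ)) : Eu d → ℂ) ξ =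
        m n ξ * (𝓕 (fun x => (f x : ℂ)) : Eu d → ℂ) ξ := by
      intro n ξ
      have := Real.fourier_smul_convolution_eq (integrable_ofReal (hηi n))
        (integrable_ofReal hfi) ξ
      rw [smul_eq_mul] at this
      rw [hm, ← this]
      refine congrFun (congrArg _ (funext fun x => ?_)) ξ
      simp only [hu, convolution_def, ContinuousLinearMap.lsmul_apply, smul_eq_mul]
      rw [← integral_complex_ofReal]
      push_cast
      rfl
    have hsq : Tendsto (fun n => sobolevENorm 1 (fun x => u n x - f x) ^ 2) atTop (𝓝 0) := by
      have e : ∀ n, sobolevENorm 1 (fun x => u n x - f x) ^ 2 = ∫⁻ ξ,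
          ENNReal.ofReal (1 + (2 * Real.pi * ‖ξ‖) ^ 2) * (‖m n ξ - 1‖ₑ ^ 2 * ‖Φ ξ‖ₑ ^ 2) := by
        intro n
        rw [sobolevENorm_sq (memLp_ofReal_sub (hU2 n) hf)]
        refine lintegral_congr_ae ?_
        filter_upwards [fourier_toLp_sub_ae (hU2 n) hf (memLp_ofReal_sub (hU2 n) hf),
          fourier_toLp_ae_eq (hU1 n) (hU2 n), hΦ1] with ξ h1 h2 h3
        rw [h1, h2, hconv n, ← h3, Real.rpow_one, ← mul_pow, ← enorm_mul, sub_mul, one_mul]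
      simp_rw [e]
      have hfin : ∫⁻ ξ, 4 * (ENNReal.ofReal (1 + (2 * Real.pi * ‖ξ‖) ^ 2) * ‖Φ ξ‖ₑ ^ 2) ≠ ∞ := by
        rw [lintegral_const_mul' _ _ (by norm_num)]
        refine ENNReal.mul_ne_top (by norm_num) ?_
        have := (ENNReal.pow_lt_top (n := 2) hf1).ne
        rw [sobolevENorm_sq hf] at this
        simpa only [Real.rpow_one] using this
      have h0 : (0 : ℝ≥0∞) = ∫⁻ _ : Eu d, 0 := by simp
      rw [h0]
      refine tendsto_lintegral_of_dominated_convergence _ (fun n => ?_) (fun n => ?_) hfin ?_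
      · exact Measurable.mul (by fun_prop)
          ((((hmc n).measurable.sub_const 1).enorm.pow_const 2).mul (hΦm.enorm.pow_const 2))
      · refine ae_of_all _ fun ξ => ?_
        simp only
        rw [mul_left_comm]
        gcongr
        have h1 : ‖m n ξ - 1‖ ≤ 2 := by
          refine (norm_sub_le _ _).trans ?_
          have := norm_fourier_le_one (hη0 n) (hη1 n) ξ
          rw [norm_one]
          linarith
        rw [← ofReal_norm, ← ENNReal.ofReal_pow (norm_nonneg _)]
        refine (ENNReal.ofReal_le_ofReal (pow_le_pow_left₀ (norm_nonneg _) h1 2)).trans ?_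
        norm_num
      · refine ae_of_all _ fun ξ => ?_
        have hm1 : Tendsto (fun n => m n ξ - 1) atTop (𝓝 0) := by
          refine squeeze_zero_norm (fun n => norm_fourier_sub_one_le (hηi n) (hη0 n) (hη1 n)
            (fun x hx => (hηr n x hx).le) ξ) ?_
          have : Tendsto (fun n : ℕ => 2 * Real.pi * (1 / ((n : ℝ) + 1)) * ‖ξ‖) atTop
              (𝓝 (2 * Real.pi * 0 * ‖ξ‖)) :=
            (tendsto_one_div_add_atTop_nhds_zero_nat.const_mul _).mul_const _
          simpa using this
        have hm2 : Tendsto (fun n => ‖m n ξ - 1‖ₑ ^ 2) atTop (𝓝 0) := by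
          have := ((continuous_enorm.tendsto _).comp hm1)
          have h2 := ENNReal.Tendsto.pow (n := 2) this
          simpa using h2
        have h3 : Tendsto (fun n => ENNReal.ofReal (1 + (2 * Real.pi * ‖ξ‖) ^ 2) * ‖Φ ξ‖ₑ ^ 2 *
            ‖m n ξ - 1‖ₑ ^ 2) atTop (𝓝 (ENNReal.ofReal (1 + (2 * Real.pi * ‖ξ‖) ^ 2) *
              ‖Φ ξ‖ₑ ^ 2 * 0)) := by
          refine ENNReal.Tendsto.const_mul hm2 (Or.inr ?_)
          exact ENNReal.mul_ne_top ENNReal.ofReal_ne_top (by simp)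
        rw [mul_zero] at h3
        refine h3.congr fun n => ?_
        ring
    have := (ENNReal.continuous_rpow_const (y := 1 / 2)).tendsto (0 : ℝ≥0∞) |>.comp hsq
    rw [ENNReal.zero_rpow_of_pos (by norm_num)] at this
    refine this.congr fun n => ?_
    rw [Function.comp_apply, ← ENNReal.rpow_natCast, ← ENNReal.rpow_mul]
    norm_num
  · intro x hx
    -- Once the mollifier lives in a ball of radius `ε/2`, the convolution near `x` only samples `f`
    -- outside the closure of `D`.
    obtain ⟨ε, hε, hball⟩ := Metric.mem_nhds_iff.1 (isClosed_closure.isOpen_compl.mem_nhds hx)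
    have h1 : ∀ᶠ n : ℕ in atTop, 1 / ((n : ℝ) + 1) < ε / 2 :=
      (tendsto_one_div_add_atTop_nhds_zero_nat).eventually_lt_const (by linarith)
    filter_upwards [h1] with n hn
    filter_upwards [Metric.ball_mem_nhds x (half_pos hε)] with y hy
    simp only [hu, convolution_def, ContinuousLinearMap.lsmul_apply, smul_eq_mul, Pi.zero_apply]
    refine integral_eq_zero_of_ae (ae_of_all _ fun t => ?_)
    simp only [Pi.zero_apply]
    by_cases ht : η n t = 0
    · rw [ht, zero_mul]
    · rw [hfD, mul_zero]
      intro hmem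
      refine hball ?_ (subset_closure hmem)
      rw [mem_ball_iff_norm] at hy ⊢
      have := hηr n t ht
      calc ‖y - t - x‖ = ‖(y - x) - t‖ := by congr 1; abel
        _ ≤ ‖y - x‖ + ‖t‖ := norm_sub_le _ _
        _ < ε := by linarith

end ScottZhang

/-! ### Lipschitz domains -/

namespace ScottZhang

variable {d : ℕ}

theorem norm_sub_inner_smul_le {e : Eu d} (he : ‖e‖ = 1) (z : Eu d) :
    ‖z - (inner ℝ e z : ℝ) • e‖ ≤ ‖z‖ := by
  have h : ‖z - (inner ℝ e z : ℝ) • e‖ ^ 2 = ‖z‖ ^ 2 - (inner ℝ e z : ℝ) ^ 2 := by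
    rw [norm_sub_sq_real, inner_smul_right, real_inner_comm, norm_smul, he, mul_one,
      Real.norm_eq_abs, sq_abs]
    ring
  have h2 : ‖z - (inner ℝ e z : ℝ) • e‖ ^ 2 ≤ ‖z‖ ^ 2 := by rw [h]; nlinarith [sq_nonneg (inner ℝ e z : ℝ)]
  exact (pow_le_pow_iff_left₀ (norm_nonneg _) (norm_nonneg _) (by norm_num)).1 h2

/-- Uniform exterior cone condition near each boundary point. -/
theorem HasLipschitzBoundary.exterior_cone {D : Set (Eu d)} (hDo : IsOpen D)
    (hD : HasLipschitzBoundary D) {x : Eu d} (hx : x ∈ frontier D) :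
    ∃ (e : Eu d) (κ δ : ℝ), ‖e‖ = 1 ∧ 0 < κ ∧ κ ≤ 1 / 2 ∧ 0 < δ ∧ δ ≤ 1 ∧
      ∀ y ∈ frontier D, y ∈ Metric.ball x δ → ∀ s, 0 < s → s ≤ δ → ∀ z : Eu d, ‖z‖ ≤ κ * s →
        y - s • e + z ∉ D := by
  obtain ⟨e, he, L, γ, hγ, U, hU, hUD⟩ := hD x hx
  obtain ⟨δ₀, hδ₀, hball⟩ := Metric.mem_nhds_iff.1 hU
  have hL : (0 : ℝ) ≤ L := L.2
  -- A perturbation of norm `κs` raises the height by at most `κs` and lowers the graph by at most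
  -- `Lκs`, together `s/2`, which is less than the descent `s`.
  set κ : ℝ := 1 / (2 * (1 + L)) with hκ
  have hκ0 : 0 < κ := by positivity
  have hκL : κ * (1 + L) = 1 / 2 := by rw [hκ]; field_simp
  have hκ2 : κ ≤ 1 / 2 := by nlinarith
  set δ : ℝ := min 1 (δ₀ / 4) with hδ
  have hδ0 : 0 < δ := by positivity
  have hδ4 : δ ≤ δ₀ / 4 := min_le_right _ _
  refine ⟨e, κ, δ, he, hκ0, hκ2, hδ0, min_le_left _ _, ?_⟩
  intro y hy hyx s hs hsδ z hz hmem
  rw [mem_ball_iff_norm] at hyx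
  have hyU : y ∈ U := hball (by rw [mem_ball_iff_norm]; linarith)
  have hyD : y ∉ D := by
    rw [hDo.frontier_eq] at hy; exact hy.2
  have h1 : inner ℝ e y ≤ γ (y - (inner ℝ e y : ℝ) • e) := by
    by_contra hc
    exact hyD ((hUD y hyU).2 (not_le.1 hc))
  have hpU : y - s • e + z ∈ U := by
    apply hball
    rw [mem_ball_iff_norm]
    calc ‖y - s • e + z - x‖ = ‖(y - x) - s • e + z‖ := by congr 1; abel
      _ ≤ ‖y - x‖ + ‖s • e‖ + ‖z‖ := (norm_add_le _ _).trans (by gcongr; exact norm_sub_le _ _)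
      _ < δ₀ := by rw [norm_smul, he, Real.norm_of_nonneg hs.le]; nlinarith
  have h2 := (hUD _ hpU).1 hmem
  have hee : inner ℝ e e = (1 : ℝ) := by rw [real_inner_self_eq_norm_sq, he]; norm_num
  have hin : inner ℝ e (y - s • e + z) = inner ℝ e y - s + inner ℝ e z := by
    rw [inner_add_right, inner_sub_right, inner_smul_right, hee, mul_one]
  have hproj : y - s • e + z - (inner ℝ e (y - s • e + z) : ℝ) • e =
      (y - (inner ℝ e y : ℝ) • e) + (z - (inner ℝ e z : ℝ) • e) := by
    rw [hin]; module
  rw [hproj, hin] at h2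
  have h3 := hγ.dist_le_mul (y - (inner ℝ e y : ℝ) • e + (z - (inner ℝ e z : ℝ) • e))
    (y - (inner ℝ e y : ℝ) • e)
  rw [Real.dist_eq, dist_eq_norm, add_sub_cancel_left] at h3
  have h4 := norm_sub_inner_smul_le he z
  have h5 : |inner ℝ e z| ≤ ‖z‖ := by
    have := abs_real_inner_le_norm e z
    rwa [he, one_mul] at this
  have h6 := abs_le.1 h3
  have h7 := abs_le.1 h5
  have h8 : (L : ℝ) * ‖z - (inner ℝ e z : ℝ) • e‖ ≤ L * (κ * s) := by gcongr; linarith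
  nlinarith

theorem notMem_closure_of_closedBall {D : Set (Eu d)} {p : Eu d} {r : ℝ} (hr : 0 < r)
    (h : ∀ z : Eu d, ‖z‖ ≤ r → p + z ∉ D) : p ∉ closure D := by
  intro hp
  obtain ⟨q, hq, hqp⟩ := Metric.mem_closure_iff.1 hp r hr
  refine h (q - p) ?_ (by simpa using hq)
  rw [dist_eq_norm, norm_sub_rev] at hqp
  exact hqp.le

/-- Points of the cone axis are exterior and approach the vertex of the cone. This excludes slits
and punctures and is the contradiction at the end of `IsTriangulation.exists_boundary_face`. -/
theorem HasLipschitzBoundary.frontier_subset_closure_exterior {D : Set (Eu d)} (hDo : IsOpen D)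
    (hD : HasLipschitzBoundary D) : frontier D ⊆ closure (closure D)ᶜ := by
  intro x hx
  obtain ⟨e, κ, δ, he, hκ, hκ2, hδ, hδ1, hcone⟩ := hD.exterior_cone hDo hx
  rw [Metric.mem_closure_iff]
  intro ε hε
  set s : ℝ := min δ (ε / 2) with hs
  have hs0 : 0 < s := by positivity
  refine ⟨x - s • e, ?_, ?_⟩
  · refine notMem_closure_of_closedBall (mul_pos hκ hs0) fun z hz => ?_
    exact hcone x hx (Metric.mem_ball_self hδ) s hs0 (min_le_left _ _) z hz
  · rw [dist_eq_norm, sub_sub_cancel, norm_smul, he, Real.norm_of_nonneg hs0.le, mul_one]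
    have : s ≤ ε / 2 := min_le_right _ _
    linarith

/-- Uniform exterior ball condition at all scales up to `1`. -/
theorem HasLipschitzBoundary.exterior_ball {D : Set (Eu d)} (hDo : IsOpen D)
    (hDb : Bornology.IsBounded D) (hD : HasLipschitzBoundary D) :
    ∃ κ : ℝ, 0 < κ ∧ κ ≤ 1 ∧ ∀ x ∈ frontier D, ∀ r : ℝ, 0 < r → r ≤ 1 →
      ∃ c, Metric.closedBall c (κ * r) ⊆ Metric.closedBall x r \ D := by
  have hc : IsCompact (frontier D) :=
    (Metric.isCompact_of_isClosed_isBounded isClosed_closure hDb.closure).of_isClosed_subset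
      isClosed_frontier frontier_subset_closure
  -- A positive lower bound survives finite unions, so compactness of the boundary reduces the claim
  -- to a neighbourhood of one point.
  refine hc.induction_on (p := fun S => ∃ κ : ℝ, 0 < κ ∧ κ ≤ 1 ∧ ∀ x ∈ S, ∀ r : ℝ, 0 < r → r ≤ 1 →
      ∃ c, Metric.closedBall c (κ * r) ⊆ Metric.closedBall x r \ D) ?_ ?_ ?_ ?_
  · exact ⟨1, one_pos, le_rfl, fun x hx => absurd hx (notMem_empty x)⟩
  · rintro s t hst ⟨κ, h0, h1, h⟩
    exact ⟨κ, h0, h1, fun x hx => h x (hst hx)⟩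
  · rintro s t ⟨κ, h0, h1, h⟩ ⟨κ', h0', h1', h'⟩
    refine ⟨min κ κ', lt_min h0 h0', (min_le_left _ _).trans h1, ?_⟩
    rintro x (hx | hx) r hr hr1
    · obtain ⟨c, hc⟩ := h x hx r hr hr1
      exact ⟨c, (Metric.closedBall_subset_closedBall (by gcongr; exact min_le_left _ _)).trans hc⟩
    · obtain ⟨c, hc⟩ := h' x hx r hr hr1
      exact ⟨c, (Metric.closedBall_subset_closedBall (by gcongr; exact min_le_right _ _)).trans hc⟩
  · intro x hx
    obtain ⟨e, κ, δ, he, hκ, hκ2, hδ, hδ1, hcone⟩ := hD.exterior_cone hDo hx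
    refine ⟨frontier D ∩ Metric.ball x δ,
      inter_mem_nhdsWithin _ (Metric.ball_mem_nhds x hδ), κ * (δ / 2), by positivity,
      by nlinarith, ?_⟩
    rintro y ⟨hy, hyx⟩ r hr hr1
    have hs : 0 < δ / 2 * r := by positivity
    refine ⟨y - (δ / 2 * r) • e, fun p hp => ?_⟩
    rw [mem_closedBall_iff_norm] at hp
    have hp2 : ‖p - (y - (δ / 2 * r) • e)‖ ≤ κ * (δ / 2 * r) := by linarith
    constructor
    · rw [mem_closedBall_iff_norm]
      calc ‖p - y‖ = ‖(p - (y - (δ / 2 * r) • e)) - (δ / 2 * r) • e‖ := by congr 1; abel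
        _ ≤ κ * (δ / 2 * r) + δ / 2 * r := by
            refine (norm_sub_le _ _).trans (add_le_add hp2 ?_)
            rw [norm_smul, he, Real.norm_of_nonneg hs.le, mul_one]
        _ ≤ r := by nlinarith
    · have := hcone y hy hyx (δ / 2 * r) hs (by nlinarith) _ hp2
      simpa using this

/-- Near a boundary point, translation by small multiples of some direction transversal to a given
hyperplane leads from the boundary to the exterior. -/
theorem HasLipschitzBoundary.exterior_direction {D : Set (Eu d)} (hDo : IsOpen D)
    (hD : HasLipschitzBoundary D) {x : Eu d} (hx : x ∈ frontier D) {V : Submodule ℝ (Eu d)}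
    (hV : V ≠ ⊤) :
    ∃ (b : Eu d) (δ : ℝ), b ∉ V ∧ 0 < δ ∧ ∀ y ∈ frontier D, y ∈ Metric.ball x δ →
      ∀ s ∈ Ioc (0 : ℝ) 1, y + s • b ∉ closure D := by
  obtain ⟨e, κ, δ, he, hκ, hκ2, hδ, hδ1, hcone⟩ := hD.exterior_cone hDo hx
  obtain ⟨z₀, hz₀⟩ : ∃ z₀ : Eu d, z₀ ∉ V := by
    by_contra! h
    exact hV (eq_top_iff.2 fun z _ => h z)
  -- If the cone axis lies in `V` it is tilted out of `V`, using at most half the aperture; the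
  -- other half keeps the translated point away from the closure of `D`.
  obtain ⟨z, hz, hzV⟩ : ∃ z : Eu d, ‖z‖ ≤ κ / 2 ∧ -e + z ∉ V := by
    by_cases heV : e ∈ V
    · have hz0 : 0 < ‖z₀‖ := norm_pos_iff.2 fun h => hz₀ (h ▸ V.zero_mem)
      refine ⟨(κ / 2 / ‖z₀‖) • z₀, ?_, fun h => hz₀ ?_⟩
      · rw [norm_smul, Real.norm_of_nonneg (by positivity)]
        exact (div_mul_cancel₀ _ hz0.ne').le
      · have h1 := (V.add_mem_iff_right (V.neg_mem heV)).1 h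
        exact (V.smul_mem_iff (by positivity)).1 h1
    · exact ⟨0, by simpa using by positivity, by simpa using heV⟩
  refine ⟨δ • (-e + z), δ, fun h => hzV ((V.smul_mem_iff hδ.ne').1 h), hδ, ?_⟩
  intro y hy hyx s hs
  have hsδ : 0 < s * δ := mul_pos hs.1 hδ
  refine notMem_closure_of_closedBall (r := κ / 2 * (s * δ)) (by positivity) fun q hq => ?_
  have := hcone y hy hyx (s * δ) hsδ (by nlinarith [hs.2]) ((s * δ) • z + q) (by
    refine (norm_add_le _ _).trans ?_
    rw [norm_smul, Real.norm_of_nonneg hsδ.le]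
    nlinarith)
  convert! this using 2
  module

end ScottZhang

/-! ### Affine functions on convex sets -/

namespace ScottZhang

variable {d : ℕ}

/-- Inverse inequality on compact convex sets: the maximum of an affine function is bounded by its
`L²` mean, if the measure scales well under homotheties. -/
theorem sq_mul_measure_le_lintegral {μ : Measure (Eu d)} {F : Set (Eu d)} (hF : IsCompact F)
    (hFc : Convex ℝ F) {c : ℝ≥0∞}
    (hμ : ∀ x ∈ F, c * μ F ≤ μ (AffineMap.homothety x (1 / 4 : ℝ) '' F))
    (p : Eu d →ᵃ[ℝ] ℝ) {x : Eu d} (hx : x ∈ F) :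
    ENNReal.ofReal (p x ^ 2) * (c * μ F) ≤ 4 * ∫⁻ y in F, ‖p y‖ₑ ^ 2 ∂μ := by
  have hpc : Continuous p := p.continuous_of_finiteDimensional
  obtain ⟨x₀, hx₀, hmax⟩ := hF.exists_isMaxOn ⟨x, hx⟩ (hpc.abs.continuousOn)
  have hmax' : ∀ y ∈ F, |p y| ≤ |p x₀| := fun y hy => hmax hy
  set A := AffineMap.homothety x₀ (1 / 4 : ℝ) '' F with hA
  have hAF : A ⊆ F := by
    rintro _ ⟨y, hy, rfl⟩
    rw [AffineMap.homothety_apply]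
    have := hFc.add_smul_sub_mem hx₀ hy (t := 1 / 4) ⟨by norm_num, by norm_num⟩
    simpa [add_comm] using this
  -- On the quarter-size copy of `F` about a maximum point `x₀` of `|p|`, the value of `p` is `3/4`
  -- of the maximal one plus `1/4` of one no larger in modulus, so at least half the maximum
  -- remains.
  have hlow : ∀ y ∈ A, ENNReal.ofReal (p x ^ 2 / 4) ≤ ‖p y‖ₑ ^ 2 := by
    rintro _ ⟨y, hy, rfl⟩
    rw [← ofReal_norm, ← ENNReal.ofReal_pow (norm_nonneg _), Real.norm_eq_abs, sq_abs]
    apply ENNReal.ofReal_le_ofReal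
    have e : p (AffineMap.homothety x₀ (1 / 4 : ℝ) y) = 3 / 4 * p x₀ + 1 / 4 * p y := by
      rw [AffineMap.homothety_eq_lineMap, AffineMap.apply_lineMap, AffineMap.lineMap_apply]
      simp
      ring
    rw [e]
    have h1 := hmax' y hy
    have h2 := hmax' x hx
    rw [← sq_abs (p x)]
    have h3 : |p x₀| / 2 ≤ |3 / 4 * p x₀ + 1 / 4 * p y| := by
      have h4 : |3 / 4 * p x₀| ≤ |3 / 4 * p x₀ + 1 / 4 * p y| + |1 / 4 * p y| := by
        have := abs_sub (3 / 4 * p x₀ + 1 / 4 * p y) (1 / 4 * p y)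
        rwa [add_sub_cancel_right] at this
      rw [abs_mul, abs_mul] at h4
      norm_num at h4 ⊢
      linarith
    rw [← sq_abs (3 / 4 * p x₀ + 1 / 4 * p y)]
    nlinarith [abs_nonneg (p x), abs_nonneg (p x₀), abs_nonneg (3 / 4 * p x₀ + 1 / 4 * p y)]
  have hAc : IsCompact A := hF.image (AffineMap.continuous_of_finiteDimensional _)
  calc ENNReal.ofReal (p x ^ 2) * (c * μ F) ≤ ENNReal.ofReal (p x ^ 2) * μ A := by
        gcongr; exact hμ x₀ hx₀
    _ = 4 * (ENNReal.ofReal (p x ^ 2 / 4) * μ A) := by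
        rw [← mul_assoc]
        congr 1
        rw [← ENNReal.ofReal_ofNat 4, ← ENNReal.ofReal_mul (by norm_num)]
        congr 1
        ring
    _ = 4 * ∫⁻ y in A, ENNReal.ofReal (p x ^ 2 / 4) ∂μ := by rw [setLIntegral_const]
    _ ≤ 4 * ∫⁻ y in A, ‖p y‖ₑ ^ 2 ∂μ := by
        gcongr 4 * ?_
        exact setLIntegral_mono' hAc.measurableSet hlow
    _ ≤ _ := by
        gcongr 4 * ?_
        exact lintegral_mono_set hAF

theorem volume_homothety_image (F : Set (Eu d)) (x : Eu d) {t : ℝ} (ht : 0 ≤ t) :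
    volume (AffineMap.homothety x t '' F) = ENNReal.ofReal (t ^ d) * volume F := by
  rw [Measure.addHaar_image_homothety, finrank_euclideanSpace_fin, abs_of_nonneg (by positivity)]

theorem hausdorffMeasure_homothety_quarter (hd : 1 ≤ d) (F : Set (Eu d)) (x : Eu d) :
    ENNReal.ofReal ((1 / 4) ^ (d - 1)) * μH[(d : ℝ) - 1] F ≤
      μH[(d : ℝ) - 1] (AffineMap.homothety x (1 / 4 : ℝ) '' F) := by
  have hd' : (0 : ℝ) ≤ (d : ℝ) - 1 := by
    have : (1 : ℝ) ≤ d := by exact_mod_cast hd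
    linarith
  rw [hausdorffMeasure_homothety_image hd' x (by norm_num)]
  rw [ENNReal.smul_def, smul_eq_mul]
  refine mul_le_mul' (le_of_eq ?_) le_rfl
  have e : (d : ℝ) - 1 = ((d - 1 : ℕ) : ℝ) := by rw [Nat.cast_sub hd]; simp
  rw [e, NNReal.rpow_natCast, ENNReal.ofReal]
  congr 1
  ext
  simp [Real.toNNReal_of_nonneg]

/-- An affine function bounded by `M` on a ball of radius `r` is Lipschitz with constant `M/r`. -/
theorem norm_linear_le_of_bound {p : Eu d →ᵃ[ℝ] ℝ} {c : Eu d} {r M : ℝ} (hr : 0 < r)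
    (h : ∀ x ∈ Metric.closedBall c r, |p x| ≤ M) (y : Eu d) : |p.linear y| ≤ M / r * ‖y‖ := by
  rcases eq_or_ne y 0 with rfl | hy
  · simp
  have hy0 : 0 < ‖y‖ := norm_pos_iff.2 hy
  set q : Eu d := (r / ‖y‖) • y with hq
  have hqn : ‖q‖ = r := by
    rw [hq, norm_smul, Real.norm_of_nonneg (by positivity), div_mul_cancel₀ _ hy0.ne']
  have h1 := h (c + q) (by rw [mem_closedBall_iff_norm, add_sub_cancel_left, hqn])
  have h2 := h (c - q) (by rw [mem_closedBall_iff_norm, sub_sub_cancel_left, norm_neg, hqn])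
  have e1 : p (c + q) = p.linear q + p c := by
    rw [add_comm]; exact p.map_vadd c q
  have e2 : p (c - q) = -p.linear q + p c := by
    rw [sub_eq_add_neg, add_comm, ← map_neg]; exact p.map_vadd c (-q)
  have h3 : |p.linear q| ≤ M := by
    rw [e1] at h1; rw [e2] at h2
    rw [abs_le] at h1 h2 ⊢
    constructor <;> linarith [h1.1, h1.2, h2.1, h2.2]
  rw [hq, map_smul, smul_eq_mul, abs_mul, abs_of_pos (by positivity)] at h3
  rw [div_mul_eq_mul_div, le_div_iff₀ hr]
  calc |p.linear y| * r = (r / ‖y‖ * |p.linear y|) * ‖y‖ := by field_simp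
    _ ≤ M * ‖y‖ := by gcongr

theorem affineMap_sub_eq_linear (p : Eu d →ᵃ[ℝ] ℝ) (x y : Eu d) :
    p x - p y = p.linear (x - y) := by
  have := p.linearMap_vsub x y
  simpa using this.symm

end ScottZhang

/-! ### Piecewise affine functions on a mesh -/

namespace ScottZhang

variable {d : ℕ} {K : Geometry.SimplicialComplex ℝ (Eu d)} {D : Set (Eu d)}

/-- The vertices of a cell form an affine basis. -/
noncomputable def cellBasis {T : Finset (Eu d)} (hT : T ∈ cells K) : AffineBasis T ℝ (Eu d) :=
  ⟨((↑) : T → Eu d), K.indep hT.1, by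
    have hc : Fintype.card T = Module.finrank ℝ (Eu d) + 1 := by
      rw [Fintype.card_coe, hT.2, finrank_euclideanSpace_fin]
    exact ((K.indep hT.1).affineSpan_eq_top_iff_card_eq_finrank_add_one).2 hc⟩

/-- The affine function with prescribed values at the vertices of a cell. -/
noncomputable def cellInterp {T : Finset (Eu d)} (hT : T ∈ cells K) (φ : Eu d → ℝ) :
    Eu d →ᵃ[ℝ] ℝ := ∑ z : T, φ z • (cellBasis hT).coord z

theorem cellInterp_apply {T : Finset (Eu d)} (hT : T ∈ cells K) (φ : Eu d → ℝ) (x : Eu d) :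
    cellInterp hT φ x = ∑ z : T, φ z * (cellBasis hT).coord z x := by
  have : ∀ s : Finset T, (∑ z ∈ s, φ z • (cellBasis hT).coord z : Eu d →ᵃ[ℝ] ℝ) x =
      ∑ z ∈ s, φ z * (cellBasis hT).coord z x := by
    intro s
    induction s using Finset.induction_on with
    | empty => simp
    | insert a s ha ih => rw [Finset.sum_insert ha, Finset.sum_insert ha, ← ih]; rfl
  exact this _

theorem coord_vertex {T : Finset (Eu d)} (hT : T ∈ cells K) (z y : T) :
    (cellBasis hT).coord z (y : Eu d) = if z = y then 1 else 0 :=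
  (cellBasis hT).coord_apply z y

theorem cellInterp_vertex {T : Finset (Eu d)} (hT : T ∈ cells K) (φ : Eu d → ℝ) {z : Eu d}
    (hz : z ∈ T) : cellInterp hT φ z = φ z := by
  rw [cellInterp_apply, Finset.sum_eq_single (⟨z, hz⟩ : T)]
  · rw [coord_vertex hT ⟨z, hz⟩ ⟨z, hz⟩]; simp
  · intro b _ hb
    rw [coord_vertex hT b ⟨z, hz⟩, if_neg hb, mul_zero]
  · intro h; exact absurd (Finset.mem_univ _) h

/-- The set where two affine functions agree is convex. -/
theorem affine_eqOn_convexHull {p q : Eu d →ᵃ[ℝ] ℝ} {S : Set (Eu d)} (h : EqOn p q S) :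
    EqOn p q (convexHull ℝ S) := by
  have hc : Convex ℝ {x | p x = q x} := by
    intro x hx y hy a b ha hb hab
    have hx' : p x = q x := hx
    have hy' : p y = q y := hy
    change p _ = q _
    rw [Convex.combo_affine_apply hab, Convex.combo_affine_apply hab, hx', hy']
  exact fun x hx => convexHull_min (fun y hy => h hy) hc hx

theorem convexHull_face_isCompact (T : Finset (Eu d)) :
    IsCompact (convexHull ℝ (T : Set (Eu d))) :=
  T.finite_toSet.isCompact_convexHull (𝕜 := ℝ)

theorem IsTriangulation.exists_cell (hK : IsTriangulation D K) {x : Eu d} (hx : x ∈ closure D) :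
    ∃ T ∈ cells K, x ∈ convexHull ℝ (T : Set (Eu d)) := by
  rw [← hK.space_eq, Geometry.SimplicialComplex.mem_space_iff] at hx
  obtain ⟨S, hS, hxS⟩ := hx
  obtain ⟨T, hT, hST⟩ := hK.pure S hS
  exact ⟨T, hT, convexHull_mono (by exact_mod_cast hST) hxS⟩

theorem IsTriangulation.cells_finite (hK : IsTriangulation D K) : (cells K).Finite :=
  hK.finite.subset fun _ h => h.1

theorem IsTriangulation.cell_subset (hK : IsTriangulation D K) {T : Finset (Eu d)}
    (hT : T ∈ cells K) : convexHull ℝ (T : Set (Eu d)) ⊆ closure D := by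
  rw [← hK.space_eq]; exact K.convexHull_subset_space hT.1

theorem mem_vertices_of_mem {T : Finset (Eu d)} (hT : T ∈ K.faces) {z : Eu d} (hz : z ∈ T) :
    z ∈ K.vertices :=
  K.down_closed hT (Finset.singleton_subset_iff.2 hz) (Finset.singleton_nonempty z)

/-- Existence of the continuous piecewise affine function with prescribed vertex values. -/
theorem IsTriangulation.exists_lagrange (hK : IsTriangulation D K) (φ : Eu d → ℝ) :
    ∃ w : Eu d → ℝ, ContinuousOn w K.space ∧ ∀ T (hT : T ∈ cells K),
      EqOn w (cellInterp hT φ) (convexHull ℝ (T : Set (Eu d))) := by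
  classical
  -- Cells of a simplicial complex meet in the hull of their common vertices, where both
  -- interpolants have the values `φ`.
  have hcompat : ∀ T (hT : T ∈ cells K) T' (hT' : T' ∈ cells K) (x : Eu d),
      x ∈ convexHull ℝ (T : Set (Eu d)) → x ∈ convexHull ℝ (T' : Set (Eu d)) →
      cellInterp hT φ x = cellInterp hT' φ x := by
    intro T hT T' hT' x hx hx'
    have := (K.inter_subset_convexHull hT.1 hT'.1) ⟨hx, hx'⟩
    refine affine_eqOn_convexHull (S := (T : Set (Eu d)) ∩ T') (fun y hy => ?_) this
    rw [cellInterp_vertex hT φ (by exact_mod_cast hy.1),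
      cellInterp_vertex hT' φ (by exact_mod_cast hy.2)]
  set w : Eu d → ℝ := fun x =>
    if h : ∃ T, ∃ _ : T ∈ cells K, x ∈ convexHull ℝ (T : Set (Eu d)) then
      cellInterp h.choose_spec.choose φ x else 0 with hw
  have hweq : ∀ T (hT : T ∈ cells K),
      EqOn w (cellInterp hT φ) (convexHull ℝ (T : Set (Eu d))) := by
    intro T hT x hx
    have h : ∃ T, ∃ _ : T ∈ cells K, x ∈ convexHull ℝ (T : Set (Eu d)) := ⟨T, hT, hx⟩
    simp only [hw]
    rw [dif_pos h]
    exact hcompat _ _ _ _ _ h.choose_spec.choose_spec hx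
  refine ⟨w, ?_, hweq⟩
  have hsp : K.space = ⋃ T : cells K, convexHull ℝ ((T : Finset (Eu d)) : Set (Eu d)) := by
    ext x
    rw [mem_iUnion]
    constructor
    · intro hx
      rw [hK.space_eq] at hx
      obtain ⟨T, hT, hxT⟩ := hK.exists_cell hx
      exact ⟨⟨T, hT⟩, hxT⟩
    · rintro ⟨T, hxT⟩
      exact K.convexHull_subset_space T.2.1 hxT
  have := hK.cells_finite.to_subtype
  rw [hsp]
  refine (locallyFinite_of_finite _).continuousOn_iUnion
    (fun T => (convexHull_face_isCompact _).isClosed) fun T => ?_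
  exact ((AffineMap.continuous_of_finiteDimensional _).continuousOn).congr (hweq T T.2)

/-- A function of the Lagrange space agrees on each cell with the interpolant of its vertex
values. -/
theorem lagrange_eqOn_cellInterp {w : Eu d → ℝ} (hw : w ∈ lagrangeSpace K) {T : Finset (Eu d)}
    (hT : T ∈ cells K) {φ : Eu d → ℝ} (hφ : ∀ z ∈ T, w z = φ z) :
    EqOn w (cellInterp hT φ) (convexHull ℝ (T : Set (Eu d))) := by
  obtain ⟨p, hp⟩ := hw.2 T hT
  refine hp.trans (affine_eqOn_convexHull fun y hy => ?_)
  rw [← hp (subset_convexHull ℝ _ hy), cellInterp_vertex hT φ (by exact_mod_cast hy),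
    hφ y (by exact_mod_cast hy)]

/-- With `mem_convexHull_of_coord` this describes a face by barycentric coordinates of a surrounding
cell: they are nonnegative and vanish at the vertices off the face. -/
theorem coord_nonneg_of_mem_convexHull {T : Finset (Eu d)} (hT : T ∈ cells K) {S : Finset (Eu d)}
    (hS : S ⊆ T) {x : Eu d} (hx : x ∈ convexHull ℝ (S : Set (Eu d))) (z : T) :
    0 ≤ (cellBasis hT).coord z x ∧ ((z : Eu d) ∉ S → (cellBasis hT).coord z x = 0) := by
  have hc : Convex ℝ {x | 0 ≤ (cellBasis hT).coord z x ∧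
      ((z : Eu d) ∉ S → (cellBasis hT).coord z x = 0)} := by
    intro x hx y hy a b ha hb hab
    change 0 ≤ (cellBasis hT).coord z _ ∧ (_ → (cellBasis hT).coord z _ = 0)
    rw [Convex.combo_affine_apply hab, smul_eq_mul, smul_eq_mul]
    refine ⟨add_nonneg (mul_nonneg ha hx.1) (mul_nonneg hb hy.1), fun h => ?_⟩
    rw [hx.2 h, hy.2 h]; ring
  refine convexHull_min (fun y hy => ?_) hc hx
  have hyT : y ∈ T := hS (by exact_mod_cast hy)
  have e := coord_vertex hT z ⟨y, hyT⟩
  simp only at e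
  refine ⟨?_, fun h => ?_⟩
  · rw [e]; split_ifs <;> norm_num
  · rw [e, if_neg]
    rintro rfl
    exact h (by exact_mod_cast hy)

theorem mem_convexHull_of_coord {T : Finset (Eu d)} (hT : T ∈ cells K) {S : Finset (Eu d)}
    {x : Eu d} (h : ∀ z : T, 0 ≤ (cellBasis hT).coord z x ∧
      ((z : Eu d) ∉ S → (cellBasis hT).coord z x = 0)) :
    x ∈ convexHull ℝ (S : Set (Eu d)) := by
  classical
  have hsum := (cellBasis hT).sum_coord_apply_eq_one x
  have hx : ∑ z : T, (cellBasis hT).coord z x • (z : Eu d) = x :=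
    (cellBasis hT).linear_combination_coord_eq_self x
  rw [← hx]
  have h2 : ∑ z : T, (cellBasis hT).coord z x • (z : Eu d) =
      ∑ z ∈ Finset.univ.filter (fun z : T => (z : Eu d) ∈ S),
        (cellBasis hT).coord z x • (z : Eu d) := by
    symm
    refine Finset.sum_subset (Finset.subset_univ _) fun z _ hz => ?_
    rw [(h z).2 (by simpa using hz), zero_smul]
  have h3 : ∑ z ∈ Finset.univ.filter (fun z : T => (z : Eu d) ∈ S),
        (cellBasis hT).coord z x = 1 := by
    rw [← hsum]
    refine Finset.sum_subset (Finset.subset_univ _) fun z _ hz => ?_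
    rw [(h z).2 (by simpa using hz)]
  rw [h2]
  refine (convex_convexHull ℝ _).sum_mem (fun z _ => (h z).1) h3 fun z hz => ?_
  exact subset_convexHull ℝ _ (by simpa using hz)

/-- The first bracket is the centre of the homothety of ratio `t` that takes `m` to `x`. This
homothety takes `m + (p - x)/t` to `p`. -/
theorem combo_extrapolate {t : ℝ} (ht : t ≠ 0) (h1t : 1 - t ≠ 0) (x m p : Eu d) :
    (1 - t) • ((1 / (1 - t)) • x + (-(t / (1 - t))) • m) + t • (m + (1 / t) • (p - x)) = p := by
  rw [smul_add, smul_smul, smul_smul, smul_add, smul_smul]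
  have e1 : (1 - t) * (1 / (1 - t)) = 1 := by field_simp
  have e2 : (1 - t) * -(t / (1 - t)) = -t := by field_simp
  have e3 : t * (1 / t) = 1 := by field_simp
  rw [e1, e2, e3]
  module

/-- Each boundary point of `D` lies in a face of the mesh whose vertices are boundary points. -/
theorem IsTriangulation.exists_boundary_face (hDo : IsOpen D) (hDl : HasLipschitzBoundary D)
    (hK : IsTriangulation D K) {x : Eu d} (hx : x ∈ frontier D) :
    ∃ S ∈ K.faces, x ∈ convexHull ℝ (S : Set (Eu d)) ∧ ∀ z ∈ S, z ∈ frontier D := by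
  classical
  have hxsp : x ∈ K.space := by rw [hK.space_eq]; exact frontier_subset_closure hx
  rw [Geometry.SimplicialComplex.mem_space_iff] at hxsp
  obtain ⟨S₀, hS₀, hxS₀⟩ := hxsp
  -- Minimality puts `x` in the relative interior of `S`: all its barycentric coordinates there are
  -- positive. If some vertex `z` of `S` were in `D`, the local structure of the mesh near `z` would
  -- be carried over to `x`.
  obtain ⟨S, ⟨hS, hxS⟩, hmin⟩ := exists_minimal_of_wellFoundedLT
    (fun S : Finset (Eu d) => S ∈ K.faces ∧ x ∈ convexHull ℝ (S : Set (Eu d))) ⟨S₀, hS₀, hxS₀⟩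
  refine ⟨S, hS, hxS, fun z hz => ?_⟩
  by_contra hzf
  obtain ⟨T₀, hT₀, hST₀⟩ := hK.pure S hS
  set lam := fun y : T₀ => (cellBasis hT₀).coord y with hlam
  have hcx := coord_nonneg_of_mem_convexHull hT₀ hST₀ hxS
  have hpos : ∀ y : T₀, (y : Eu d) ∈ S → 0 < lam y x := by
    intro y hy
    refine lt_of_le_of_ne (hcx y).1 fun h0 => ?_
    have hmem : x ∈ convexHull ℝ ((S.erase y : Finset (Eu d)) : Set (Eu d)) := by
      refine mem_convexHull_of_coord hT₀ fun u => ⟨(hcx u).1, fun hu => ?_⟩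
      by_cases huy : u = y
      · rw [huy]; exact h0.symm
      · refine (hcx u).2 fun huS => hu (Finset.mem_erase.2 ⟨fun h => huy (Subtype.ext h), huS⟩)
    have hne : (S.erase (y : Eu d)).Nonempty := by
      rw [Finset.nonempty_iff_ne_empty]
      intro he
      rw [he] at hmem
      simp at hmem
    have hface := K.down_closed hS (Finset.erase_subset (y : Eu d) S) hne
    have := hmin ⟨hface, hmem⟩ (Finset.erase_subset (y : Eu d) S)
    exact Finset.notMem_erase (y : Eu d) S (this hy)
  have hzcl : z ∈ closure D := by
    rw [← hK.space_eq]; exact K.subset_space hS (by exact_mod_cast hz)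
  have hzD : z ∈ D := by
    rw [hDo.frontier_eq] at hzf
    by_contra h
    exact hzf ⟨hzcl, h⟩
  -- a point of `D` close to `z` on the segment from `z` to `x`
  have hcont : Tendsto (fun δ : ℝ => (1 - δ) • z + δ • x) (𝓝[>] 0) (𝓝 z) := by
    have : Continuous fun δ : ℝ => (1 - δ) • z + δ • x := by fun_prop
    have h := (this.tendsto 0).mono_left (nhdsWithin_le_nhds (s := Ioi 0))
    simpa using h
  obtain ⟨δ, hδD, hδ0, hδ1⟩ : ∃ δ : ℝ, (1 - δ) • z + δ • x ∈ D ∧ 0 < δ ∧ δ < 1 := by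
    have h1 := hcont.eventually (hDo.mem_nhds hzD)
    have h2 : ∀ᶠ δ : ℝ in 𝓝[>] 0, 0 < δ ∧ δ < 1 := Ioo_mem_nhdsGT one_pos
    exact ((h1.and h2).exists).imp fun δ h => ⟨h.1, h.2.1, h.2.2⟩
  set m := (1 - δ) • z + δ • x with hm
  have hzS : z ∈ convexHull ℝ (S : Set (Eu d)) := subset_convexHull ℝ _ (by exact_mod_cast hz)
  have hmS : m ∈ convexHull ℝ (S : Set (Eu d)) :=
    convex_convexHull ℝ _ hzS hxS (by linarith) hδ0.le (by ring)
  have hcm := coord_nonneg_of_mem_convexHull hT₀ hST₀ hmS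
  have hcz := coord_nonneg_of_mem_convexHull hT₀ hST₀ hzS
  have hmpos : ∀ y : T₀, (y : Eu d) ∈ S → 0 < lam y m := by
    intro y hy
    have e : lam y m = (1 - δ) * lam y z + δ * lam y x := by
      simp only [hlam, hm]
      rw [Convex.combo_affine_apply (by ring), smul_eq_mul, smul_eq_mul]
    rw [e]
    have h1 : 0 ≤ (1 - δ) * lam y z := mul_nonneg (by linarith) (hcz y).1
    have h2 := mul_pos hδ0 (hpos y hy)
    linarith
  -- The point `m` has positive coordinates at all vertices of `S`, so it lies in no proper subface,
  -- whereas a cell containing `m` meets `S` in a face containing `m`.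
  have hsub : ∀ T ∈ cells K, m ∈ convexHull ℝ (T : Set (Eu d)) → S ⊆ T := by
    intro T hT hmT y hy
    by_contra hyT
    have h1 := K.inter_subset_convexHull hS hT.1 ⟨hmS, hmT⟩
    rw [← Finset.coe_inter] at h1
    have h2 := coord_nonneg_of_mem_convexHull hT₀ (Finset.inter_subset_left.trans hST₀) h1
      ⟨y, hST₀ hy⟩
    have h3 := h2.2 (by simp [hyT])
    exact (hmpos ⟨y, hST₀ hy⟩ hy).ne' h3
  -- the cells near `m`
  have hN : ∀ᶠ q in 𝓝 m, ∃ T ∈ cells K, S ⊆ T ∧ q ∈ convexHull ℝ (T : Set (Eu d)) := by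
    have hclosed : IsClosed (⋃ T ∈ {T | T ∈ cells K ∧ m ∉ convexHull ℝ (T : Set (Eu d))},
        convexHull ℝ (T : Set (Eu d))) :=
      (hK.cells_finite.subset fun T h => h.1).isClosed_biUnion
        fun T _ => (convexHull_face_isCompact T).isClosed
    have hmn : m ∈ (⋃ T ∈ {T | T ∈ cells K ∧ m ∉ convexHull ℝ (T : Set (Eu d))},
        convexHull ℝ (T : Set (Eu d)))ᶜ := by
      simp only [mem_compl_iff, mem_iUnion, not_exists]
      intro T hT hmT
      exact hT.2 hmT
    filter_upwards [hclosed.isOpen_compl.mem_nhds hmn, hDo.mem_nhds hδD] with q hq hqD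
    obtain ⟨T, hT, hqT⟩ := hK.exists_cell (subset_closure hqD)
    refine ⟨T, hT, hsub T hT ?_, hqT⟩
    by_contra hmT
    exact hq (mem_biUnion (show T ∈ {T | T ∈ cells K ∧ m ∉ convexHull ℝ (T : Set (Eu d))} from
      ⟨hT, hmT⟩) hqT)
  -- `x` lies strictly between `m` and another point of the simplex
  obtain ⟨y₀, hy₀⟩ : ∃ t : ℝ, 0 < t ∧ t < 1 ∧ ∀ y : T₀, (y : Eu d) ∈ S → t ≤ lam y x := by
    have hev : ∀ᶠ t : ℝ in 𝓝[>] 0, ∀ y : T₀, (y : Eu d) ∈ S → t ≤ lam y x := by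
      rw [eventually_all]
      intro y
      by_cases hy : (y : Eu d) ∈ S
      · have : ∀ᶠ t : ℝ in 𝓝[>] 0, t ≤ lam y x := by
          filter_upwards [Ioo_mem_nhdsGT (hpos y hy)] with t ht using ht.2.le
        exact this.mono fun t ht _ => ht
      · exact Eventually.of_forall fun t h => absurd h hy
    have h2 : ∀ᶠ δ : ℝ in 𝓝[>] 0, 0 < δ ∧ δ < 1 := Ioo_mem_nhdsGT one_pos
    exact ((h2.and hev).exists).imp fun t h => ⟨h.1.1, h.1.2, h.2⟩
  obtain ⟨hy0, hy1, hyx⟩ := hy₀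
  set t := y₀ with ht
  have h1t : 0 < 1 - t := by linarith
  set y := (1 / (1 - t)) • x + (-(t / (1 - t))) • m with hy
  have hyS : y ∈ convexHull ℝ (S : Set (Eu d)) := by
    refine mem_convexHull_of_coord hT₀ fun u => ?_
    have e : (cellBasis hT₀).coord u y =
        1 / (1 - t) * lam u x + (-(t / (1 - t))) * lam u m := by
      simp only [hlam, hy]
      rw [Convex.combo_affine_apply (by field_simp; ring), smul_eq_mul, smul_eq_mul]
    have hle : lam u m ≤ 1 := by
      have hs := (cellBasis hT₀).sum_coord_apply_eq_one m
      rw [← hs]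
      exact Finset.single_le_sum (f := fun i => (cellBasis hT₀).coord i m)
        (fun i _ => (hcm i).1) (Finset.mem_univ u)
    by_cases hu : (u : Eu d) ∈ S
    · refine ⟨?_, fun h => absurd hu h⟩
      rw [e]
      have h3 := hyx u hu
      have : 1 / (1 - t) * lam u x + (-(t / (1 - t))) * lam u m =
          (lam u x - t * lam u m) / (1 - t) := by field_simp; ring
      rw [this]
      apply div_nonneg _ h1t.le
      nlinarith
    · have h0 : (cellBasis hT₀).coord u y = 0 := by
        rw [e]; simp only [hlam]; rw [(hcx u).2 hu, (hcm u).2 hu]; ring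
      exact ⟨h0.ge, fun _ => h0⟩
  -- Every cell near `m` contains `S`, hence the centre `y`, and is mapped into itself by the
  -- homothety. A neighbourhood of `m` thus shrinks onto a neighbourhood of `x` inside the closure
  -- of `D`, which is impossible at a Lipschitz boundary point.
  have hxint : ∀ᶠ p in 𝓝 x, p ∈ closure D := by
    have hmap : Tendsto (fun p : Eu d => m + (1 / t) • (p - x)) (𝓝 x) (𝓝 m) := by
      have : Continuous fun p : Eu d => m + (1 / t) • (p - x) := by fun_prop
      simpa using this.tendsto x
    filter_upwards [hmap.eventually hN] with p hp
    obtain ⟨T, hT, hSTs, hpT⟩ := hp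
    have hyT : y ∈ convexHull ℝ (T : Set (Eu d)) :=
      convexHull_mono (by exact_mod_cast hSTs) hyS
    have := convex_convexHull ℝ _ hyT hpT h1t.le hy0.le (by ring)
    have e : (1 - t) • y + t • (m + (1 / t) • (p - x)) = p :=
      combo_extrapolate hy0.ne' h1t.ne' x m p
    rw [e] at this
    exact hK.cell_subset hT this
  have hxc := hDl.frontier_subset_closure_exterior hDo hx
  rw [closure_compl] at hxc
  exact hxc (mem_interior_iff_mem_nhds.2 hxint)

end ScottZhang

/-! ### Shape regular meshes -/

namespace ScottZhang

variable {d : ℕ} {K : Geometry.SimplicialComplex ℝ (Eu d)} {D : Set (Eu d)}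

theorem simplexDiam_le_meshSize (hK : IsTriangulation D K) {T : Finset (Eu d)} (hT : T ∈ cells K) :
    simplexDiam T ≤ meshSize K :=
  le_csSup (hK.cells_finite.image _).bddAbove (mem_image_of_mem _ hT)

theorem dist_le_simplexDiam {T : Finset (Eu d)} {x y : Eu d}
    (hx : x ∈ convexHull ℝ (T : Set (Eu d))) (hy : y ∈ convexHull ℝ (T : Set (Eu d))) :
    dist x y ≤ simplexDiam T :=
  Metric.dist_le_diam_of_mem (convexHull_face_isCompact T).isBounded hx hy

theorem norm_sub_le_meshSize (hK : IsTriangulation D K) {T : Finset (Eu d)} (hT : T ∈ cells K)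
    {x y : Eu d} (hx : x ∈ convexHull ℝ (T : Set (Eu d)))
    (hy : y ∈ convexHull ℝ (T : Set (Eu d))) : ‖x - y‖ ≤ meshSize K := by
  rw [← dist_eq_norm]
  exact (dist_le_simplexDiam hx hy).trans (simplexDiam_le_meshSize hK hT)

theorem simplexDiam_pos (hd : 1 ≤ d) {T : Finset (Eu d)} (hT : T ∈ cells K) :
    0 < simplexDiam T := by
  have h : 1 < T.card := by rw [hT.2]; omega
  obtain ⟨a, ha, b, hb, hab⟩ := Finset.one_lt_card.1 h
  exact (dist_pos.2 hab).trans_le (dist_le_simplexDiam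
    (subset_convexHull ℝ _ (by exact_mod_cast ha)) (subset_convexHull ℝ _ (by exact_mod_cast hb)))

theorem meshSize_pos (hd : 1 ≤ d) (hK : IsTriangulation D K) {T : Finset (Eu d)}
    (hT : T ∈ cells K) : 0 < meshSize K :=
  (simplexDiam_pos hd hT).trans_le (simplexDiam_le_meshSize hK hT)

/-- Each cell contains a ball of radius comparable to the mesh size. -/
theorem exists_ball_subset_cell (hd : 1 ≤ d) (hK : IsTriangulation D K) {σ ρ : ℝ}
    (hσ : ShapeRegular σ K) (hρ : QuasiUniform ρ K) {T : Finset (Eu d)} (hT : T ∈ cells K) :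
    ∃ c, Metric.closedBall c (1 / (2 * (|σ * ρ| + 1)) * meshSize K) ⊆
      convexHull ℝ (T : Set (Eu d)) := by
  have h0 : 0 < meshSize K := meshSize_pos hd hK hT
  have h1 : meshSize K ≤ |σ * ρ| * inradius T ∨ meshSize K ≤ 0 := by
    have hle : meshSize K ≤ |ρ| * simplexDiam T := by
      refine csSup_le ⟨_, mem_image_of_mem _ hT⟩ ?_
      rintro _ ⟨T', hT', rfl⟩
      exact (hρ T' hT' T hT).trans
        (mul_le_mul_of_nonneg_right (le_abs_self ρ) Metric.diam_nonneg)
    have hdp := simplexDiam_pos hd hT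
    have hs := hσ T hT
    left
    have hin : 0 ≤ inradius T ∨ inradius T ≤ 0 := le_total _ _
    rcases hin with hin | hin
    · rw [abs_mul]
      calc meshSize K ≤ |ρ| * simplexDiam T := hle
        _ ≤ |ρ| * (|σ| * inradius T) := by
            gcongr
            exact hs.trans (mul_le_mul_of_nonneg_right (le_abs_self σ) hin)
        _ = _ := by ring
    · exfalso
      have hmem : (0 : ℝ) ∈ {r : ℝ | ∃ c, Metric.closedBall c r ⊆
          convexHull ℝ (T : Set (Eu d))} := by
        have hne : T.Nonempty := by rw [← Finset.card_pos, hT.2]; omega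
        obtain ⟨z, hz⟩ := hne
        refine ⟨z, ?_⟩
        rw [Metric.closedBall_zero, singleton_subset_iff]
        exact subset_convexHull ℝ _ (by exact_mod_cast hz)
      have hge : 0 ≤ inradius T := by
        -- If the radii were unbounded, the supremum would be zero by convention, which serves as
        -- well.
        by_cases hb : BddAbove {r : ℝ | ∃ c, Metric.closedBall c r ⊆
          convexHull ℝ (T : Set (Eu d))}
        · exact le_csSup hb hmem
        · exact (Real.sSup_of_not_bddAbove hb).ge
      have h00 : inradius T = 0 := le_antisymm hin hge
      rw [h00, mul_zero] at hs
      linarith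
  have h2 : meshSize K ≤ |σ * ρ| * inradius T := h1.resolve_right (not_le.2 h0)
  set q := |σ * ρ| with hq
  have hq0 : 0 ≤ q := abs_nonneg _
  have hi : 0 < inradius T := by
    by_contra h
    have := mul_nonpos_of_nonneg_of_nonpos hq0 (not_lt.1 h)
    linarith
  -- Staying strictly below the supremum yields an actual ball without showing that the supremum is
  -- attained.
  have hlt : 1 / (2 * (q + 1)) * meshSize K < inradius T := by
    rw [div_mul_eq_mul_div, one_mul, div_lt_iff₀ (by positivity)]
    nlinarith
  obtain ⟨r, ⟨c, hc⟩, hr⟩ := exists_lt_of_lt_csSup (by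
    by_contra hne
    have : inradius T = sSup ∅ := by
      unfold inradius; rw [not_nonempty_iff_eq_empty.1 hne]
    rw [Real.sSup_empty] at this
    linarith) hlt
  exact ⟨c, (Metric.closedBall_subset_closedBall hr.le).trans hc⟩

/-- The points of a convex set close to its complement form a thin strip. -/
theorem volume_strip_le (hd : 1 ≤ d) {A : Set (Eu d)} (hA : IsCompact A) (hAc : Convex ℝ A) {c : Eu d} {r t : ℝ}
    (hr : 0 < r) (ht : 0 < t) (hball : Metric.closedBall c r ⊆ A) :
    volume {q ∈ A | ¬ Metric.closedBall q t ⊆ A} ≤ ENNReal.ofReal (d * (t / r)) * volume A := by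
  rcases le_total (t / r) 1 with htr | htr
  · set τ := t / r with hτ
    have hτ0 : 0 < τ := by positivity
    -- By convexity `A` contains `(1-τ)a` plus `τ` times the inscribed ball, that is, the ball of
    -- radius `τr = t` about each point of `B`. The strip lies in `A \ B`, of relative volume `1 -
    -- (1-τ)^d ≤ dτ` by Bernoulli.
    set B := AffineMap.homothety c (1 - τ) '' A with hB
    have hBA : ∀ x ∈ B, Metric.closedBall x t ⊆ A := by
      rintro _ ⟨a, ha, rfl⟩ p hp
      rw [mem_closedBall_iff_norm] at hp
      set z := p - AffineMap.homothety c (1 - τ) a with hz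
      have hmem : c + (1 / τ) • z ∈ A := by
        apply hball
        rw [mem_closedBall_iff_norm, add_sub_cancel_left, norm_smul,
          Real.norm_of_nonneg (by positivity), div_mul_eq_mul_div, one_mul, div_le_iff₀ hτ0, hτ]
        have : r * (t / r) = t := by field_simp
        rw [this]; exact hp
      have := hAc ha hmem (a := 1 - τ) (b := τ) (by linarith) hτ0.le (by ring)
      have e : (1 - τ) • a + τ • (c + (1 / τ) • z) = p := by
        have e3 : τ * (1 / τ) = 1 := by field_simp
        rw [smul_add, smul_smul, e3, hz, AffineMap.homothety_apply]
        simp only [vsub_eq_sub, vadd_eq_add]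
        module
      rwa [e] at this
    have hsub : {q ∈ A | ¬ Metric.closedBall q t ⊆ A} ⊆ A \ B :=
      fun q hq => ⟨hq.1, fun h => hq.2 (hBA q h)⟩
    have hBc : IsCompact B := hA.image (AffineMap.continuous_of_finiteDimensional _)
    have hBsub : B ⊆ A := fun x hx => hBA x hx (Metric.mem_closedBall_self ht.le)
    have hvA : volume A ≠ ∞ := hA.measure_lt_top.ne
    refine (measure_mono hsub).trans ?_
    rw [measure_sdiff hBsub hBc.measurableSet.nullMeasurableSet
      hBc.measure_lt_top.ne, hB, volume_homothety_image _ _ (by linarith)]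
    rw [tsub_le_iff_right, ← add_mul, ← ENNReal.ofReal_add (by positivity)
      (pow_nonneg (by linarith) _)]
    refine le_mul_of_one_le_left zero_le ?_
    rw [← ENNReal.ofReal_one]
    apply ENNReal.ofReal_le_ofReal
    have := one_add_mul_le_pow (a := -τ) (by linarith) d
    rw [← sub_eq_add_neg] at this
    linarith
  · refine (measure_mono (fun q hq => hq.1)).trans (le_mul_of_one_le_left zero_le ?_)
    rw [← ENNReal.ofReal_one]
    apply ENNReal.ofReal_le_ofReal
    have : (1 : ℝ) ≤ d := by exact_mod_cast hd
    nlinarith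

/-- Different cells overlap in a null set. -/
theorem volume_cell_inter_cell {T T' : Finset (Eu d)} (hT : T ∈ cells K)
    (hT' : T' ∈ cells K) (hne : T ≠ T') :
    volume (convexHull ℝ (T : Set (Eu d)) ∩ convexHull ℝ (T' : Set (Eu d))) = 0 := by
  classical
  have hsub := K.inter_subset_convexHull hT.1 hT'.1
  rw [← Finset.coe_inter] at hsub
  have hcard : (T ∩ T').card < d + 1 := by
    rw [← hT.2]
    refine Finset.card_lt_card ⟨Finset.inter_subset_left, fun h => hne ?_⟩
    exact Finset.eq_of_subset_of_card_le (h.trans Finset.inter_subset_right)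
      (by rw [hT.2, hT'.2])
  have hspan : affineSpan ℝ ((T ∩ T' : Finset (Eu d)) : Set (Eu d)) ≠ ⊤ := by
    intro h
    have hind : AffineIndependent ℝ ((↑) : (T ∩ T' : Finset (Eu d)) → Eu d) :=
      (K.indep hT.1).mono (by exact_mod_cast Finset.inter_subset_left)
    have h2 : Fintype.card (T ∩ T' : Finset (Eu d)) = Module.finrank ℝ (Eu d) + 1 := by
      refine (hind.affineSpan_eq_top_iff_card_eq_finrank_add_one).1 ?_
      rw [Subtype.range_coe_subtype]
      exact h
    rw [Fintype.card_coe, finrank_euclideanSpace_fin] at h2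
    omega
  exact measure_mono_null (hsub.trans (convexHull_subset_affineSpan _))
    (Measure.addHaar_affineSubspace _ _ hspan)

/-- Cells overlap only in null sets, so the sum of the integrals is the integral over their union.
-/
theorem sum_setLIntegral_cells_le (hK : IsTriangulation D K) (g : Eu d → ℝ≥0∞) :
    ∑ T ∈ hK.cells_finite.toFinset, ∫⁻ x in convexHull ℝ (T : Set (Eu d)), g x ≤ ∫⁻ x, g x := by
  rw [← lintegral_biUnion_finset₀]
  · exact setLIntegral_le_lintegral _ _
  · intro T hT T' hT' hne
    exact volume_cell_inter_cell (by simpa using hT) (by simpa using hT') hne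
  · intro T _
    exact (convexHull_face_isCompact T).measurableSet.nullMeasurableSet

end ScottZhang

/-! ### The trace inequality for smooth functions -/

namespace ScottZhang

variable {d : ℕ}

/-- The cylinder over `B` with axis `b`. -/
def cylinder (B : Set (Eu d)) (b : Eu d) : Set (Eu d) :=
  (fun p : Eu d × ℝ => p.1 + p.2 • b) '' (B ×ˢ Icc (0 : ℝ) 1)

theorem isCompact_cylinder {B : Set (Eu d)} (hB : IsCompact B) (b : Eu d) :
    IsCompact (cylinder B b) :=
  (hB.prod isCompact_Icc).image (by fun_prop)

theorem finrank_vectorSpan_face (hd : 1 ≤ d) {F : Finset (Eu d)}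
    (hF : AffineIndependent ℝ ((↑) : F → Eu d)) (hFc : F.card = d) :
    Module.finrank ℝ (vectorSpan ℝ (F : Set (Eu d))) = d - 1 := by
  have h := hF.finrank_vectorSpan (n := d - 1) (by rw [Fintype.card_coe, hFc]; omega)
  rw [Subtype.range_coe_subtype] at h
  exact h

theorem vectorSpan_face_ne_top (hd : 1 ≤ d) {F : Finset (Eu d)}
    (hF : AffineIndependent ℝ ((↑) : F → Eu d)) (hFc : F.card = d) :
    vectorSpan ℝ (F : Set (Eu d)) ≠ ⊤ := by
  intro h
  have h2 := finrank_vectorSpan_face hd hF hFc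
  rw [h, finrank_top, finrank_euclideanSpace_fin] at h2
  omega

theorem sub_mem_vectorSpan_of_mem_convexHull {F : Set (Eu d)} {x y : Eu d}
    (hx : x ∈ convexHull ℝ F) (hy : y ∈ convexHull ℝ F) : x - y ∈ vectorSpan ℝ F := by
  rw [← direction_affineSpan]
  exact AffineSubspace.vsub_mem_direction (convexHull_subset_affineSpan _ hx)
    (convexHull_subset_affineSpan _ hy)

/-- Integration over a face with respect to the surface measure, and then along a transversal
direction, is integration over the cylinder, up to a constant. -/
theorem exists_cylinder_const (hd : 1 ≤ d) {F : Finset (Eu d)}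
    (hF : AffineIndependent ℝ ((↑) : F → Eu d)) (hFc : F.card = d) {b : Eu d}
    (hb : b ∉ vectorSpan ℝ (F : Set (Eu d))) :
    ∃ c : ℝ≥0∞, c ≠ 0 ∧ c ≠ ∞ ∧ ∀ B ⊆ convexHull ℝ (F : Set (Eu d)), IsCompact B →
      ∀ g : Eu d → ℝ≥0∞, Measurable g →
        ∫⁻ y in B, (∫⁻ s in Icc (0 : ℝ) 1, g (y + s • b)) ∂μH[(d : ℝ) - 1] =
          c * ∫⁻ x in cylinder B b, g x := by
  set V := vectorSpan ℝ (F : Set (Eu d)) with hV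
  have hfr := finrank_vectorSpan_face hd hF hFc
  have hexp : (d : ℝ) - 1 = (Module.finrank ℝ V : ℝ) := by
    rw [hfr, Nat.cast_sub hd]; simp
  have hne : F.Nonempty := by rw [← Finset.card_pos]; omega
  obtain ⟨z, hz⟩ := hne
  have hzF : z ∈ convexHull ℝ (F : Set (Eu d)) := subset_convexHull ℝ _ (by exact_mod_cast hz)
  -- the linear isomorphism
  set Ψ₀ : (V × ℝ) →ₗ[ℝ] Eu d := V.subtype.coprod (LinearMap.toSpanSingleton ℝ (Eu d) b) with hΨ₀
  have hΨ₀app : ∀ y s, Ψ₀ (y, s) = (y : Eu d) + s • b := fun y s => by simp [hΨ₀]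
  have hinj : Function.Injective Ψ₀ := by
    rw [← LinearMap.ker_eq_bot, LinearMap.ker_eq_bot']
    rintro ⟨y, s⟩ h
    rw [hΨ₀app] at h
    have hs : s = 0 := by
      by_contra hs
      refine hb ((V.smul_mem_iff hs).1 ?_)
      have : s • b = -(y : Eu d) := by rw [eq_neg_iff_add_eq_zero, add_comm]; exact h
      rw [this]
      exact V.neg_mem y.2
    rw [hs, zero_smul, add_zero] at h
    ext1
    · exact Subtype.ext h
    · exact hs
  have hdim : Module.finrank ℝ (V × ℝ) = Module.finrank ℝ (Eu d) := by
    rw [Module.finrank_prod, hfr, Module.finrank_self, finrank_euclideanSpace_fin]; omega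
  set Ψ : (V × ℝ) ≃L[ℝ] Eu d :=
    (LinearEquiv.ofInjectiveOfFinrankEq Ψ₀ hinj hdim).toContinuousLinearEquiv with hΨ
  have hΨapp : ∀ y s, Ψ (y, s) = (y : Eu d) + s • b := fun y s => by
    rw [← hΨ₀app]; rfl
  set μV : Measure V := μH[(d : ℝ) - 1] with hμV
  have hHaarV : μV.IsAddHaarMeasure := by
    rw [hμV, hexp]; infer_instance
  have hHaar : (Measure.map Ψ (μV.prod volume)).IsAddHaarMeasure :=
    Ψ.isAddHaarMeasure_map _
  -- The `(d-1)`-dimensional Hausdorff measure is a Haar measure on the hyperplane, so uniqueness of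
  -- Haar measure gives the factor. Its value, which depends on the angle and length of `b`, is
  -- never needed: it cancels in `nodal_value_estimate`.
  set c := Measure.addHaarScalarFactor (Measure.map Ψ (μV.prod volume)) volume with hc
  have hceq : Measure.map Ψ (μV.prod volume) = c • (volume : Measure (Eu d)) :=
    Measure.isAddLeftInvariant_eq_smul _ _
  have hcpos : 0 < c := Measure.addHaarScalarFactor_pos_of_isAddHaarMeasure _ _
  refine ⟨c, by exact_mod_cast hcpos.ne', ENNReal.coe_ne_top, ?_⟩
  intro B hBF hB g hg
  have hcyl : MeasurableSet (cylinder B b) := (isCompact_cylinder hB b).measurableSet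
  have hBm : MeasurableSet B := hB.measurableSet
  -- the isometry
  set ι : V → Eu d := fun y => z + y with hι
  have hιi : Isometry ι := by
    refine Isometry.of_dist_eq fun x y => ?_
    simp [hι, dist_eq_norm]
  have hιe : MeasurableEmbedding ι := hιi.isClosedEmbedding.measurableEmbedding
  have hd0 : (0 : ℝ) ≤ (d : ℝ) - 1 := by rw [hexp]; positivity
  have hmap : Measure.map ι μV = (μH[(d : ℝ) - 1] : Measure (Eu d)).restrict (range ι) :=
    hιi.map_hausdorffMeasure (Or.inl hd0)
  have hBr : B ⊆ range ι := fun y hy =>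
    ⟨⟨y - z, sub_mem_vectorSpan_of_mem_convexHull (hBF hy) hzF⟩, by simp [hι]⟩
  have hface : ∀ φ : Eu d → ℝ≥0∞, ∫⁻ y in B, φ y ∂μH[(d : ℝ) - 1] =
      ∫⁻ y, B.indicator φ (ι y) ∂μV := by
    intro φ
    rw [← hιe.lintegral_map, hmap, lintegral_indicator hBm, Measure.restrict_restrict hBm,
      inter_eq_left.2 hBr]
  -- Transversality of `b` makes the decomposition into base point and height unique.
  have hmem : ∀ (y : V) (s : ℝ), ι y + s • b ∈ cylinder B b ↔ ι y ∈ B ∧ s ∈ Icc (0 : ℝ) 1 := by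
    intro y s
    constructor
    · rintro ⟨⟨y', s'⟩, ⟨hy', hs'⟩, h⟩
      simp only at h hy' hs'
      have hmemV : (s - s') • b ∈ V := by
        have : (s - s') • b = (y' - z) - y := by
          simp only [hι] at h
          rw [sub_smul, sub_eq_iff_eq_add, ← sub_eq_iff_eq_add']
          rw [← sub_eq_zero] at h ⊢
          rw [← neg_eq_zero, ← h]
          abel
        rw [this]
        exact V.sub_mem (sub_mem_vectorSpan_of_mem_convexHull (hBF hy') hzF) y.2
      have hss : s = s' := by
        by_contra hss
        exact hb ((V.smul_mem_iff (sub_ne_zero.2 hss)).1 hmemV)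
      subst hss
      have : y' = ι y := add_right_cancel h
      exact ⟨this ▸ hy', hs'⟩
    · rintro ⟨h1, h2⟩
      exact ⟨(ι y, s), ⟨h1, h2⟩, rfl⟩
  have hgi : Measurable ((cylinder B b).indicator g) := hg.indicator hcyl
  calc ∫⁻ y in B, (∫⁻ s in Icc (0 : ℝ) 1, g (y + s • b)) ∂μH[(d : ℝ) - 1]
      = ∫⁻ y : V, (∫⁻ s : ℝ, (cylinder B b).indicator g (z + Ψ (y, s))) ∂μV := by
        rw [hface]
        refine lintegral_congr fun y => ?_
        have e : ∀ s, z + Ψ (y, s) = ι y + s • b := fun s => by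
          rw [hΨapp, ← add_assoc]
        simp_rw [e]
        by_cases hy : ι y ∈ B
        · rw [indicator_of_mem hy, ← lintegral_indicator measurableSet_Icc]
          refine lintegral_congr fun s => ?_
          by_cases hs : s ∈ Icc (0 : ℝ) 1
          · rw [indicator_of_mem hs, indicator_of_mem ((hmem y s).2 ⟨hy, hs⟩)]
          · rw [indicator_of_notMem hs, indicator_of_notMem fun h => hs ((hmem y s).1 h).2]
        · rw [indicator_of_notMem hy]
          symm
          rw [lintegral_eq_zero_iff']
          · exact ae_of_all _ fun s => indicator_of_notMem (fun h => hy ((hmem y s).1 h).1) _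
          · exact (hgi.comp (by fun_prop)).aemeasurable
    _ = ∫⁻ p, (cylinder B b).indicator g (z + Ψ p) ∂(μV.prod volume) := by
        have hgm : Measurable fun p => (cylinder B b).indicator g (z + Ψ p) :=
          hgi.comp ((measurable_const_add z).comp Ψ.continuous.measurable)
        rw [lintegral_prod _ hgm.aemeasurable]
    _ = ∫⁻ x, (cylinder B b).indicator g (z + x) ∂(Measure.map Ψ (μV.prod volume)) := by
        have hgm : Measurable fun x => (cylinder B b).indicator g (z + x) :=
          hgi.comp (measurable_const_add z)
        rw [lintegral_map hgm Ψ.continuous.measurable]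
    _ = c * ∫⁻ x in cylinder B b, g x := by
        rw [hceq, lintegral_smul_measure, lintegral_add_left_eq_self, lintegral_indicator hcyl]
        rfl

theorem eLpNorm_two_sq {X F : Type*} [MeasurableSpace X] {μ : Measure X} [NormedAddCommGroup F]
    (f : X → F) : eLpNorm f 2 μ ^ 2 = ∫⁻ x, ‖f x‖ₑ ^ 2 ∂μ := by
  rw [eLpNorm_eq_lintegral_rpow_enorm_toReal (by norm_num) (by norm_num)]
  simp only [ENNReal.toReal_ofNat, one_div]
  rw [← ENNReal.rpow_natCast, ← ENNReal.rpow_mul]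
  norm_num

theorem enorm_add_sq_le (a b : ℝ) : ‖a + b‖ₑ ^ 2 ≤ 2 * ‖a‖ₑ ^ 2 + 2 * ‖b‖ₑ ^ 2 := by
  simp_rw [← ofReal_norm, ← ENNReal.ofReal_pow (norm_nonneg _)]
  rw [← ENNReal.ofReal_ofNat 2, ← ENNReal.ofReal_mul (by norm_num),
    ← ENNReal.ofReal_mul (by norm_num), ← ENNReal.ofReal_add (by positivity) (by positivity)]
  apply ENNReal.ofReal_le_ofReal
  simp only [Real.norm_eq_abs, sq_abs]
  nlinarith [sq_nonneg (a - b)]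

/-- Write `φ 0` as `φ s` minus the integral of `φ'` up to `s`, bound the integral by Cauchy-Schwarz,
and average over `s`. -/
theorem enorm_sq_zero_le_segment {φ φ' : ℝ → ℝ} (hφ : ∀ s, HasDerivAt φ (φ' s) s)
    (hc : Continuous φ') :
    ‖φ 0‖ₑ ^ 2 ≤ 2 * ∫⁻ s in Icc (0 : ℝ) 1, (‖φ s‖ₑ ^ 2 + ‖φ' s‖ₑ ^ 2) := by
  have hφc : Continuous φ := continuous_iff_continuousAt.2 fun s => (hφ s).continuousAt
  set μ : Measure ℝ := volume.restrict (Icc (0 : ℝ) 1) with hμ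
  have hprob : IsProbabilityMeasure μ := ⟨by simp [hμ]⟩
  set J := ∫⁻ s in Icc (0 : ℝ) 1, ‖φ' s‖ₑ ^ 2 with hJ
  have hCS : (∫⁻ s, ‖φ' s‖ₑ ∂μ) ^ 2 ≤ J := by
    have := eLpNorm_le_eLpNorm_of_exponent_le (μ := μ) (p := 1) (q := 2) (by norm_num)
      hc.aestronglyMeasurable
    rw [eLpNorm_one_eq_lintegral_enorm] at this
    calc _ ≤ eLpNorm φ' 2 μ ^ 2 := by gcongr
      _ = J := eLpNorm_two_sq _
  have hpt : ∀ s ∈ Icc (0 : ℝ) 1, ‖φ 0‖ₑ ^ 2 ≤ 2 * ‖φ s‖ₑ ^ 2 + 2 * J := by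
    intro s hs
    have hint : ∫ t in (0 : ℝ)..s, φ' t = φ s - φ 0 :=
      intervalIntegral.integral_eq_sub_of_hasDerivAt (fun t _ => hφ t)
        (hc.intervalIntegrable _ _)
    have e : φ 0 = φ s + -(∫ t in (0 : ℝ)..s, φ' t) := by rw [hint]; ring
    rw [e]
    refine (enorm_add_sq_le _ _).trans ?_
    gcongr
    rw [enorm_neg]
    refine le_trans ?_ hCS
    gcongr
    rw [intervalIntegral.integral_of_le hs.1]
    refine (enorm_integral_le_lintegral_enorm _).trans ?_
    exact lintegral_mono_set fun t ht => ⟨ht.1.le, ht.2.trans hs.2⟩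
  calc ‖φ 0‖ₑ ^ 2 = ∫⁻ _ in Icc (0 : ℝ) 1, ‖φ 0‖ₑ ^ 2 := by simp
    _ ≤ ∫⁻ s in Icc (0 : ℝ) 1, (2 * ‖φ s‖ₑ ^ 2 + 2 * J) :=
        setLIntegral_mono' measurableSet_Icc hpt
    _ = 2 * ∫⁻ s in Icc (0 : ℝ) 1, (‖φ s‖ₑ ^ 2 + ‖φ' s‖ₑ ^ 2) := by
        have hm : Measurable fun s => ‖φ s‖ₑ ^ 2 := (hφc.measurable.enorm).pow_const 2
        rw [lintegral_add_left (hm.const_mul 2), lintegral_add_left hm, lintegral_const_mul _ hm]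
        simp [mul_add, hJ]

/-- Trace inequality for smooth functions on a face, in terms of the cylinder over it. -/
theorem trace_inequality_smooth {B : Set (Eu d)} {b : Eu d} {c : ℝ≥0∞}
    (hc : ∀ g : Eu d → ℝ≥0∞, Measurable g →
        ∫⁻ y in B, (∫⁻ s in Icc (0 : ℝ) 1, g (y + s • b)) ∂μH[(d : ℝ) - 1] =
          c * ∫⁻ x in cylinder B b, g x)
    {v : Eu d → ℝ} (hv : ContDiff ℝ 1 v) :
    eLpNorm v 2 ((μH[(d : ℝ) - 1]).restrict B) ≤ (2 * c) ^ (1 / 2 : ℝ) *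
      (eLpNorm v 2 (volume.restrict (cylinder B b)) +
        ‖b‖ₑ * eLpNorm (fun x => fderiv ℝ v x) 2 (volume.restrict (cylinder B b))) := by
  have hfc : Continuous fun x => fderiv ℝ v x := hv.continuous_fderiv (by simp)
  have hfb : Continuous fun x => fderiv ℝ v x b := hfc.clm_apply continuous_const
  have hmeas : Measurable fun x => ‖v x‖ₑ ^ 2 + ‖fderiv ℝ v x b‖ₑ ^ 2 :=
    (hv.continuous.measurable.enorm.pow_const 2).add (hfb.measurable.enorm.pow_const 2)
  set X := eLpNorm v 2 (volume.restrict (cylinder B b)) with hX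
  set Y := eLpNorm (fun x => fderiv ℝ v x) 2 (volume.restrict (cylinder B b)) with hY
  have hsq : eLpNorm v 2 ((μH[(d : ℝ) - 1]).restrict B) ^ 2 ≤
      ((2 * c) ^ (1 / 2 : ℝ) * (X + ‖b‖ₑ * Y)) ^ 2 := by
    rw [eLpNorm_two_sq, mul_pow, ← ENNReal.rpow_natCast ((2 * c) ^ (1 / 2 : ℝ)),
      ← ENNReal.rpow_mul]
    norm_num
    calc ∫⁻ y in B, ‖v y‖ₑ ^ 2 ∂μH[(d : ℝ) - 1]
        ≤ ∫⁻ y in B, (2 * ∫⁻ s in Icc (0 : ℝ) 1,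
          (‖v (y + s • b)‖ₑ ^ 2 + ‖fderiv ℝ v (y + s • b) b‖ₑ ^ 2)) ∂μH[(d : ℝ) - 1] := by
          refine lintegral_mono fun y => ?_
          have hder : ∀ s : ℝ, HasDerivAt (fun s : ℝ => v (y + s • b))
              (fderiv ℝ v (y + s • b) b) s := by
            intro s
            have h1 : HasDerivAt (fun s : ℝ => y + s • b) b s := by
              simpa using ((hasDerivAt_id s).smul_const b).const_add y
            exact ((hv.differentiable (by simp) _).hasFDerivAt).comp_hasDerivAt s h1
          have := enorm_sq_zero_le_segment hder (by fun_prop)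
          simpa using this
      _ = 2 * (c * ∫⁻ x in cylinder B b, (‖v x‖ₑ ^ 2 + ‖fderiv ℝ v x b‖ₑ ^ 2)) := by
          rw [lintegral_const_mul' _ _ (by norm_num), hc _ hmeas]
      _ ≤ 2 * (c * (X ^ 2 + (‖b‖ₑ * Y) ^ 2)) := by
          gcongr
          rw [lintegral_add_left (hv.continuous.measurable.enorm.pow_const 2), hX, hY, mul_pow,
            eLpNorm_two_sq, eLpNorm_two_sq, ← lintegral_const_mul' _ _ (by simp)]
          gcongr with x
          rw [← mul_pow, mul_comm]
          gcongr
          exact ContinuousLinearMap.le_opENorm _ _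
      _ ≤ 2 * c * (X + ‖b‖ₑ * Y) ^ 2 := by
          rw [mul_assoc]
          gcongr
          rw [add_sq]
          calc X ^ 2 + (‖b‖ₑ * Y) ^ 2 ≤ X ^ 2 + (‖b‖ₑ * Y) ^ 2 + 2 * X * (‖b‖ₑ * Y) := le_self_add
            _ = _ := by ring
  exact (ENNReal.pow_le_pow_left_iff two_ne_zero).1 hsq

end ScottZhang

/-! ### Traces -/

namespace ScottZhang

variable {d : ℕ}

theorem eLpNorm_le_sobolevENorm {r : ℝ} (hr : 0 ≤ r) (g : Eu d → ℝ) :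
    eLpNorm g 2 volume ≤ sobolevENorm r g := by
  by_cases hg : MemLp (fun x => (g x : ℂ)) 2 (volume : Measure (Eu d))
  · refine (ENNReal.pow_le_pow_left_iff two_ne_zero).1 ?_
    rw [eLpNorm_two_sq, sobolevENorm_sq hg]
    refine (lintegral_fourier_toLp hg).ge.trans ?_
    refine lintegral_mono fun ξ => ?_
    refine le_mul_of_one_le_left' ?_
    rw [ENNReal.one_le_ofReal]
    exact Real.one_le_rpow (by nlinarith [sq_nonneg (2 * Real.pi * ‖ξ‖)]) hr
  · rw [sobolevENorm, dif_neg hg]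
    exact le_top

/-- `u n` converges in `H¹` to the function `f` with weak gradient `G`. -/
structure IsH1Limit (f : Eu d → ℝ) (G : Eu d → Eu d →L[ℝ] ℝ) (u : ℕ → Eu d → ℝ) : Prop where
  aesm : AEStronglyMeasurable f volume
  aesm_grad : AEStronglyMeasurable G volume
  contDiff : ∀ n, ContDiff ℝ 1 (u n)
  tendsto : Tendsto (fun n => eLpNorm (fun x => u n x - f x) 2 volume) atTop (𝓝 0)
  tendsto_grad : Tendsto (fun n => eLpNorm (fun x => fderiv ℝ (u n) x - G x) 2 volume) atTop (𝓝 0)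

theorem isH1Limit_of_sobolev {f : Eu d → ℝ} {G : Eu d → Eu d →L[ℝ] ℝ} {u : ℕ → Eu d → ℝ}
    (hf : MemLp (fun x => (f x : ℂ)) 2 (volume : Measure (Eu d))) (hG : Measurable G)
    (hfG : ∀ u : Eu d → ℝ, ContDiff ℝ (⊤ : ℕ∞) u → HasCompactSupport u →
      ∫⁻ x, ‖fderiv ℝ u x - G x‖ₑ ^ 2 ≤ sobolevENorm 1 (fun x => u x - f x) ^ 2)
    (hu : ∀ n, ContDiff ℝ (⊤ : ℕ∞) (u n) ∧ HasCompactSupport (u n))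
    (hlim : Tendsto (fun n => sobolevENorm 1 (fun x => u n x - f x)) atTop (𝓝 0)) :
    IsH1Limit f G u where
  aesm := (memLp_ofReal_iff.1 hf).aestronglyMeasurable
  aesm_grad := hG.aestronglyMeasurable
  contDiff n := (hu n).1.of_le (by exact_mod_cast le_top)
  tendsto := tendsto_of_tendsto_of_tendsto_of_le_of_le tendsto_const_nhds hlim
    (fun _ => zero_le) fun n => eLpNorm_le_sobolevENorm zero_le_one _
  tendsto_grad := tendsto_of_tendsto_of_tendsto_of_le_of_le tendsto_const_nhds hlim
    (fun _ => zero_le) fun n => by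
      refine (ENNReal.pow_le_pow_left_iff two_ne_zero).1 ?_
      rw [eLpNorm_two_sq]
      exact hfG _ (hu n).1 (hu n).2

theorem eLpNorm_sub_le_restrict {X : Type*} [NormedAddCommGroup X] {A : Set (Eu d)}
    {u f p : Eu d → X} (hu : AEStronglyMeasurable u volume) (hf : AEStronglyMeasurable f volume)
    (hp : AEStronglyMeasurable p volume) :
    eLpNorm (fun x => u x - p x) 2 (volume.restrict A) ≤
      eLpNorm (fun x => u x - f x) 2 volume + eLpNorm (fun x => f x - p x) 2 (volume.restrict A) := by
  have e : (fun x => u x - p x) = (fun x => u x - f x) + fun x => f x - p x := by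
    ext x; simp
  rw [e]
  refine (eLpNorm_add_le (hu.sub hf).restrict (hf.sub hp).restrict (by norm_num)).trans ?_
  exact add_le_add (eLpNorm_mono_measure _ Measure.restrict_le_self) le_rfl

/-- The smooth inequality is applied to `u n - p`, and `n → ∞` on both sides. The affine `p` is
subtracted so that the right side can become a local approximation error. -/
theorem trace_inequality_limit {B : Set (Eu d)} {b : Eu d} {c : ℝ≥0∞} (hct : c ≠ ∞)
    (hc : ∀ g : Eu d → ℝ≥0∞, Measurable g →
        ∫⁻ y in B, (∫⁻ s in Icc (0 : ℝ) 1, g (y + s • b)) ∂μH[(d : ℝ) - 1] =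
          c * ∫⁻ x in cylinder B b, g x)
    {f : Eu d → ℝ} {G : Eu d → Eu d →L[ℝ] ℝ} {u : ℕ → Eu d → ℝ} (hu : IsH1Limit f G u)
    {g : Eu d → ℝ} (hg : AEStronglyMeasurable g ((μH[(d : ℝ) - 1]).restrict B))
    (hlim : Tendsto (fun n => eLpNorm (fun x => u n x - g x) 2 ((μH[(d : ℝ) - 1]).restrict B))
      atTop (𝓝 0)) (p : Eu d →ᵃ[ℝ] ℝ) :
    eLpNorm (fun x => g x - p x) 2 ((μH[(d : ℝ) - 1]).restrict B) ≤ (2 * c) ^ (1 / 2 : ℝ) *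
      (eLpNorm (fun x => f x - p x) 2 (volume.restrict (cylinder B b)) +
        ‖b‖ₑ * eLpNorm (fun x => G x - LinearMap.toContinuousLinearMap p.linear) 2
          (volume.restrict (cylinder B b))) := by
  set K : ℝ≥0∞ := (2 * c) ^ (1 / 2 : ℝ) with hK
  have hKt : K ≠ ∞ := ENNReal.rpow_ne_top_of_nonneg (by norm_num) (ENNReal.mul_ne_top (by simp) hct)
  set L := LinearMap.toContinuousLinearMap p.linear with hL
  have hpd : ContDiff ℝ 1 p := by
    have : (p : Eu d → ℝ) = fun x => L x + p 0 := by
      ext x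
      have := affineMap_sub_eq_linear p x 0
      simp only [sub_zero] at this
      simp [hL, ← this]
    rw [this]; fun_prop
  have hpf : ∀ x, HasFDerivAt p L x := by
    intro x
    have : (p : Eu d → ℝ) = fun x => L x + p 0 := by
      ext x
      have := affineMap_sub_eq_linear p x 0
      simp only [sub_zero] at this
      simp [hL, ← this]
    rw [this]; exact L.hasFDerivAt.add_const _
  set A := eLpNorm (fun x => f x - p x) 2 (volume.restrict (cylinder B b))
  set A' := eLpNorm (fun x => G x - L) 2 (volume.restrict (cylinder B b))
  set δ := fun n => eLpNorm (fun x => u n x - f x) 2 volume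
  set δ' := fun n => eLpNorm (fun x => fderiv ℝ (u n) x - G x) 2 volume
  set ε := fun n => eLpNorm (fun x => u n x - g x) 2 ((μH[(d : ℝ) - 1]).restrict B)
  have key : ∀ n, eLpNorm (fun x => g x - p x) 2 ((μH[(d : ℝ) - 1]).restrict B) ≤
      ε n + K * ((δ n + A) + ‖b‖ₑ * (δ' n + A')) := by
    intro n
    have hun := hu.contDiff n
    have e : (fun x => g x - p x) = (fun x => g x - u n x) + fun x => u n x - p x := by
      ext x; simp
    rw [e]
    refine (eLpNorm_add_le (hg.sub hun.continuous.aestronglyMeasurable)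
      (hun.continuous.sub hpd.continuous).aestronglyMeasurable (by norm_num)).trans ?_
    gcongr
    · exact (eLpNorm_sub_comm _ _ _ _).le
    refine (trace_inequality_smooth hc (hun.sub hpd)).trans ?_
    gcongr
    · exact eLpNorm_sub_le_restrict hun.continuous.aestronglyMeasurable hu.aesm
        hpd.continuous.aestronglyMeasurable
    · have e2 : (fun x => fderiv ℝ (fun x => u n x - p x) x) = fun x => fderiv ℝ (u n) x - L := by
        ext1 x
        exact (((hun.differentiable (by simp) x).hasFDerivAt).sub (hpf x)).fderiv
      rw [e2]
      exact eLpNorm_sub_le_restrict (hun.continuous_fderiv (by simp)).aestronglyMeasurable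
        hu.aesm_grad aestronglyMeasurable_const
  refine ge_of_tendsto' (x := atTop) (b := _) ?_ key
  have h1 : Tendsto (fun n => (δ n + A) + ‖b‖ₑ * (δ' n + A')) atTop
      (𝓝 ((0 + A) + ‖b‖ₑ * (0 + A'))) :=
    (hu.tendsto.add tendsto_const_nhds).add
      (ENNReal.Tendsto.const_mul (hu.tendsto_grad.add tendsto_const_nhds) (Or.inr (by simp)))
  have h2 := hlim.add (ENNReal.Tendsto.const_mul h1 (Or.inr hKt))
  simpa using h2

/-- With `u = u'` this says that restrictions to the base are Cauchy, hence a trace exists; with two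
sequences it shows that the trace does not depend on the sequence. -/
theorem eLpNorm_trace_sub_le {B : Set (Eu d)} {b : Eu d} {c : ℝ≥0∞}
    (hc : ∀ g : Eu d → ℝ≥0∞, Measurable g →
        ∫⁻ y in B, (∫⁻ s in Icc (0 : ℝ) 1, g (y + s • b)) ∂μH[(d : ℝ) - 1] =
          c * ∫⁻ x in cylinder B b, g x)
    {f : Eu d → ℝ} {G : Eu d → Eu d →L[ℝ] ℝ} {u u' : ℕ → Eu d → ℝ} (hu : IsH1Limit f G u)
    (hu' : IsH1Limit f G u') (m n : ℕ) :
    eLpNorm (fun x => u m x - u' n x) 2 ((μH[(d : ℝ) - 1]).restrict B) ≤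
      (2 * c) ^ (1 / 2 : ℝ) * (eLpNorm (fun x => u m x - f x) 2 volume +
        ‖b‖ₑ * eLpNorm (fun x => fderiv ℝ (u m) x - G x) 2 volume) +
      (2 * c) ^ (1 / 2 : ℝ) * (eLpNorm (fun x => u' n x - f x) 2 volume +
        ‖b‖ₑ * eLpNorm (fun x => fderiv ℝ (u' n) x - G x) 2 volume) := by
  have h1 := hu.contDiff m
  have h2 := hu'.contDiff n
  refine (trace_inequality_smooth hc (h1.sub h2)).trans ?_
  rw [← mul_add]
  refine mul_le_mul_right ?_ _
  rw [add_add_add_comm, ← mul_add]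
  refine add_le_add ?_ (mul_le_mul_right ?_ _)
  · refine (eLpNorm_sub_le_restrict h1.continuous.aestronglyMeasurable hu.aesm
      h2.continuous.aestronglyMeasurable).trans ?_
    gcongr
    exact (eLpNorm_sub_comm _ _ _ _).le.trans (eLpNorm_mono_measure _ Measure.restrict_le_self)
  · have e2 : (fun x => fderiv ℝ (fun x => u m x - u' n x) x) =
        fun x => fderiv ℝ (u m) x - fderiv ℝ (u' n) x := by
      ext1 x
      exact (((h1.differentiable (by simp) x).hasFDerivAt).sub
        ((h2.differentiable (by simp) x).hasFDerivAt)).fderiv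
    rw [e2]
    refine (eLpNorm_sub_le_restrict (h1.continuous_fderiv (by simp)).aestronglyMeasurable
      hu.aesm_grad (h2.continuous_fderiv (by simp)).aestronglyMeasurable).trans ?_
    gcongr
    exact (eLpNorm_sub_comm _ _ _ _).le.trans (eLpNorm_mono_measure _ Measure.restrict_le_self)

theorem IsH1Limit.tendsto_error {f : Eu d → ℝ} {G : Eu d → Eu d →L[ℝ] ℝ} {u : ℕ → Eu d → ℝ}
    (hu : IsH1Limit f G u) (b : Eu d) {c : ℝ≥0∞} (hct : c ≠ ∞) :
    Tendsto (fun n => (2 * c) ^ (1 / 2 : ℝ) * (eLpNorm (fun x => u n x - f x) 2 volume +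
        ‖b‖ₑ * eLpNorm (fun x => fderiv ℝ (u n) x - G x) 2 volume)) atTop (𝓝 0) := by
  have hKt : (2 * c) ^ (1 / 2 : ℝ) ≠ ∞ :=
    ENNReal.rpow_ne_top_of_nonneg (by norm_num) (ENNReal.mul_ne_top (by simp) hct)
  have := ENNReal.Tendsto.const_mul (hu.tendsto.add
    (ENNReal.Tendsto.const_mul (a := ‖b‖ₑ) hu.tendsto_grad (Or.inr (by simp)))) (Or.inr hKt)
  simpa using this

theorem exists_transversal (hd : 1 ≤ d) {F : Finset (Eu d)}
    (hF : AffineIndependent ℝ ((↑) : F → Eu d)) (hFc : F.card = d) :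
    ∃ b, b ∉ vectorSpan ℝ (F : Set (Eu d)) := by
  by_contra! h
  exact vectorSpan_face_ne_top hd hF hFc (eq_top_iff.2 fun x _ => h x)

/-- The cylinder formula with integrand one: the face measure is a finite multiple of the volume of
a compact cylinder. -/
theorem faceMeasure_isFinite (hd : 1 ≤ d) {F : Finset (Eu d)}
    (hF : AffineIndependent ℝ ((↑) : F → Eu d)) (hFc : F.card = d) :
    IsFiniteMeasure (faceMeasure F) := by
  obtain ⟨b, hb⟩ := exists_transversal hd hF hFc
  obtain ⟨c, -, hct, hc⟩ := exists_cylinder_const hd hF hFc hb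
  have hcomp := convexHull_face_isCompact F
  have h := hc _ subset_rfl hcomp (fun _ => 1) measurable_const
  refine ⟨?_⟩
  simp only [lintegral_const, Measure.restrict_apply MeasurableSet.univ, univ_inter, one_mul,
    Real.volume_Icc, sub_zero, ENNReal.ofReal_one] at h
  rw [faceMeasure, Measure.restrict_apply MeasurableSet.univ, univ_inter, h]
  exact ENNReal.mul_lt_top hct.lt_top (isCompact_cylinder hcomp b).measure_lt_top

theorem memLp_faceMeasure_of_continuous (hd : 1 ≤ d) {F : Finset (Eu d)}
    (hF : AffineIndependent ℝ ((↑) : F → Eu d)) (hFc : F.card = d) {u : Eu d → ℝ}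
    (hu : Continuous u) : MemLp u 2 (faceMeasure F) := by
  have := faceMeasure_isFinite hd hF hFc
  have hcomp := convexHull_face_isCompact F
  obtain ⟨C, hC⟩ := hcomp.exists_bound_of_continuousOn hu.continuousOn
  refine MemLp.of_bound hu.aestronglyMeasurable C ?_
  exact ae_restrict_of_forall_mem hcomp.measurableSet hC

/-- Existence of traces. -/
theorem exists_trace (hd : 1 ≤ d) {F : Finset (Eu d)}
    (hF : AffineIndependent ℝ ((↑) : F → Eu d)) (hFc : F.card = d)
    {f : Eu d → ℝ} {G : Eu d → Eu d →L[ℝ] ℝ} {u : ℕ → Eu d → ℝ} (hu : IsH1Limit f G u) :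
    ∃ g, MemLp g 2 (faceMeasure F) ∧
      Tendsto (fun n => eLpNorm (fun x => u n x - g x) 2 (faceMeasure F)) atTop (𝓝 0) := by
  obtain ⟨b, hb⟩ := exists_transversal hd hF hFc
  obtain ⟨c, -, hct, hc⟩ := exists_cylinder_const hd hF hFc hb
  have hc' := hc _ subset_rfl (convexHull_face_isCompact F)
  have hmem := fun n => memLp_faceMeasure_of_continuous hd hF hFc (hu.contDiff n).continuous
  have hcau : CauchySeq fun n => (hmem n).toLp (u n) := by
    rw [EMetric.cauchySeq_iff]
    intro ε hε
    have hε2 : 0 < ε / 2 := ENNReal.div_pos hε.ne' (by simp)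
    obtain ⟨N, hN⟩ := eventually_atTop.1
      ((hu.tendsto_error b hct).eventually (eventually_lt_nhds hε2))
    refine ⟨N, fun m hm n hn => ?_⟩
    rw [Lp.edist_toLp_toLp]
    refine (eLpNorm_trace_sub_le hc' hu hu m n).trans_lt ?_
    rw [← ENNReal.add_halves ε]
    exact ENNReal.add_lt_add (hN m hm) (hN n hn)
  obtain ⟨g, hg⟩ := cauchySeq_tendsto_of_complete hcau
  refine ⟨g, Lp.memLp g, ?_⟩
  have := (Lp.tendsto_Lp_iff_tendsto_eLpNorm'' u hmem g (Lp.memLp g)).1 (by simpa using hg)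
  exact this

theorem trace_ae_unique (hd : 1 ≤ d) {F : Finset (Eu d)}
    (hF : AffineIndependent ℝ ((↑) : F → Eu d)) (hFc : F.card = d)
    {f : Eu d → ℝ} {G : Eu d → Eu d →L[ℝ] ℝ} {u u' : ℕ → Eu d → ℝ} (hu : IsH1Limit f G u)
    (hu' : IsH1Limit f G u') {g g' : Eu d → ℝ} (hg : AEStronglyMeasurable g (faceMeasure F))
    (hg' : AEStronglyMeasurable g' (faceMeasure F))
    (hlim : Tendsto (fun n => eLpNorm (fun x => u n x - g x) 2 (faceMeasure F)) atTop (𝓝 0))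
    (hlim' : Tendsto (fun n => eLpNorm (fun x => u' n x - g' x) 2 (faceMeasure F)) atTop (𝓝 0)) :
    g =ᵐ[faceMeasure F] g' := by
  obtain ⟨b, hb⟩ := exists_transversal hd hF hFc
  obtain ⟨c, -, hct, hc⟩ := exists_cylinder_const hd hF hFc hb
  have hc' := hc _ subset_rfl (convexHull_face_isCompact F)
  have key : eLpNorm (g - g') 2 (faceMeasure F) = 0 := by
    refine le_antisymm ?_ zero_le
    have hsum := (hlim.add ((hu.tendsto_error b hct).add (hu'.tendsto_error b hct))).add hlim'
    simp only [add_zero] at hsum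
    refine ge_of_tendsto' hsum fun n => ?_
    have h1 := (hu.contDiff n).continuous.aestronglyMeasurable (μ := faceMeasure F)
    have h2 := (hu'.contDiff n).continuous.aestronglyMeasurable (μ := faceMeasure F)
    have e : g - g' = ((fun x => g x - u n x) + fun x => u n x - u' n x) +
        fun x => u' n x - g' x := by ext x; simp
    rw [e]
    refine (eLpNorm_add_le ((hg.sub h1).add (h1.sub h2)) (h2.sub hg') (by norm_num)).trans ?_
    gcongr
    refine (eLpNorm_add_le (hg.sub h1) (h1.sub h2) (by norm_num)).trans ?_
    gcongr
    · exact (eLpNorm_sub_comm _ _ _ _).le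
    · exact eLpNorm_trace_sub_le hc' hu hu' n n
    · exact le_rfl
  rw [eLpNorm_eq_zero_iff (hg.sub hg') (by norm_num)] at key
  filter_upwards [key] with x hx
  simpa [sub_eq_zero] using hx

theorem volume_face_eq_zero (hd : 1 ≤ d) {F : Finset (Eu d)}
    (hF : AffineIndependent ℝ ((↑) : F → Eu d)) (hFc : F.card = d) :
    volume (convexHull ℝ (F : Set (Eu d))) = 0 := by
  refine measure_mono_null (convexHull_subset_affineSpan _) ?_
  refine Measure.addHaar_affineSubspace _ _ fun h => ?_
  apply vectorSpan_face_ne_top hd hF hFc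
  rw [← direction_affineSpan, h, AffineSubspace.direction_top]

/-- The weak gradient vanishes where the approximating functions do eventually. -/
theorem grad_ae_eq_zero {f : Eu d → ℝ} {G : Eu d → Eu d →L[ℝ] ℝ} {u : ℕ → Eu d → ℝ}
    (hu : IsH1Limit f G u) {A : Set (Eu d)} (hA : MeasurableSet A)
    (h0 : ∀ x ∈ A, ∀ᶠ n in atTop, u n =ᶠ[𝓝 x] 0) : ∀ᵐ x ∂(volume.restrict A), G x = 0 := by
  -- Fatou: on `A` the integrands on the right are eventually equal to `|G|²`, while their integrals
  -- tend to zero.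
  have hfat : ∫⁻ x in A, ‖G x‖ₑ ^ 2 ≤ 0 := by
    calc ∫⁻ x in A, ‖G x‖ₑ ^ 2
        ≤ ∫⁻ x in A, liminf (fun n => ‖fderiv ℝ (u n) x - G x‖ₑ ^ 2) atTop := by
          refine setLIntegral_mono' hA fun x hx => ?_
          have : Tendsto (fun n => ‖fderiv ℝ (u n) x - G x‖ₑ ^ 2) atTop (𝓝 (‖G x‖ₑ ^ 2)) := by
            refine tendsto_const_nhds.congr' ?_
            filter_upwards [h0 x hx] with n hn
            rw [hn.fderiv_eq]
            simp
          rw [this.liminf_eq]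
      _ ≤ liminf (fun n => ∫⁻ x in A, ‖fderiv ℝ (u n) x - G x‖ₑ ^ 2) atTop := by
          refine lintegral_liminf_le' fun n => ?_
          exact ((((hu.contDiff n).continuous_fderiv (by simp)).aestronglyMeasurable.sub
            hu.aesm_grad).restrict.enorm).pow_const 2
      _ ≤ 0 := by
          have : Tendsto (fun n => ∫⁻ x in A, ‖fderiv ℝ (u n) x - G x‖ₑ ^ 2) atTop (𝓝 0) := by
            have h2 := (ENNReal.continuous_pow 2).continuousAt.tendsto.comp hu.tendsto_grad
            simp only [ne_eq, OfNat.ofNat_ne_zero, not_false_eq_true, zero_pow] at h2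
            refine tendsto_of_tendsto_of_tendsto_of_le_of_le tendsto_const_nhds h2
              (fun _ => zero_le) fun n => ?_
            simp only [Function.comp]
            rw [eLpNorm_two_sq]
            exact setLIntegral_le_lintegral _ _
          rw [this.liminf_eq]
  have := (lintegral_eq_zero_iff' (hu.aesm_grad.restrict.enorm.pow_const 2)).1
    (le_antisymm hfat zero_le)
  filter_upwards [this] with x hx
  have hx' : ‖G x‖ₑ = 0 := (pow_eq_zero_iff two_ne_zero).1 hx
  rwa [← ofReal_norm, ENNReal.ofReal_eq_zero, norm_le_zero_iff] at hx'

theorem eLpNorm_two_eq_zero_of_ae {X F : Type*} [MeasurableSpace X] {μ : Measure X}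
    [NormedAddCommGroup F] {f : X → F} (h : ∀ᵐ x ∂μ, f x = 0) : eLpNorm f 2 μ = 0 :=
  (eLpNorm_congr_ae (g := fun _ => 0) h).trans eLpNorm_zero'

/-- The trace vanishes on boundary faces. -/
theorem trace_eq_zero_of_boundary (hd : 1 ≤ d) {D : Set (Eu d)} (hDo : IsOpen D)
    (hDl : HasLipschitzBoundary D) {F : Finset (Eu d)}
    (hF : AffineIndependent ℝ ((↑) : F → Eu d)) (hFc : F.card = d)
    (hFD : convexHull ℝ (F : Set (Eu d)) ⊆ frontier D)
    {f : Eu d → ℝ} {G : Eu d → Eu d →L[ℝ] ℝ} {u : ℕ → Eu d → ℝ} (hu : IsH1Limit f G u)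
    (hfD : ∀ x ∉ D, f x = 0) (h0 : ∀ x ∉ closure D, ∀ᶠ n in atTop, u n =ᶠ[𝓝 x] 0)
    {g : Eu d → ℝ} (hg : AEStronglyMeasurable g (faceMeasure F))
    (hlim : Tendsto (fun n => eLpNorm (fun x => u n x - g x) 2 (faceMeasure F)) atTop (𝓝 0)) :
    g =ᵐ[faceMeasure F] 0 := by
  have hcomp := convexHull_face_isCompact F
  have hG0 := grad_ae_eq_zero hu (isClosed_closure (s := D)).isOpen_compl.measurableSet h0
  rw [Filter.EventuallyEq, faceMeasure, ae_restrict_iff' hcomp.measurableSet, ae_iff]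
  -- The outward direction provided by the Lipschitz chart works only near a given point, so the
  -- face is treated in small pieces.
  refine measure_null_of_locally_null _ fun x hx => ?_
  simp only [Pi.zero_apply, Classical.not_imp, mem_ofPred_eq] at hx
  obtain ⟨b, δ, hb, hδ, hbδ⟩ := hDl.exterior_direction hDo (hFD hx.1)
    (vectorSpan_face_ne_top hd hF hFc)
  obtain ⟨c, -, hct, hc⟩ := exists_cylinder_const hd hF hFc hb
  set B := convexHull ℝ (F : Set (Eu d)) ∩ Metric.closedBall x (δ / 2) with hB
  have hBc : IsCompact B := hcomp.inter_right Metric.isClosed_closedBall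
  have hc' := hc B inter_subset_left hBc
  -- Above its base the cylinder is exterior to `D`, so `f` and `G` vanish almost everywhere on it
  -- and the trace inequality with `p = 0` gives `g = 0` on `B`.
  have hcylsub : cylinder B b ⊆ convexHull ℝ (F : Set (Eu d)) ∪ (closure D)ᶜ := by
    rintro _ ⟨⟨y, s⟩, ⟨hy, hs⟩, rfl⟩
    simp only at hy hs ⊢
    rcases hs.1.eq_or_lt with h | h
    · left; rw [← h]; simpa using hy.1
    · right
      exact hbδ y (hFD hy.1) (Metric.closedBall_subset_ball (by linarith) hy.2) s ⟨h, hs.2⟩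
  have hcyl_ae : ∀ᵐ x ∂(volume.restrict (cylinder B b)), f x - (0 : Eu d →ᵃ[ℝ] ℝ) x = 0 ∧
      G x - LinearMap.toContinuousLinearMap (0 : Eu d →ᵃ[ℝ] ℝ).linear = 0 := by
    rw [ae_restrict_iff' (isClosed_closure (s := D)).isOpen_compl.measurableSet] at hG0
    rw [ae_restrict_iff' (isCompact_cylinder hBc b).measurableSet]
    have hn : ∀ᵐ x ∂(volume : Measure (Eu d)), x ∉ convexHull ℝ (F : Set (Eu d)) :=
      measure_eq_zero_iff_ae_notMem.1 (volume_face_eq_zero hd hF hFc)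
    filter_upwards [hG0, hn] with y hy1 hy2 hy3
    have hy4 : y ∈ (closure D)ᶜ := (hcylsub hy3).resolve_left hy2
    refine ⟨?_, ?_⟩
    · simp [hfD y fun h => hy4 (subset_closure h)]
    · rw [hy1 hy4]; simp
  have hBle : (μH[(d : ℝ) - 1] : Measure (Eu d)).restrict B ≤ faceMeasure F :=
    Measure.restrict_mono_set _ inter_subset_left
  have hineq := trace_inequality_limit hct hc' hu (hg.mono_measure hBle)
    (tendsto_of_tendsto_of_tendsto_of_le_of_le tendsto_const_nhds hlim
      (fun _ => zero_le) fun n => eLpNorm_mono_measure _ hBle) 0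
  have z1 : eLpNorm (fun x => f x - (0 : Eu d →ᵃ[ℝ] ℝ) x) 2
      (volume.restrict (cylinder B b)) = 0 :=
    eLpNorm_two_eq_zero_of_ae (hcyl_ae.mono fun x hx => hx.1)
  have z2 : eLpNorm (fun x => G x - LinearMap.toContinuousLinearMap
      (0 : Eu d →ᵃ[ℝ] ℝ).linear) 2 (volume.restrict (cylinder B b)) = 0 :=
    eLpNorm_two_eq_zero_of_ae (hcyl_ae.mono fun x hx => hx.2)
  have hineq0 : eLpNorm (fun x => g x - (0 : Eu d →ᵃ[ℝ] ℝ) x) 2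
      ((μH[(d : ℝ) - 1] : Measure (Eu d)).restrict B) = 0 := by
    refine le_antisymm (hineq.trans (le_of_eq ?_)) zero_le
    rw [z1, z2, mul_zero, add_zero, mul_zero]
  have hsm : AEStronglyMeasurable (fun x => g x - (0 : Eu d →ᵃ[ℝ] ℝ) x)
      ((μH[(d : ℝ) - 1] : Measure (Eu d)).restrict B) :=
    (hg.mono_measure hBle).sub (show AEStronglyMeasurable (fun x => (0 : Eu d →ᵃ[ℝ] ℝ) x) _ from
      aestronglyMeasurable_const (b := (0 : ℝ)))
  have hineq := (eLpNorm_eq_zero_iff hsm (by norm_num)).1 hineq0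
  rw [Filter.EventuallyEq, ae_restrict_iff' hBc.measurableSet, ae_iff] at hineq
  refine ⟨_ ∩ Metric.closedBall x (δ / 2), inter_mem_nhdsWithin _
    (Metric.closedBall_mem_nhds x (by positivity)), measure_mono_null ?_ hineq⟩
  rintro y ⟨hy1, hy2⟩
  simp only [Pi.zero_apply, Classical.not_imp, mem_ofPred_eq] at hy1 ⊢
  exact ⟨⟨hy1.1, hy2⟩, by simpa using hy1.2⟩

end ScottZhang

/-! ### Dual functions and nodal values -/

namespace ScottZhang

variable {d : ℕ} {K : Geometry.SimplicialComplex ℝ (Eu d)} {D : Set (Eu d)}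

theorem exists_opposite_vertex {T F : Finset (Eu d)} (hT : T ∈ cells K) (hFT : F ⊆ T)
    (hFc : F.card = d) : ∃ a, (T : Set (Eu d)) = insert a (F : Set (Eu d)) ∧ a ∈ T ∧ a ∉ F := by
  classical
  obtain ⟨a, ha, hTa⟩ := (Finset.covBy_iff_exists_insert).1
    (Finset.covBy_iff_card_sdiff_eq_one.2 ⟨hFT, by
      rw [Finset.card_sdiff_of_subset hFT, hT.2, hFc]; omega⟩)
  exact ⟨a, by rw [← hTa, Finset.coe_insert], hTa ▸ Finset.mem_insert_self _ _, ha⟩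

/-- Affine independence of the vertices of `T`; the edge from `z` to the opposite vertex can thus
serve as cylinder axis. -/
theorem opposite_sub_notMem_vectorSpan {T F : Finset (Eu d)} (hT : T ∈ cells K) (hFT : F ⊆ T)
    {a z : Eu d} (ha : a ∈ T) (haF : a ∉ F) (hz : z ∈ F) :
    a - z ∉ vectorSpan ℝ (F : Set (Eu d)) := by
  intro h
  have h1 : a ∈ affineSpan ℝ (F : Set (Eu d)) := by
    rw [← direction_affineSpan] at h
    have := AffineSubspace.vadd_mem_of_mem_direction h
      (subset_affineSpan ℝ (F : Set (Eu d)) (by exact_mod_cast hz : z ∈ (F : Set (Eu d))))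
    simpa using this
  have h2 := (K.indep hT.1).notMem_affineSpan_sdiff (⟨a, ha⟩ : T) univ
  refine h2 (affineSpan_mono ℝ ?_ h1)
  intro y hy
  refine ⟨⟨y, hFT (by exact_mod_cast hy)⟩, ⟨mem_univ _, ?_⟩, rfl⟩
  rintro h3
  have h4 : y = a := congrArg Subtype.val h3
  exact haF (by rw [← h4]; exact_mod_cast hy)

/-- The cell is the cone over `F` with apex `a`: for `s + t = 1`, `s a + t y = (s z + t y) + s (a -
z)`, with the bracket in the face. -/
theorem cell_subset_cylinder {T F : Finset (Eu d)} {a z : Eu d}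
    (hTa : (T : Set (Eu d)) = insert a (F : Set (Eu d))) (hz : z ∈ F) :
    convexHull ℝ (T : Set (Eu d)) ⊆ cylinder (convexHull ℝ (F : Set (Eu d))) (a - z) := by
  have hzF : z ∈ (F : Set (Eu d)) := by exact_mod_cast hz
  rw [hTa, convexHull_insert ⟨z, hzF⟩]
  intro x hx
  rw [mem_convexJoin] at hx
  obtain ⟨_, rfl, y, hy, s, t, hs, ht, hst, rfl⟩ := hx
  refine ⟨(s • z + t • y, s), ⟨?_, hs, by linarith⟩, ?_⟩
  · exact (convex_convexHull ℝ _) (subset_convexHull ℝ _ hzF) hy hs ht hst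
  · simp only [smul_sub]; abel

theorem memLp_affine_faceMeasure (hd : 1 ≤ d) {F : Finset (Eu d)} (hF : F ∈ K.faces)
    (hFc : F.card = d) (p : Eu d →ᵃ[ℝ] ℝ) : MemLp p 2 (faceMeasure F) :=
  memLp_faceMeasure_of_continuous hd (K.indep hF) hFc p.continuous_of_finiteDimensional

theorem sq_mul_faceMeasure_le (hd : 1 ≤ d) {F : Finset (Eu d)} (hF : F ∈ K.faces)
    (hFc : F.card = d) (p : Eu d →ᵃ[ℝ] ℝ) {x : Eu d}
    (hx : x ∈ convexHull ℝ (F : Set (Eu d))) :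
    ENNReal.ofReal (p x ^ 2) * (ENNReal.ofReal ((1 / 4) ^ (d - 1)) *
      μH[(d : ℝ) - 1] (convexHull ℝ (F : Set (Eu d)))) ≤
      4 * ENNReal.ofReal (∫ y, p y * p y ∂(faceMeasure F)) := by
  refine (sq_mul_measure_le_lintegral (convexHull_face_isCompact F) (convex_convexHull ℝ _)
    (fun y _ => hausdorffMeasure_homothety_quarter hd _ y) p hx).trans_eq ?_
  congr 1
  rw [ofReal_integral_eq_lintegral_ofReal]
  · refine lintegral_congr fun y => ?_
    rw [← ofReal_norm, ← ENNReal.ofReal_pow (norm_nonneg _), Real.norm_eq_abs, sq_abs, sq]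
  · exact (memLp_affine_faceMeasure hd hF hFc p).integrable_mul
      (memLp_affine_faceMeasure hd hF hFc p)
  · exact ae_of_all _ fun y => mul_self_nonneg _

/-- The face measure is a positive multiple of the volume of a cylinder that contains the cell. -/
theorem hausdorffMeasure_face_pos (hd : 1 ≤ d) {T F : Finset (Eu d)} (hT : T ∈ cells K)
    (hFT : F ⊆ T) (hFc : F.card = d) (hF : F ∈ K.faces)
    (hvol : volume (convexHull ℝ (T : Set (Eu d))) ≠ 0) :
    μH[(d : ℝ) - 1] (convexHull ℝ (F : Set (Eu d))) ≠ 0 := by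
  obtain ⟨a, hTa, ha, haF⟩ := exists_opposite_vertex hT hFT hFc
  obtain ⟨z, hz⟩ := K.nonempty_of_mem_faces hF
  obtain ⟨c, hc0, -, hc⟩ := exists_cylinder_const hd (K.indep hF) hFc
    (opposite_sub_notMem_vectorSpan hT hFT ha haF hz)
  have h := hc _ subset_rfl (convexHull_face_isCompact F) (fun _ => 1) measurable_const
  simp only [lintegral_const, Measure.restrict_apply MeasurableSet.univ, univ_inter, one_mul,
    Real.volume_Icc, sub_zero, ENNReal.ofReal_one] at h
  rw [h]
  refine mul_ne_zero hc0 fun h0 => hvol (measure_mono_null (cell_subset_cylinder hTa hz) h0)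

/-- Existence of the dual function of a vertex of a face. -/
theorem exists_dualFunction (hd : 1 ≤ d) {T F : Finset (Eu d)} (hT : T ∈ cells K)
    (hFT : F ⊆ T) (hFc : F.card = d) (hF : F ∈ K.faces)
    (hvol : volume (convexHull ℝ (T : Set (Eu d))) ≠ 0) {z : Eu d} (hz : z ∈ F) :
    ∃ ψ, IsDualFunction F z ψ := by
  classical
  have hint : ∀ p q : Eu d →ᵃ[ℝ] ℝ, Integrable (fun x => p x * q x) (faceMeasure F) := fun p q =>
    (memLp_affine_faceMeasure hd hF hFc p).integrable_mul (memLp_affine_faceMeasure hd hF hFc q)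
  -- Only values on the face matter, so the value at the opposite vertex is set to zero.
  set ext : (F → ℝ) → Eu d → ℝ := fun c y => if h : y ∈ F then c ⟨y, h⟩ else 0 with hext
  have hextF : ∀ c (y : F), ext c y = c y := fun c y => by simp [hext]
  have happ : ∀ (φ : Eu d → ℝ), EqOn (cellInterp hT φ)
      (fun x => ∑ y : F, φ y * cellInterp hT (ext (Pi.single y 1)) x)
      (convexHull ℝ (F : Set (Eu d))) := by
    intro φ
    set q : Eu d →ᵃ[ℝ] ℝ := ∑ y : F, φ y • cellInterp hT (ext (Pi.single y 1)) with hq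
    have hqa : ∀ x, q x = ∑ y : F, φ y * cellInterp hT (ext (Pi.single y 1)) x := by
      intro x
      have : ∀ s : Finset F, (∑ y ∈ s, φ y • cellInterp hT (ext (Pi.single y 1)) :
          Eu d →ᵃ[ℝ] ℝ) x = ∑ y ∈ s, φ y * cellInterp hT (ext (Pi.single y 1)) x := by
        intro s
        induction s using Finset.induction_on with
        | empty => simp
        | insert a s ha ih => rw [Finset.sum_insert ha, Finset.sum_insert ha, ← ih]; rfl
      exact this _
    have : EqOn (cellInterp hT φ) q (convexHull ℝ (F : Set (Eu d))) := by
      refine affine_eqOn_convexHull fun x hx => ?_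
      have hxF : x ∈ F := by exact_mod_cast hx
      rw [hqa, cellInterp_vertex hT _ (hFT hxF), Finset.sum_eq_single (⟨x, hxF⟩ : F)]
      · rw [cellInterp_vertex hT _ (hFT hxF)]
        simp [hext, hxF]
      · intro y _ hy
        rw [cellInterp_vertex hT _ (hFT hxF)]
        simp [hext, hxF, hy.symm]
      · intro h; exact absurd (Finset.mem_univ _) h
    exact fun x hx => (this hx).trans (hqa x)
  have hsupp : ∀ {φ φ' : Eu d → ℝ}, EqOn φ φ' (convexHull ℝ (F : Set (Eu d))) →
      φ =ᵐ[faceMeasure F] φ' := fun {φ φ'} h =>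
    ae_restrict_of_forall_mem (convexHull_face_isCompact F).measurableSet h
  -- The Gram matrix of the nodal basis in `L²` of the face. A kernel vector gives an affine
  -- function of zero `L²` norm on the face, which vanishes there by the inverse inequality; so `M`
  -- is invertible.
  set M : Matrix F F ℝ := fun y y' => ∫ x, cellInterp hT (ext (Pi.single y 1)) x *
    cellInterp hT (ext (Pi.single y' 1)) x ∂(faceMeasure F) with hM
  have hMv : ∀ (c : F → ℝ) (y : F), M.mulVec c y = ∫ x, cellInterp hT (ext (Pi.single y 1)) x *
      cellInterp hT (ext c) x ∂(faceMeasure F) := by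
    intro c y
    have e : (fun x => cellInterp hT (ext (Pi.single y 1)) x * cellInterp hT (ext c) x)
        =ᵐ[faceMeasure F] fun x => ∑ y' : F, (cellInterp hT (ext (Pi.single y 1)) x *
          cellInterp hT (ext (Pi.single y' 1)) x) * c y' := by
      refine hsupp fun x hx => ?_
      rw [happ (ext c) hx, Finset.mul_sum]
      refine Finset.sum_congr rfl fun y' _ => ?_
      rw [hextF]; ring
    rw [integral_congr_ae e, integral_finsetSum _ fun y' _ => (hint _ _).mul_const _]
    simp_rw [integral_mul_const]
    rfl
  have hinj : Function.Injective M.mulVecLin := by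
    rw [← LinearMap.ker_eq_bot, LinearMap.ker_eq_bot']
    intro c hc
    have hc' : ∀ y, M.mulVec c y = 0 := fun y => congrFun hc y
    have h0 : ∫ x, cellInterp hT (ext c) x * cellInterp hT (ext c) x ∂(faceMeasure F) = 0 := by
      have e : (fun x => cellInterp hT (ext c) x * cellInterp hT (ext c) x)
          =ᵐ[faceMeasure F] fun x => ∑ y : F, (cellInterp hT (ext (Pi.single y 1)) x *
            cellInterp hT (ext c) x) * c y := by
        refine hsupp fun x hx => ?_
        nth_rewrite 1 [happ (ext c) hx]
        rw [Finset.sum_mul]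
        refine Finset.sum_congr rfl fun y' _ => ?_
        rw [hextF]; ring
      rw [integral_congr_ae e, integral_finsetSum _ fun y' _ => (hint _ _).mul_const _]
      simp_rw [integral_mul_const, ← hMv, hc']
      simp
    ext y
    have hyF : (y : Eu d) ∈ convexHull ℝ (F : Set (Eu d)) :=
      subset_convexHull ℝ _ (by exact_mod_cast y.2)
    have := sq_mul_faceMeasure_le hd hF hFc (cellInterp hT (ext c)) hyF
    rw [h0, ENNReal.ofReal_zero, mul_zero, nonpos_iff_eq_zero, mul_eq_zero, mul_eq_zero] at this
    rcases this with h | h | h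
    · rw [ENNReal.ofReal_eq_zero, cellInterp_vertex hT _ (hFT y.2), hextF] at h
      simpa using pow_eq_zero_iff two_ne_zero |>.1 (le_antisymm h (sq_nonneg _))
    · rw [ENNReal.ofReal_eq_zero] at h
      exact absurd h (not_le.2 (by positivity))
    · exact absurd h (hausdorffMeasure_face_pos hd hT hFT hFc hF hvol)
  -- The nodal values of `ψ` solve the Gram system with a unit vector on the right.
  obtain ⟨c, hc⟩ := (LinearMap.injective_iff_surjective.1 hinj) (Pi.single (⟨z, hz⟩ : F) 1)
  refine ⟨cellInterp hT (ext c), fun p => ?_⟩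
  have hp : EqOn p (cellInterp hT p) (convexHull ℝ (F : Set (Eu d))) :=
    affine_eqOn_convexHull fun x hx => (cellInterp_vertex hT _ (hFT (by exact_mod_cast hx))).symm
  have e : (fun x => cellInterp hT (ext c) x * p x)
      =ᵐ[faceMeasure F] fun x => ∑ y : F, (cellInterp hT (ext (Pi.single y 1)) x *
        cellInterp hT (ext c) x) * p y := by
    refine hsupp fun x hx => ?_
    rw [hp hx, happ p hx, Finset.mul_sum]
    refine Finset.sum_congr rfl fun y' _ => ?_
    ring
  rw [integral_congr_ae e, integral_finsetSum _ fun y' _ => (hint _ _).mul_const _]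
  simp_rw [integral_mul_const, ← hMv]
  have hc' : ∀ y, M.mulVec c y = (Pi.single (⟨z, hz⟩ : F) (1 : ℝ) : F → ℝ) y := fun y => congrFun hc y
  simp_rw [hc', Pi.single_apply]
  simp

/-- The dual function is unique on the face. -/
theorem IsDualFunction.ae_unique (hd : 1 ≤ d) {T F : Finset (Eu d)} (hT : T ∈ cells K)
    (hFT : F ⊆ T) (hFc : F.card = d) (hF : F ∈ K.faces)
    (hvol : volume (convexHull ℝ (T : Set (Eu d))) ≠ 0) {z : Eu d}
    {ψ ψ' : Eu d →ᵃ[ℝ] ℝ} (h : IsDualFunction F z ψ) (h' : IsDualFunction F z ψ') :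
    ψ =ᵐ[faceMeasure F] ψ' := by
  have hint : ∀ p q : Eu d →ᵃ[ℝ] ℝ, Integrable (fun x => p x * q x) (faceMeasure F) := fun p q =>
    (memLp_affine_faceMeasure hd hF hFc p).integrable_mul (memLp_affine_faceMeasure hd hF hFc q)
  have hsub : ∀ x, (ψ - ψ') x = ψ x - ψ' x := fun _ => rfl
  have h0 : ∫ x, (ψ - ψ') x * (ψ - ψ') x ∂(faceMeasure F) = 0 := by
    have e : ∀ x, (ψ - ψ') x * (ψ - ψ') x = ψ x * (ψ - ψ') x - ψ' x * (ψ - ψ') x := fun x => by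
      rw [hsub]; ring
    simp_rw [e]
    rw [integral_sub (hint _ _) (hint _ _), h, h', sub_self]
  refine ae_restrict_of_forall_mem (convexHull_face_isCompact F).measurableSet fun x hx => ?_
  have := sq_mul_faceMeasure_le hd hF hFc (ψ - ψ') hx
  rw [h0, ENNReal.ofReal_zero, mul_zero, nonpos_iff_eq_zero, mul_eq_zero, mul_eq_zero] at this
  rcases this with h | h | h
  · rw [ENNReal.ofReal_eq_zero, hsub] at h
    exact sub_eq_zero.1 (pow_eq_zero_iff two_ne_zero |>.1 (le_antisymm h (sq_nonneg _)))
  · rw [ENNReal.ofReal_eq_zero] at h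
    exact absurd h (not_le.2 (by positivity))
  · exact absurd h (hausdorffMeasure_face_pos hd hT hFT hFc hF hvol)

theorem sq_integral_mul_le {X : Type*} [MeasurableSpace X] {μ : Measure X} {φ g : X → ℝ}
    (hφ : AEStronglyMeasurable φ μ) (hg : AEStronglyMeasurable g μ) :
    ‖∫ x, φ x * g x ∂μ‖ₑ ^ 2 ≤ (∫⁻ x, ‖φ x‖ₑ ^ 2 ∂μ) * ∫⁻ x, ‖g x‖ₑ ^ 2 ∂μ := by
  have h := ENNReal.lintegral_mul_le_Lp_mul_Lq μ Real.HolderConjugate.two_two hφ.enorm hg.enorm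
  have h1 : ‖∫ x, φ x * g x ∂μ‖ₑ ≤ _ :=
    (enorm_integral_le_lintegral_enorm _).trans ((lintegral_congr fun x => enorm_mul _ _).le.trans h)
  refine (pow_le_pow_left' h1 2).trans_eq ?_
  rw [mul_pow, ← ENNReal.rpow_natCast, ← ENNReal.rpow_natCast, ← ENNReal.rpow_mul,
    ← ENNReal.rpow_mul]
  norm_num

theorem sq_add_mul_le (A B b : ℝ≥0∞) : (A + b * B) ^ 2 ≤ 2 * (A ^ 2 + b ^ 2 * B ^ 2) := by
  rw [← mul_pow]
  generalize b * B = x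
  have := ENNReal.rpow_add_le_mul_rpow_add_rpow A x (p := 2) (by norm_num)
  norm_num at this
  exact this

/-- The nodal values of the interpolant, compared with any affine function. -/
theorem nodal_value_estimate (hd : 1 ≤ d) (hK : IsTriangulation D K) {T F : Finset (Eu d)}
    (hT : T ∈ cells K) (hFT : F ⊆ T) (hFc : F.card = d) (hF : F ∈ K.faces) {z : Eu d} (hz : z ∈ F)
    {f : Eu d → ℝ} {G : Eu d → Eu d →L[ℝ] ℝ} {u : ℕ → Eu d → ℝ} (hu : IsH1Limit f G u)
    {g : Eu d → ℝ} (hg : MemLp g 2 (faceMeasure F))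
    (hlim : Tendsto (fun n => eLpNorm (fun x => u n x - g x) 2 (faceMeasure F)) atTop (𝓝 0))
    {ψ : Eu d →ᵃ[ℝ] ℝ} (hψ : IsDualFunction F z ψ) (p : Eu d →ᵃ[ℝ] ℝ) :
    ‖(∫ x, ψ x * g x ∂(faceMeasure F)) - p z‖ₑ ^ 2 * volume (convexHull ℝ (T : Set (Eu d))) ≤
      ENNReal.ofReal (16 * 4 ^ (d - 1)) *
        ∫⁻ x in Metric.closedBall z (2 * meshSize K), (‖f x - p x‖ₑ ^ 2 +
          ENNReal.ofReal (meshSize K ^ 2) *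
            ‖G x - LinearMap.toContinuousLinearMap p.linear‖ₑ ^ 2) := by
  obtain ⟨a, hTa, ha, haF⟩ := exists_opposite_vertex hT hFT hFc
  set b := a - z with hb
  have hbV := opposite_sub_notMem_vectorSpan hT hFT ha haF hz
  obtain ⟨c, hc0, hct, hc⟩ := exists_cylinder_const hd (K.indep hF) hFc hbV
  have hcF := hc _ subset_rfl (convexHull_face_isCompact F)
  set Cy := cylinder (convexHull ℝ (F : Set (Eu d))) b with hCy
  set V := volume (convexHull ℝ (T : Set (Eu d))) with hV
  set m := μH[(d : ℝ) - 1] (convexHull ℝ (F : Set (Eu d))) with hm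
  set q := ENNReal.ofReal ((1 / 4) ^ (d - 1)) with hq
  -- The cell lies in the cylinder, whose volume times `c` is the face measure.
  have hmV : c * V ≤ m := by
    have h := hcF (fun _ => 1) measurable_const
    simp only [lintegral_const, Measure.restrict_apply MeasurableSet.univ, univ_inter, one_mul,
      Real.volume_Icc, sub_zero, ENNReal.ofReal_one] at h
    rw [hm, h]
    gcongr
    exact measure_mono (cell_subset_cylinder hTa hz)
  have hzT : z ∈ convexHull ℝ (T : Set (Eu d)) := subset_convexHull ℝ _ (by exact_mod_cast hFT hz)
  have hbn : ‖b‖ ≤ meshSize K :=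
    norm_sub_le_meshSize hK hT (subset_convexHull ℝ _ (by exact_mod_cast ha)) hzT
  have hCyB : Cy ⊆ Metric.closedBall z (2 * meshSize K) := by
    rintro _ ⟨⟨y, s⟩, ⟨hy, hs⟩, rfl⟩
    simp only at hy hs ⊢
    have h1 : ‖y - z‖ ≤ meshSize K :=
      norm_sub_le_meshSize hK hT (convexHull_mono (by exact_mod_cast hFT) hy) hzT
    rw [mem_closedBall_iff_norm]
    calc ‖y + s • b - z‖ = ‖(y - z) + s • b‖ := by congr 1; abel
      _ ≤ ‖y - z‖ + ‖s • b‖ := norm_add_le _ _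
      _ ≤ meshSize K + 1 * meshSize K := by
          rw [norm_smul, Real.norm_of_nonneg hs.1]
          gcongr
          exact hs.2
      _ = 2 * meshSize K := by ring
  set Y := ∫⁻ x in Metric.closedBall z (2 * meshSize K), (‖f x - p x‖ₑ ^ 2 +
          ENNReal.ofReal (meshSize K ^ 2) *
            ‖G x - LinearMap.toContinuousLinearMap p.linear‖ₑ ^ 2) with hY
  set X := ∫⁻ x, ‖g x - p x‖ₑ ^ 2 ∂(faceMeasure F) with hX
  have hpm := memLp_affine_faceMeasure hd hF hFc p
  have hψm := memLp_affine_faceMeasure hd hF hFc ψ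
  have hXY : X ≤ 4 * c * Y := by
    have h := trace_inequality_limit hct hcF hu hg.aestronglyMeasurable hlim p
    have h2 := pow_le_pow_left' h 2
    rw [eLpNorm_two_sq, mul_pow, ← ENNReal.rpow_natCast ((2 * c) ^ (1 / 2 : ℝ)),
      ← ENNReal.rpow_mul] at h2
    norm_num at h2
    refine h2.trans ?_
    calc 2 * c * _ ≤ 2 * c * (2 * Y) := by
          gcongr
          refine (sq_add_mul_le _ _ _).trans ?_
          gcongr
          rw [eLpNorm_two_sq, eLpNorm_two_sq, hY, ← lintegral_const_mul' _ _ (by simp),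
            ← lintegral_add_left' ?_]
          · refine (lintegral_mono_set hCyB).trans (lintegral_mono fun x => ?_)
            gcongr
            rw [← ofReal_norm, ← ENNReal.ofReal_pow (norm_nonneg _)]
            gcongr
          · exact ((hu.aesm.sub
              p.continuous_of_finiteDimensional.aestronglyMeasurable).restrict.enorm).pow_const 2
      _ = 4 * c * Y := by ring
  -- Testing `ψ` against itself: its squared `L²` norm is `ψ z`, which the inverse inequality bounds
  -- by `4/(q m)`.
  have hψψ : ∫ y, ψ y * ψ y ∂(faceMeasure F) = ψ z := hψ ψ
  have hψ0 : 0 ≤ ψ z := by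
    rw [← hψψ]; exact integral_nonneg fun y => mul_self_nonneg _
  have hψl : ∫⁻ x, ‖ψ x‖ₑ ^ 2 ∂(faceMeasure F) = ENNReal.ofReal (ψ z) := by
    have hi : Integrable (fun y => ψ y * ψ y) (faceMeasure F) := hψm.integrable_mul hψm
    rw [← hψψ, ofReal_integral_eq_lintegral_ofReal hi
      (ae_of_all _ fun y => mul_self_nonneg _)]
    refine lintegral_congr fun y => ?_
    rw [← ofReal_norm, ← ENNReal.ofReal_pow (norm_nonneg _), Real.norm_eq_abs, sq_abs, sq]
  have hψm4 : ENNReal.ofReal (ψ z) * (q * m) ≤ 4 := by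
    have h := sq_mul_faceMeasure_le hd hF hFc ψ
      (subset_convexHull ℝ (F : Set (Eu d)) (by exact_mod_cast hz : z ∈ (F : Set (Eu d))))
    rw [hψψ, sq, ENNReal.ofReal_mul hψ0, mul_assoc, mul_comm 4] at h
    rcases eq_or_ne (ENNReal.ofReal (ψ z)) 0 with h0 | h0
    · rw [h0, zero_mul]; exact zero_le
    · exact (ENNReal.mul_le_mul_iff_right h0 ENNReal.ofReal_ne_top).1 h
  have e1 : (∫ x, ψ x * g x ∂(faceMeasure F)) - p z =
      ∫ x, ψ x * (g x - p x) ∂(faceMeasure F) := by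
    have hi1 : Integrable (fun y => ψ y * g y) (faceMeasure F) := hψm.integrable_mul hg
    have hi2 : Integrable (fun y => ψ y * p y) (faceMeasure F) := hψm.integrable_mul hpm
    rw [← hψ p, ← integral_sub hi1 hi2]
    simp_rw [mul_sub]
  rw [e1]
  have hI : ‖∫ x, ψ x * (g x - p x) ∂(faceMeasure F)‖ₑ ^ 2 ≤ ENNReal.ofReal (ψ z) * X := by
    rw [← hψl]
    exact sq_integral_mul_le hψm.1 (hg.sub hpm).1
  set I := ‖∫ x, ψ x * (g x - p x) ∂(faceMeasure F)‖ₑ ^ 2 with hIdef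
  -- The trace inequality contributes the factor `c` on the right and `c V ≤ m` the same factor on
  -- the left.
  have hfin : c * (q * (I * V)) ≤ c * (16 * Y) := by
    calc c * (q * (I * V)) = I * (q * (c * V)) := by ring
      _ ≤ (ENNReal.ofReal (ψ z) * X) * (q * m) := by gcongr
      _ = (ENNReal.ofReal (ψ z) * (q * m)) * X := by ring
      _ ≤ 4 * (4 * c * Y) := by gcongr
      _ = c * (16 * Y) := by ring
  have hfin2 := (ENNReal.mul_le_mul_iff_right hc0 hct).1 hfin
  have hq4 : ENNReal.ofReal (4 ^ (d - 1)) * q = 1 := by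
    rw [hq, ← ENNReal.ofReal_mul (by positivity), ← mul_pow]; norm_num
  calc I * V = ENNReal.ofReal (4 ^ (d - 1)) * (q * (I * V)) := by
        rw [← mul_assoc, hq4, one_mul]
    _ ≤ ENNReal.ofReal (4 ^ (d - 1)) * (16 * Y) := by gcongr
    _ = ENNReal.ofReal (16 * 4 ^ (d - 1)) * Y := by
        rw [ENNReal.ofReal_mul (by norm_num)]
        norm_num
        ring

end ScottZhang

/-! ### Local errors of the interpolant -/

namespace ScottZhang

variable {d : ℕ} {K : Geometry.SimplicialComplex ℝ (Eu d)} {D : Set (Eu d)}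

/-- The affine function with value `α` at `x` and gradient `L`. -/
noncomputable def affineAt (x : Eu d) (α : ℝ) (L : Eu d →L[ℝ] ℝ) : Eu d →ᵃ[ℝ] ℝ :=
  L.toLinearMap.toAffineMap + AffineMap.const ℝ (Eu d) (α - L x)

theorem affineAt_apply (x : Eu d) (α : ℝ) (L : Eu d →L[ℝ] ℝ) (q : Eu d) :
    affineAt x α L q = α + L (q - x) := by
  rw [affineAt, AffineMap.coe_add, Pi.add_apply, AffineMap.const_apply, map_sub]
  change L q + _ = _
  ring

theorem affineAt_linear (x : Eu d) (α : ℝ) (L : Eu d →L[ℝ] ℝ) :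
    LinearMap.toContinuousLinearMap (affineAt x α L).linear = L := by
  ext q
  simp [affineAt]

/-- The squared error of the first order approximation at `x` of `f` with gradient `G`, on the ball
of radius `6 h`. -/
noncomputable def localError (f : Eu d → ℝ) (G : Eu d → Eu d →L[ℝ] ℝ) (a : Eu d → ℝ) (b : Eu d → Eu d →L[ℝ] ℝ)
    (h : ℝ) (x : Eu d) : ℝ≥0∞ :=
  ∫⁻ y in Metric.closedBall 0 (6 * h),
    (‖f (x + y) - a x - b x y‖ₑ ^ 2 + ENNReal.ofReal (h ^ 2) * ‖G (x + y) - b x‖ₑ ^ 2)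

/-- A piecewise affine function `w` on a mesh whose nodal values are controlled by local averages
of `f` and its gradient `G`, together with first order approximations of `f`. -/
structure MeshApprox (D : Set (Eu d)) (K : Geometry.SimplicialComplex ℝ (Eu d)) (w f : Eu d → ℝ)
    (G : Eu d → Eu d →L[ℝ] ℝ) (a : Eu d → ℝ) (b : Eu d → Eu d →L[ℝ] ℝ) (h κ : ℝ) (M : ℝ≥0∞) :
    Prop where
  dim_pos : 1 ≤ d
  isOpen : IsOpen D
  isBounded : Bornology.IsBounded D
  isTriangulation : IsTriangulation D K
  h_pos : 0 < h
  κ_pos : 0 < κ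
  κ_le : κ ≤ 1
  diam_le : ∀ T ∈ cells K, ∀ x ∈ convexHull ℝ (T : Set (Eu d)), ∀ y ∈ convexHull ℝ (T : Set (Eu d)),
    ‖x - y‖ ≤ h
  ball : ∀ T ∈ cells K, ∃ c, Metric.closedBall c (κ * h) ⊆ convexHull ℝ (T : Set (Eu d))
  ext_ball : ∀ x ∈ frontier D, ∃ c, Metric.closedBall c (κ * h) ⊆ Metric.closedBall x h \ D
  w_mem : w ∈ lagrangeSpace K
  w_bdry : ∀ x ∈ frontier D, w x = 0
  f_meas : Measurable f
  G_meas : Measurable G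
  a_meas : Measurable a
  b_meas : Measurable b
  f_zero : ∀ᵐ x, x ∉ D → f x = 0
  approx : ∀ y, ‖y‖ ≤ 6 * h → ∫⁻ x, ‖f (x + y) - a x - b x y‖ₑ ^ 2 ≤ M
  approx_grad : ∀ y, ‖y‖ ≤ 6 * h → ENNReal.ofReal (h ^ 2) * ∫⁻ x, ‖G (x + y) - b x‖ₑ ^ 2 ≤ M
  nodal : ∀ z ∈ K.vertices, ∀ p : Eu d →ᵃ[ℝ] ℝ,
    ‖w z - p z‖ₑ ^ 2 * volume (Metric.closedBall (0 : Eu d) (κ * h)) ≤ 4 * 4 ^ d *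
      ∫⁻ x in Metric.closedBall z (2 * h), (‖f x - p x‖ₑ ^ 2 + ENNReal.ofReal (h ^ 2) *
        ‖G x - LinearMap.toContinuousLinearMap p.linear‖ₑ ^ 2)

theorem localError_eq (f : Eu d → ℝ) (G : Eu d → Eu d →L[ℝ] ℝ) (a : Eu d → ℝ)
    (b : Eu d → Eu d →L[ℝ] ℝ) (h : ℝ) (x : Eu d) :
    localError f G a b h x = ∫⁻ q in Metric.closedBall x (6 * h),
      (‖f q - affineAt x (a x) (b x) q‖ₑ ^ 2 + ENNReal.ofReal (h ^ 2) *
        ‖G q - LinearMap.toContinuousLinearMap (affineAt x (a x) (b x)).linear‖ₑ ^ 2) := by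
  symm
  rw [localError, ← lintegral_indicator Metric.isClosed_closedBall.measurableSet,
    ← lintegral_indicator Metric.isClosed_closedBall.measurableSet,
    ← lintegral_add_left_eq_self _ x]
  refine lintegral_congr fun y => ?_
  by_cases hy : y ∈ Metric.closedBall (0 : Eu d) (6 * h)
  · have hy' : x + y ∈ Metric.closedBall x (6 * h) := by
      rw [mem_closedBall_iff_norm] at hy ⊢
      simpa using hy
    rw [indicator_of_mem hy, indicator_of_mem hy', affineAt_linear, affineAt_apply,
      add_sub_cancel_left, sub_sub]
  · have hy' : x + y ∉ Metric.closedBall x (6 * h) := by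
      rw [mem_closedBall_iff_norm] at hy ⊢
      simpa using hy
    rw [indicator_of_notMem hy, indicator_of_notMem hy']

namespace MeshApprox

variable {w f : Eu d → ℝ} {G : Eu d → Eu d →L[ℝ] ℝ} {a : Eu d → ℝ} {b : Eu d → Eu d →L[ℝ] ℝ}
  {h κ : ℝ} {M : ℝ≥0∞}

theorem measurable_integrand (S : MeshApprox D K w f G a b h κ M) :
    Measurable fun p : Eu d × Eu d => ‖f (p.1 + p.2) - a p.1 - b p.1 p.2‖ₑ ^ 2 := by
  have h1 : Measurable fun p : Eu d × Eu d => b p.1 p.2 :=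
    isBoundedBilinearMap_apply.continuous.measurable.comp
      ((S.b_meas.comp measurable_fst).prodMk measurable_snd)
  have h2 : Measurable fun p : Eu d × Eu d => f (p.1 + p.2) :=
    S.f_meas.comp (measurable_fst.add measurable_snd)
  exact (((h2.sub (S.a_meas.comp measurable_fst)).sub h1).enorm).pow_const 2

theorem measurable_integrand_grad (S : MeshApprox D K w f G a b h κ M) :
    Measurable fun p : Eu d × Eu d => ‖G (p.1 + p.2) - b p.1‖ₑ ^ 2 := by
  have h2 : Measurable fun p : Eu d × Eu d => G (p.1 + p.2) :=
    S.G_meas.comp (measurable_fst.add measurable_snd)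
  exact ((h2.sub (S.b_meas.comp measurable_fst)).enorm).pow_const 2

theorem volume_ball_pos (S : MeshApprox D K w f G a b h κ M) :
    volume (Metric.closedBall (0 : Eu d) (κ * h)) ≠ 0 :=
  (Metric.measure_closedBall_pos _ _ (mul_pos S.κ_pos S.h_pos)).ne'

theorem volume_ball_ne_top (κ h : ℝ) :
    volume (Metric.closedBall (0 : Eu d) (κ * h)) ≠ ∞ :=
  (isCompact_closedBall (0 : Eu d) _).measure_lt_top.ne

theorem volume_ball_six (S : MeshApprox D K w f G a b h κ M) :
    volume (Metric.closedBall (0 : Eu d) (6 * h)) =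
      ENNReal.ofReal ((6 / κ) ^ d) * volume (Metric.closedBall (0 : Eu d) (κ * h)) := by
  have hκ := S.κ_pos
  have hh := S.h_pos
  have := Measure.addHaar_closedBall_mul (volume : Measure (Eu d)) (0 : Eu d)
    (r := 6 / κ) (by positivity) (s := κ * h) (by positivity)
  rw [finrank_euclideanSpace_fin] at this
  rw [← this]
  congr 2
  field_simp

/-- By Tonelli the integral over `x` may be done first; for each shift `y` it is at most `2M`, and
`y` fills a ball of radius `6h`. -/
theorem lintegral_localError_le (S : MeshApprox D K w f G a b h κ M) :
    ∫⁻ x, localError f G a b h x ≤ volume (Metric.closedBall (0 : Eu d) (κ * h)) *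
      (ENNReal.ofReal ((6 / κ) ^ d) * (2 * M)) := by
  have hm1 := S.measurable_integrand
  have hm2 := S.measurable_integrand_grad
  have hpt : ∀ y ∈ Metric.closedBall (0 : Eu d) (6 * h),
      ∫⁻ x, (‖f (x + y) - a x - b x y‖ₑ ^ 2 + ENNReal.ofReal (h ^ 2) * ‖G (x + y) - b x‖ₑ ^ 2) ≤
        2 * M := by
    intro y hy
    have hy' : ‖y‖ ≤ 6 * h := by simpa using hy
    have hb : Measurable fun x => b x y := (ContinuousLinearMap.measurable_apply y).comp S.b_meas
    have hm : Measurable fun x => ‖f (x + y) - a x - b x y‖ₑ ^ 2 :=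
      ((((S.f_meas.comp (measurable_id.add_const y)).sub S.a_meas).sub hb).enorm).pow_const 2
    have hm' : Measurable fun x => ‖G (x + y) - b x‖ₑ ^ 2 :=
      (((S.G_meas.comp (measurable_id.add_const y)).sub S.b_meas).enorm).pow_const 2
    rw [two_mul]
    refine le_trans (le_of_eq ?_) (add_le_add (S.approx y hy') (S.approx_grad y hy'))
    rw [lintegral_add_left hm, lintegral_const_mul _ hm']
  have hm3 : Measurable fun p : Eu d × Eu d => ‖f (p.1 + p.2) - a p.1 - b p.1 p.2‖ₑ ^ 2 +
      ENNReal.ofReal (h ^ 2) * ‖G (p.1 + p.2) - b p.1‖ₑ ^ 2 := hm1.add (hm2.const_mul _)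
  have hswap := lintegral_lintegral_swap (μ := (volume : Measure (Eu d)))
    (ν := volume.restrict (Metric.closedBall (0 : Eu d) (6 * h)))
    (f := fun x y => ‖f (x + y) - a x - b x y‖ₑ ^ 2 +
      ENNReal.ofReal (h ^ 2) * ‖G (x + y) - b x‖ₑ ^ 2)
    hm3.aemeasurable
  refine hswap.le.trans ((setLIntegral_mono' Metric.isClosed_closedBall.measurableSet hpt).trans
    (le_of_eq ?_))
  rw [lintegral_const, Measure.restrict_apply MeasurableSet.univ, univ_inter,
    S.volume_ball_six]
  ring

/-- The ball of radius `2h` about a vertex at distance at most `4h` from `x` lies in the ball of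
radius `6h` about `x`. -/
theorem vertex_error_le (S : MeshApprox D K w f G a b h κ M) {z x : Eu d} (hz : z ∈ K.vertices)
    (hzx : ‖z - x‖ ≤ 4 * h) :
    ‖w z - affineAt x (a x) (b x) z‖ₑ ^ 2 * volume (Metric.closedBall (0 : Eu d) (κ * h)) ≤
      4 * 4 ^ d * localError f G a b h x := by
  refine (S.nodal z hz (affineAt x (a x) (b x))).trans ?_
  rw [localError_eq]
  gcongr
  refine Metric.closedBall_subset_closedBall' ?_
  rw [dist_eq_norm]
  linarith

/-- On a cell near `x`, the function `w` is close to the first order approximation at `x`. -/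
theorem cell_error_le (S : MeshApprox D K w f G a b h κ M) {T : Finset (Eu d)} (hT : T ∈ cells K)
    {x : Eu d} (hTx : ∀ z ∈ T, ‖z - x‖ ≤ 4 * h) {q : Eu d}
    (hq : q ∈ convexHull ℝ (T : Set (Eu d))) :
    ‖w q - affineAt x (a x) (b x) q‖ₑ ^ 2 * volume (Metric.closedBall (0 : Eu d) (κ * h)) ≤
      4 * 4 ^ d * localError f G a b h x := by
  obtain ⟨p, hp⟩ := S.w_mem.2 T hT
  -- The modulus of an affine function is convex, so its maximum over the cell is attained at a
  -- vertex.
  have hconv : ConvexOn ℝ (convexHull ℝ (T : Set (Eu d)))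
      fun q => ‖(p - affineAt x (a x) (b x)) q‖ :=
    ((convexOn_univ_norm (E := ℝ)).comp_affineMap (p - affineAt x (a x) (b x))).subset
      (fun _ _ => mem_univ _) (convex_convexHull ℝ _)
  obtain ⟨z, hz, hle⟩ := hconv.exists_ge_of_mem_convexHull (subset_convexHull ℝ _) hq
  have hzT : z ∈ T := by exact_mod_cast hz
  refine le_trans ?_ (S.vertex_error_le (mem_vertices_of_mem hT.1 hzT) (hTx z hzT))
  rw [hp hq, hp (subset_convexHull ℝ _ hz), ← ofReal_norm, ← ofReal_norm]
  gcongr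
  exact hle

theorem sub_taylor_le (S : MeshApprox D K w f G a b h κ M) {x : Eu d} (hx : x ∈ closure D) :
    ‖w x - a x‖ₑ ^ 2 * volume (Metric.closedBall (0 : Eu d) (κ * h)) ≤
      4 * 4 ^ d * localError f G a b h x := by
  obtain ⟨T, hT, hxT⟩ := S.isTriangulation.exists_cell hx
  have := S.cell_error_le hT (x := x) (fun z hz => by
    have := S.diam_le T hT z (subset_convexHull ℝ _ (by exact_mod_cast hz)) x hxT
    linarith [S.h_pos]) hxT
  rwa [affineAt_apply, sub_self, map_zero, add_zero] at this

/-- The `L²` error estimate. -/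
theorem lintegral_sub_le (S : MeshApprox D K w f G a b h κ M) :
    ∫⁻ x, ‖D.indicator w x - f x‖ₑ ^ 2 ≤
      (2 * (4 * 4 ^ d * (ENNReal.ofReal ((6 / κ) ^ d) * 2)) + 2) * M := by
  set m := volume (Metric.closedBall (0 : Eu d) (κ * h)) with hm
  have hm0 : m ≠ 0 := S.volume_ball_pos
  have hmt : m ≠ ∞ := volume_ball_ne_top κ h
  have hmeas : Measurable fun x => ‖f x - a x‖ₑ ^ 2 := ((S.f_meas.sub S.a_meas).enorm).pow_const 2
  have hpt : ∀ᵐ x, ‖D.indicator w x - f x‖ₑ ^ 2 ≤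
      2 * (4 * 4 ^ d * m⁻¹ * localError f G a b h x) + 2 * ‖f x - a x‖ₑ ^ 2 := by
    filter_upwards [S.f_zero] with x hx
    by_cases hxD : x ∈ D
    · rw [indicator_of_mem hxD]
      have e : w x - f x = (w x - a x) + -(f x - a x) := by ring
      rw [e]
      refine (enorm_add_sq_le _ _).trans ?_
      rw [enorm_neg]
      gcongr
      have := S.sub_taylor_le (subset_closure hxD)
      calc ‖w x - a x‖ₑ ^ 2 = m⁻¹ * (‖w x - a x‖ₑ ^ 2 * m) := by
            rw [mul_comm, mul_assoc, ENNReal.mul_inv_cancel hm0 hmt, mul_one]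
        _ ≤ m⁻¹ * (4 * 4 ^ d * localError f G a b h x) := by gcongr
        _ = _ := by ring
    · rw [indicator_of_notMem hxD, hx hxD]
      simp
  have hf0 : ∫⁻ x, ‖f x - a x‖ₑ ^ 2 ≤ M := by
    have := S.approx 0 (by simpa using S.h_pos.le)
    simpa using this
  calc ∫⁻ x, ‖D.indicator w x - f x‖ₑ ^ 2
      ≤ ∫⁻ x, (2 * (4 * 4 ^ d * m⁻¹ * localError f G a b h x) + 2 * ‖f x - a x‖ₑ ^ 2) :=
        lintegral_mono_ae hpt
    _ = 2 * (4 * 4 ^ d * m⁻¹ * ∫⁻ x, localError f G a b h x) + 2 * ∫⁻ x, ‖f x - a x‖ₑ ^ 2 := by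
        rw [lintegral_add_right _ (hmeas.const_mul 2), lintegral_const_mul' _ _ (by norm_num),
          lintegral_const_mul' _ _ ?_, lintegral_const_mul' _ _ (by norm_num)]
        exact ENNReal.mul_ne_top (ENNReal.mul_ne_top (by norm_num)
          (ENNReal.pow_ne_top (by norm_num))) (ENNReal.inv_ne_top.2 hm0)
    _ ≤ 2 * (4 * 4 ^ d * m⁻¹ * (m * (ENNReal.ofReal ((6 / κ) ^ d) * (2 * M)))) + 2 * M := by
        gcongr
        exact S.lintegral_localError_le
    _ = 2 * (4 * 4 ^ d * (m⁻¹ * m) * (ENNReal.ofReal ((6 / κ) ^ d) * (2 * M))) + 2 * M := by ring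
    _ = _ := by rw [ENNReal.inv_mul_cancel hm0 hmt]; ring

end MeshApprox

/-- A continuous function that is Lipschitz on each member of a finite closed cover of an interval
is Lipschitz on the interval. -/
theorem abs_sub_le_of_finite_closed_cover {g : ℝ → ℝ} {α β Λ : ℝ} (hαβ : α ≤ β)
    (hg : ContinuousOn g (Icc α β)) {ι : Type*} {I : Set ι} (hI : I.Finite) {A : ι → Set ℝ}
    (hA : ∀ i ∈ I, IsClosed (A i)) (hcov : ∀ s ∈ Icc α β, ∃ i ∈ I, s ∈ A i)
    (hlip : ∀ i ∈ I, ∀ s ∈ A i ∩ Icc α β, ∀ s' ∈ A i ∩ Icc α β, |g s - g s'| ≤ Λ * |s - s'|) :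
    |g β - g α| ≤ Λ * (β - α) := by
  have key : ∀ g : ℝ → ℝ, ContinuousOn g (Icc α β) →
      (∀ i ∈ I, ∀ s ∈ A i ∩ Icc α β, ∀ s' ∈ A i ∩ Icc α β, |g s - g s'| ≤ Λ * |s - s'|) →
      g β ≤ g α + Λ * (β - α) := by
    intro g hg hlip
    refine image_le_of_liminf_slope_right_le_deriv_boundary (B := fun s => g α + Λ * (s - α))
      (B' := fun _ => Λ) hg (by simp) (by fun_prop) (fun s _ => ?_) (fun s hs r hr => ?_)
      (right_mem_Icc.2 hαβ)
    · have := (((hasDerivAt_id s).sub_const α).const_mul Λ).const_add (g α)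
      simpa using this.hasDerivWithinAt
    · have hev : ∀ᶠ z in 𝓝[>] s, z ∈ Icc α β := by
        filter_upwards [Ioc_mem_nhdsGT hs.2] with z hz
        exact ⟨hs.1.trans hz.1.le, hz.2⟩
      -- Finitely many sets cover, so one of them accumulates at `s` from the right. Being closed it
      -- contains `s`, and its Lipschitz bound controls the right slope along a sequence, as the
      -- comparison principle requires.
      obtain ⟨i, hi, hfr⟩ : ∃ i ∈ I, ∃ᶠ z in 𝓝[>] s, z ∈ A i := by
        by_contra! hcon
        have h1 : ∀ᶠ z in 𝓝[>] s, ∀ i ∈ I, z ∉ A i :=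
          (eventually_all_finite hI).2 fun i hi => hcon i hi
        obtain ⟨z, hz1, hz2⟩ := (h1.and hev).exists
        obtain ⟨i, hi, hzi⟩ := hcov z hz2
        exact hz1 i hi hzi
      have hsA : s ∈ A i := by
        rw [← (hA i hi).closure_eq, mem_closure_iff_frequently]
        exact hfr.filter_mono nhdsWithin_le_nhds
      refine (hfr.and_eventually (hev.and self_mem_nhdsWithin)).mono ?_
      rintro z ⟨hzA, hz, hsz⟩
      have hsz' : 0 < z - s := sub_pos.2 hsz
      have := hlip i hi z ⟨hzA, hz⟩ s ⟨hsA, hs.1, hs.2.le⟩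
      rw [abs_of_pos hsz'] at this
      rw [slope_def_field]
      refine lt_of_le_of_lt ?_ hr
      rw [div_le_iff₀ hsz']
      exact (le_abs_self _).trans this
  rw [abs_le]
  have h1 := key g hg hlip
  have h2 := key (fun s => -g s) hg.neg (fun i hi s hs s' hs' => by
    have := hlip i hi s hs s' hs'
    rw [← abs_neg]
    convert this using 2
    ring)
  constructor <;> linarith

end ScottZhang

/-! ### Second differences of the interpolant -/

namespace ScottZhang

variable {d : ℕ} {K : Geometry.SimplicialComplex ℝ (Eu d)} {D : Set (Eu d)}

theorem abs_le_of_enorm_sq_mul_le {r : ℝ} {m X : ℝ≥0∞} (hm0 : m ≠ 0) (hmt : m ≠ ∞) (hX : X ≠ ∞)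
    (h : ‖r‖ₑ ^ 2 * m ≤ X) : |r| ≤ √((X / m).toReal) := by
  refine Real.abs_le_sqrt ?_
  have h1 : ‖r‖ₑ ^ 2 ≤ X / m := (ENNReal.le_div_iff_mul_le (Or.inl hm0) (Or.inl hmt)).2 h
  have h2 := ENNReal.toReal_mono (ENNReal.div_ne_top hX hm0) h1
  rwa [ENNReal.toReal_pow, toReal_enorm, Real.norm_eq_abs, sq_abs] at h2

namespace MeshApprox

variable {w f : Eu d → ℝ} {G : Eu d → Eu d →L[ℝ] ℝ} {a : Eu d → ℝ} {b : Eu d → Eu d →L[ℝ] ℝ}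
  {h κ : ℝ} {M : ℝ≥0∞}

theorem continuous_indicator (S : MeshApprox D K w f G a b h κ M) : Continuous (D.indicator w) :=
  _root_.continuous_indicator S.w_bdry (S.isTriangulation.space_eq ▸ S.w_mem.1)

theorem indicator_eq (S : MeshApprox D K w f G a b h κ M) {x : Eu d} (hx : x ∈ closure D) :
    D.indicator w x = w x := by
  by_cases hxD : x ∈ D
  · exact indicator_of_mem hxD _
  · rw [indicator_of_notMem hxD, S.w_bdry x ⟨hx, by rwa [S.isOpen.interior_eq]⟩]

/-- On the exterior ball `f` vanishes, so the `L²` norm of the approximation there is itself part of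
the local error; the inverse inequality turns this into a pointwise bound. -/
theorem affine_ext_ball_le (S : MeshApprox D K w f G a b h κ M) {x x₀ : Eu d}
    (hx₀ : x₀ ∈ frontier D) (hx : ‖x₀ - x‖ ≤ 5 * h) :
    ∃ c, ∀ q ∈ Metric.closedBall c (κ * h), ‖affineAt x (a x) (b x) q‖ₑ ^ 2 *
      volume (Metric.closedBall (0 : Eu d) (κ * h)) ≤ 4 * 4 ^ d * localError f G a b h x := by
  obtain ⟨c, hc⟩ := S.ext_ball x₀ hx₀
  refine ⟨c, fun q hq => ?_⟩
  set p := affineAt x (a x) (b x) with hp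
  set B := Metric.closedBall c (κ * h) with hB
  have hvol : volume B = volume (Metric.closedBall (0 : Eu d) (κ * h)) :=
    Measure.addHaar_closedBall_center _ _ _
  have h1 := sq_mul_measure_le_lintegral (μ := volume) (isCompact_closedBall c (κ * h))
    (convex_closedBall _ _) (c := ENNReal.ofReal ((1 / 4) ^ d))
    (fun y _ => (volume_homothety_image _ y (by norm_num)).ge) p hq
  have h2 : ∫⁻ y in B, ‖p y‖ₑ ^ 2 ≤ localError f G a b h x := by
    rw [localError_eq]
    have hsub : B ⊆ Metric.closedBall x (6 * h) := by
      refine (hc.trans sdiff_subset).trans (Metric.closedBall_subset_closedBall' ?_)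
      rw [dist_eq_norm]; linarith
    refine le_trans ?_ (lintegral_mono_set hsub)
    refine lintegral_mono_ae ?_
    rw [ae_restrict_iff' Metric.isClosed_closedBall.measurableSet]
    filter_upwards [S.f_zero] with y hy hyB
    rw [hy (hc hyB).2, zero_sub, enorm_neg]
    exact le_self_add
  have h4 : (4 : ℝ≥0∞) ^ d * ENNReal.ofReal ((1 / 4) ^ d) = 1 := by
    rw [← ENNReal.ofReal_ofNat 4, ← ENNReal.ofReal_pow (by norm_num),
      ← ENNReal.ofReal_mul (by positivity), ← mul_pow]
    norm_num
  have h5 : ‖p q‖ₑ ^ 2 = ENNReal.ofReal (p q ^ 2) := by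
    rw [← ofReal_norm, ← ENNReal.ofReal_pow (norm_nonneg _), Real.norm_eq_abs, sq_abs]
  rw [h5, ← hvol]
  calc ENNReal.ofReal (p q ^ 2) * volume B
      = 4 ^ d * (ENNReal.ofReal (p q ^ 2) * (ENNReal.ofReal ((1 / 4) ^ d) * volume B)) := by
        rw [mul_left_comm, ← mul_assoc (4 ^ d), h4, one_mul]
    _ ≤ 4 ^ d * (4 * localError f G a b h x) := by
        exact mul_le_mul_right (h1.trans (mul_le_mul_right h2 _)) _
    _ = _ := by ring

/-- The line is covered by the cells and the complement of `D`. On a cell `w - p` is affine and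
small on an inscribed ball of radius `κh`, which bounds its gradient. Off `D` it equals `-p`, whose
gradient is bounded from an exterior ball near a boundary point met by the segment. -/
theorem lipschitz_segment (S : MeshApprox D K w f G a b h κ M) {x x' y : Eu d}
    (hfin : localError f G a b h x' ≠ ∞)
    (hnear : ∀ s ∈ Icc (-1 : ℝ) 1, ‖x + s • y - x'‖ ≤ 3 * h)
    {s₀ : ℝ} (hs₀ : s₀ ∈ Icc (-1 : ℝ) 1) (hs₀D : x + s₀ • y ∈ D) {α β : ℝ} (hα : -1 ≤ α)
    (hαβ : α ≤ β) (hβ : β ≤ 1) :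
    |(D.indicator w (x + β • y) - affineAt x' (a x') (b x') (x + β • y)) -
      (D.indicator w (x + α • y) - affineAt x' (a x') (b x') (x + α • y))| ≤
      √((4 * 4 ^ d * localError f G a b h x' /
        volume (Metric.closedBall (0 : Eu d) (κ * h))).toReal) / (κ * h) * ‖y‖ * (β - α) := by
  set m := volume (Metric.closedBall (0 : Eu d) (κ * h)) with hm
  have hm0 : m ≠ 0 := S.volume_ball_pos
  have hmt : m ≠ ∞ := volume_ball_ne_top κ h
  have hX : 4 * 4 ^ d * localError f G a b h x' ≠ ∞ :=
    ENNReal.mul_ne_top (ENNReal.mul_ne_top (by norm_num) (ENNReal.pow_ne_top (by norm_num))) hfin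
  set p := affineAt x' (a x') (b x') with hp
  set B := √((4 * 4 ^ d * localError f G a b h x' / m).toReal) with hB
  have hκh : 0 < κ * h := mul_pos S.κ_pos S.h_pos
  have hh := S.h_pos
  have hpc : Continuous p := p.continuous_of_finiteDimensional
  have hline : Continuous fun s : ℝ => x + s • y := by fun_prop
  have hsub : Icc α β ⊆ Icc (-1 : ℝ) 1 := Icc_subset_Icc hα hβ
  have hlin : ∀ (p : Eu d →ᵃ[ℝ] ℝ) (c : Eu d), (∀ q ∈ Metric.closedBall c (κ * h), |p q| ≤ B) →
      ∀ s s' : ℝ, |p (x + s • y) - p (x + s' • y)| ≤ B / (κ * h) * ‖y‖ * |s - s'| := by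
    intro p c hpB s s'
    rw [affineMap_sub_eq_linear]
    refine (norm_linear_le_of_bound hκh hpB _).trans_eq ?_
    have : x + s • y - (x + s' • y) = (s - s') • y := by rw [sub_smul]; abel
    rw [this, norm_smul, Real.norm_eq_abs]
    ring
  refine abs_sub_le_of_finite_closed_cover
    (g := fun s => D.indicator w (x + s • y) - p (x + s • y)) hαβ
    ((S.continuous_indicator.comp hline).sub (hpc.comp hline)).continuousOn
    -- The index `none` stands for the complement of `D`, `some T` for the cell `T`.
    (I := insert none (some '' cells K))
    (A := fun i => i.elim {s : ℝ | x + s • y ∉ D}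
      fun T => {s : ℝ | x + s • y ∈ convexHull ℝ (T : Set (Eu d))})
    ((S.isTriangulation.cells_finite.image _).insert _) ?_ ?_ ?_
  · rintro i (rfl | ⟨T, hT, rfl⟩)
    · exact S.isOpen.isClosed_compl.preimage hline
    · exact (convexHull_face_isCompact T).isClosed.preimage hline
  · intro s _
    by_cases hsD : x + s • y ∈ D
    · obtain ⟨T, hT, hsT⟩ := S.isTriangulation.exists_cell (subset_closure hsD)
      exact ⟨some T, Or.inr ⟨T, hT, rfl⟩, hsT⟩
    · exact ⟨none, Or.inl rfl, hsD⟩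
  · rintro i (rfl | ⟨T, hT, rfl⟩) s ⟨hs, hsI⟩ s' ⟨hs', hsI'⟩
    · have hs1 : x + s • y ∉ D := hs
      have hs1' : x + s' • y ∉ D := hs'
      have hseg : IsPreconnected ((fun s : ℝ => x + s • y) '' Icc (-1) 1) :=
        isPreconnected_Icc.image _ hline.continuousOn
      -- The segment has a point in `D` and a point outside, so by connectedness it crosses the
      -- boundary.
      obtain ⟨_, ⟨s₁, hs₁, rfl⟩, hfr⟩ : (((fun s : ℝ => x + s • y) '' Icc (-1) 1) ∩
          frontier D).Nonempty := by
        by_contra hcon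
        have hmem := hseg.subset_of_closure_inter_subset S.isOpen ⟨_, ⟨s₀, hs₀, rfl⟩, hs₀D⟩ (by
          rintro q ⟨hq1, hq2⟩
          by_contra hqD
          exact hcon ⟨q, hq2, hq1, by rwa [S.isOpen.interior_eq]⟩)
        exact hs1 (hmem ⟨s, hsub hsI, rfl⟩)
      obtain ⟨c, hc⟩ := S.affine_ext_ball_le hfr ((hnear s₁ hs₁).trans (by linarith))
      have := hlin p c (fun q hq => abs_le_of_enorm_sq_mul_le hm0 hmt hX (hc q hq)) s' s
      rw [indicator_of_notMem hs1, indicator_of_notMem hs1', abs_sub_comm s]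
      convert this using 2
      ring
    · have hs1 : x + s • y ∈ convexHull ℝ (T : Set (Eu d)) := hs
      have hs1' : x + s' • y ∈ convexHull ℝ (T : Set (Eu d)) := hs'
      obtain ⟨q, hq⟩ := S.w_mem.2 T hT
      obtain ⟨c, hc⟩ := S.ball T hT
      have hbd : ∀ r ∈ Metric.closedBall c (κ * h), |(q - p) r| ≤ B := by
        intro r hr
        refine abs_le_of_enorm_sq_mul_le hm0 hmt hX ?_
        have := S.cell_error_le hT (x := x') (fun z hz => by
          have h1 := S.diam_le T hT z (subset_convexHull ℝ _ (by exact_mod_cast hz)) _ hs1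
          have h2 := hnear s (hsub hsI)
          calc ‖z - x'‖ = ‖(z - (x + s • y)) + (x + s • y - x')‖ := by congr 1; abel
            _ ≤ _ := norm_add_le _ _
            _ ≤ 4 * h := by linarith) (hc hr)
        rw [hq (hc hr)] at this
        exact this
      have := hlin (q - p) c hbd s s'
      rw [S.indicator_eq (S.isTriangulation.cell_subset hT hs1),
        S.indicator_eq (S.isTriangulation.cell_subset hT hs1'), hq hs1, hq hs1']
      exact this

/-- The points of a cell whose `t`-neighbourhood leaves the cell. -/
def strip (T : Finset (Eu d)) (t : ℝ) : Set (Eu d) :=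
  {q ∈ convexHull ℝ (T : Set (Eu d)) |
    ¬ Metric.closedBall q t ⊆ convexHull ℝ (T : Set (Eu d))}

/-- If none of the three points is in `D`, all values are zero. Otherwise take the cell of one that
is: if it contained the ball of radius `2‖y‖` about it, all three points would lie in one cell,
where `w` is affine. -/
theorem mem_strip_of_secDiff_ne_zero (S : MeshApprox D K w f G a b h κ M) {x y : Eu d}
    (hne : secDiff y (D.indicator w) x ≠ 0) :
    ∃ T ∈ cells K, ∃ s₀ ∈ ({0, 1, -1} : Set ℝ), x + s₀ • y ∈ D ∧
      x + s₀ • y ∈ strip T (2 * ‖y‖) := by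
  obtain ⟨s₀, hs₀, hsD⟩ : ∃ s₀ ∈ ({0, 1, -1} : Set ℝ), x + s₀ • y ∈ D := by
    by_contra! hcon
    have h0 := hcon 0 (by simp)
    have h1 := hcon 1 (by simp)
    have h2 := hcon (-1) (by simp)
    rw [zero_smul, add_zero] at h0
    rw [one_smul] at h1
    rw [neg_one_smul, ← sub_eq_add_neg] at h2
    refine hne ?_
    rw [secDiff, indicator_of_notMem h0, indicator_of_notMem h1, indicator_of_notMem h2]
    ring
  obtain ⟨T, hT, hsT⟩ := S.isTriangulation.exists_cell (subset_closure hsD)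
  refine ⟨T, hT, s₀, hs₀, hsD, hsT, fun hball => hne ?_⟩
  have hmem : ∀ s : ℝ, |s - s₀| ≤ 2 → x + s • y ∈ convexHull ℝ (T : Set (Eu d)) := by
    intro s hs
    refine hball ?_
    rw [mem_closedBall_iff_norm]
    have : x + s • y - (x + s₀ • y) = (s - s₀) • y := by rw [sub_smul]; abel
    rw [this, norm_smul, Real.norm_eq_abs]
    gcongr
  have hs : |0 - s₀| ≤ 2 ∧ |1 - s₀| ≤ 2 ∧ |-1 - s₀| ≤ 2 := by
    rcases hs₀ with rfl | rfl | rfl <;> norm_num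
  obtain ⟨p, hp⟩ := S.w_mem.2 T hT
  have hval : ∀ s : ℝ, |s - s₀| ≤ 2 → D.indicator w (x + s • y) = p (x + s • y) := fun s hs => by
    rw [S.indicator_eq (S.isTriangulation.cell_subset hT (hmem s hs)), hp (hmem s hs)]
  have h0 := hval 0 hs.1
  have h1 := hval 1 hs.2.1
  have h2 := hval (-1) hs.2.2
  rw [zero_smul, add_zero] at h0
  rw [one_smul] at h1
  rw [neg_one_smul, ← sub_eq_add_neg] at h2
  rw [secDiff, h0, h1, h2]
  have e1 := affineMap_sub_eq_linear p (x + y) x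
  have e2 := affineMap_sub_eq_linear p x (x - y)
  rw [add_sub_cancel_left] at e1
  rw [sub_sub_cancel] at e2
  linarith

/-- Second differences annihilate affine functions, so `w` may be replaced by `w - p`, and the two
increments are bounded by `lipschitz_segment`. The base point `x'` is arbitrary in `T`; this freedom
allows averaging over the cell later. -/
theorem secDiff_le (S : MeshApprox D K w f G a b h κ M) {x x' y : Eu d} (hy : ‖y‖ ≤ h)
    (hy0 : y ≠ 0) {T : Finset (Eu d)} (hT : T ∈ cells K) {s₀ : ℝ}
    (hs₀ : s₀ ∈ ({0, 1, -1} : Set ℝ)) (hsD : x + s₀ • y ∈ D)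
    (hsT : x + s₀ • y ∈ convexHull ℝ (T : Set (Eu d)))
    (hx' : x' ∈ convexHull ℝ (T : Set (Eu d))) :
    ‖secDiff y (D.indicator w) x‖ₑ ^ 2 ≤ ENNReal.ofReal ((2 * (‖y‖ / (κ * h))) ^ 2) *
      (4 * 4 ^ d * localError f G a b h x' / volume (Metric.closedBall (0 : Eu d) (κ * h))) := by
  have hκh : 0 < κ * h := mul_pos S.κ_pos S.h_pos
  have hy0' : 0 < ‖y‖ := norm_pos_iff.2 hy0
  set m := volume (Metric.closedBall (0 : Eu d) (κ * h)) with hm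
  have hm0 : m ≠ 0 := S.volume_ball_pos
  have hmt : m ≠ ∞ := volume_ball_ne_top κ h
  rcases eq_or_ne (localError f G a b h x') ∞ with htop | hfin
  · rw [htop, ENNReal.mul_top (by positivity), ENNReal.top_div_of_ne_top hmt, ENNReal.mul_top]
    · exact le_top
    · rw [ne_eq, ENNReal.ofReal_eq_zero, not_le]; positivity
  have hX : 4 * 4 ^ d * localError f G a b h x' / m ≠ ∞ :=
    ENNReal.div_ne_top (ENNReal.mul_ne_top (ENNReal.mul_ne_top (by norm_num)
      (ENNReal.pow_ne_top (by norm_num))) hfin) hm0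
  have hs₀I : s₀ ∈ Icc (-1 : ℝ) 1 := by rcases hs₀ with rfl | rfl | rfl <;> norm_num
  have hnear : ∀ s ∈ Icc (-1 : ℝ) 1, ‖x + s • y - x'‖ ≤ 3 * h := by
    intro s hs
    have h1 := S.diam_le T hT _ hsT x' hx'
    calc ‖x + s • y - x'‖ = ‖(s - s₀) • y + (x + s₀ • y - x')‖ := by
          congr 1; rw [sub_smul]; abel
      _ ≤ |s - s₀| * ‖y‖ + ‖x + s₀ • y - x'‖ := by
          rw [← Real.norm_eq_abs, ← norm_smul]; exact norm_add_le _ _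
      _ ≤ 2 * h + h := by
          gcongr
          rw [abs_le]; constructor <;> linarith [hs.1, hs.2, hs₀I.1, hs₀I.2]
      _ = 3 * h := by ring
  have h1 := S.lipschitz_segment hfin hnear hs₀I hsD (α := 0) (β := 1) (by norm_num) (by norm_num)
    le_rfl
  have h2 := S.lipschitz_segment hfin hnear hs₀I hsD (α := -1) (β := 0) le_rfl (by norm_num)
    (by norm_num)
  set X := 4 * 4 ^ d * localError f G a b h x' / m with hXdef
  set p := affineAt x' (a x') (b x') with hp
  rw [zero_smul, add_zero] at h1 h2
  rw [one_smul] at h1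
  rw [neg_one_smul, ← sub_eq_add_neg] at h2
  have e1 := affineMap_sub_eq_linear p (x + y) x
  have e2 := affineMap_sub_eq_linear p x (x - y)
  rw [add_sub_cancel_left] at e1
  rw [sub_sub_cancel] at e2
  have habs : |secDiff y (D.indicator w) x| ≤ 2 * (‖y‖ / (κ * h)) * √X.toReal := by
    have e : secDiff y (D.indicator w) x =
        ((D.indicator w (x + y) - p (x + y)) - (D.indicator w x - p x)) -
        ((D.indicator w x - p x) - (D.indicator w (x - y) - p (x - y))) := by
      rw [secDiff]; linarith
    rw [e]
    refine (abs_sub _ _).trans ((add_le_add h1 h2).trans_eq ?_)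
    field_simp
    ring
  calc ‖secDiff y (D.indicator w) x‖ₑ ^ 2
      = ENNReal.ofReal (|secDiff y (D.indicator w) x| ^ 2) := by
        rw [← ofReal_norm, ← ENNReal.ofReal_pow (norm_nonneg _), Real.norm_eq_abs]
    _ ≤ ENNReal.ofReal ((2 * (‖y‖ / (κ * h)) * √X.toReal) ^ 2) := by gcongr
    _ = _ := by
        rw [mul_pow, Real.sq_sqrt ENNReal.toReal_nonneg, ENNReal.ofReal_mul (by positivity),
          ENNReal.ofReal_toReal hX]

theorem volume_strip (S : MeshApprox D K w f G a b h κ M) {T : Finset (Eu d)} (hT : T ∈ cells K)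
    {t : ℝ} (ht : 0 < t) : volume (strip T t) ≤ ENNReal.ofReal (d * (t / (κ * h))) *
      volume (convexHull ℝ (T : Set (Eu d))) := by
  obtain ⟨c, hc⟩ := S.ball T hT
  exact volume_strip_le S.dim_pos (convexHull_face_isCompact T) (convex_convexHull ℝ _)
    (mul_pos S.κ_pos S.h_pos) ht hc

/-- The second differences of the interpolant. -/
theorem lintegral_secDiff_le (S : MeshApprox D K w f G a b h κ M) {y : Eu d} (hy : ‖y‖ ≤ h)
    (hy0 : y ≠ 0) :
    ∫⁻ x, ‖secDiff y (D.indicator w) x‖ₑ ^ 2 ≤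
      3 * ENNReal.ofReal (d * (2 * ‖y‖ / (κ * h))) * (ENNReal.ofReal ((2 * (‖y‖ / (κ * h))) ^ 2) *
        (4 * 4 ^ d * (ENNReal.ofReal ((6 / κ) ^ d) * (2 * M)))) := by
  classical
  set m := volume (Metric.closedBall (0 : Eu d) (κ * h)) with hm
  have hm0 : m ≠ 0 := S.volume_ball_pos
  have hmt : m ≠ ∞ := volume_ball_ne_top κ h
  have ht : 0 < 2 * ‖y‖ := by have := norm_pos_iff.2 hy0; positivity
  set k : ℝ≥0∞ := ENNReal.ofReal ((2 * (‖y‖ / (κ * h))) ^ 2) * (4 * 4 ^ d) * m⁻¹ with hk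
  have hkt : k ≠ ∞ := ENNReal.mul_ne_top (ENNReal.mul_ne_top ENNReal.ofReal_ne_top
    (ENNReal.mul_ne_top (by norm_num) (ENNReal.pow_ne_top (by norm_num)))) (ENNReal.inv_ne_top.2 hm0)
  -- The pointwise bound holds with every base point in the cell, hence with the infimum, and the
  -- infimum times the volume of the cell is at most the integral over it. This converts the strip
  -- estimate into an integral of the local error with the gain `‖y‖/h`.
  set i : Finset (Eu d) → ℝ≥0∞ := fun T =>
    ⨅ x' ∈ convexHull ℝ (T : Set (Eu d)), k * localError f G a b h x' with hi
  -- Passing to measurable hulls of the same volume avoids proving that strips are measurable.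
  set A : Finset (Eu d) → Set (Eu d) := fun T => toMeasurable volume (strip T (2 * ‖y‖)) with hA
  have hAm : ∀ T, MeasurableSet (A T) := fun T => measurableSet_toMeasurable _ _
  set χ : Finset (Eu d) → Eu d → ℝ≥0∞ := fun T => (A T).indicator fun _ => i T with hχ
  have hχm : ∀ T, Measurable (χ T) := fun T => measurable_const.indicator (hAm T)
  have hχ1 : ∀ T (v : Eu d), ∫⁻ x, χ T (x + v) = i T * volume (A T) := by
    intro T v
    rw [lintegral_add_right_eq_self (χ T) v, hχ, lintegral_indicator_const (hAm T)]
  set Ts := S.isTriangulation.cells_finite.toFinset with hTs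
  have hpt : ∀ x, ‖secDiff y (D.indicator w) x‖ₑ ^ 2 ≤
      ∑ T ∈ Ts, (χ T (x + (0 : ℝ) • y) + χ T (x + (1 : ℝ) • y) + χ T (x + (-1 : ℝ) • y)) := by
    intro x
    by_cases hne : secDiff y (D.indicator w) x = 0
    · rw [hne]; simp
    obtain ⟨T, hT, s₀, hs₀, hsD, hsT⟩ := S.mem_strip_of_secDiff_ne_zero hne
    have h1 : ‖secDiff y (D.indicator w) x‖ₑ ^ 2 ≤ χ T (x + s₀ • y) := by
      rw [hχ]
      simp only
      rw [indicator_of_mem (subset_toMeasurable _ _ hsT)]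
      refine le_iInf₂ fun x' hx' => ?_
      refine (S.secDiff_le hy hy0 hT hs₀ hsD hsT.1 hx').trans_eq ?_
      rw [hk, ← hm, div_eq_mul_inv _ m]
      ring
    refine le_trans (h1.trans ?_) (Finset.single_le_sum (f := fun T =>
      (χ T (x + (0 : ℝ) • y) + χ T (x + (1 : ℝ) • y) + χ T (x + (-1 : ℝ) • y)))
      (fun _ _ => zero_le) (by simpa [hTs] using hT))
    rcases hs₀ with rfl | rfl | rfl
    · exact le_self_add.trans le_self_add
    · exact le_add_self.trans le_self_add
    · exact le_add_self
  calc ∫⁻ x, ‖secDiff y (D.indicator w) x‖ₑ ^ 2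
      ≤ ∫⁻ x, ∑ T ∈ Ts, (χ T (x + (0 : ℝ) • y) + χ T (x + (1 : ℝ) • y) +
          χ T (x + (-1 : ℝ) • y)) := lintegral_mono hpt
    -- The factor three counts the points `x`, `x + y`, `x - y`; translation invariance makes their
    -- contributions equal.
    _ = ∑ T ∈ Ts, 3 * (i T * volume (A T)) := by
        have hm' : ∀ T (v : Eu d), Measurable fun x => χ T (x + v) := fun T v =>
          (hχm T).comp (measurable_id.add_const v)
        have hm3 : ∀ T, Measurable fun x =>
            χ T (x + (0 : ℝ) • y) + χ T (x + (1 : ℝ) • y) + χ T (x + (-1 : ℝ) • y) := fun T =>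
          ((hm' T _).add (hm' T _)).add (hm' T _)
        have hm2 : ∀ T, Measurable fun x =>
            χ T (x + (0 : ℝ) • y) + χ T (x + (1 : ℝ) • y) := fun T => (hm' T _).add (hm' T _)
        rw [lintegral_finsetSum _ fun T _ => hm3 T]
        refine Finset.sum_congr rfl fun T _ => ?_
        rw [lintegral_add_left (hm2 T), lintegral_add_left (hm' T _), hχ1, hχ1,
          hχ1]
        ring
    _ ≤ ∑ T ∈ Ts, 3 * ENNReal.ofReal (d * (2 * ‖y‖ / (κ * h))) *
          ∫⁻ x in convexHull ℝ (T : Set (Eu d)), k * localError f G a b h x := by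
        refine Finset.sum_le_sum fun T hT => ?_
        have hT' : T ∈ cells K := by simpa [hTs] using hT
        have h1 : i T * volume (convexHull ℝ (T : Set (Eu d))) ≤
            ∫⁻ x in convexHull ℝ (T : Set (Eu d)), k * localError f G a b h x := by
          rw [← setLIntegral_const]
          exact setLIntegral_mono' (convexHull_face_isCompact T).measurableSet fun x hx =>
            iInf₂_le x hx
        calc 3 * (i T * volume (A T))
            ≤ 3 * (i T * (ENNReal.ofReal (d * (2 * ‖y‖ / (κ * h))) *
              volume (convexHull ℝ (T : Set (Eu d))))) := by
              gcongr
              rw [hA, measure_toMeasurable]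
              exact S.volume_strip hT' ht
          _ = 3 * ENNReal.ofReal (d * (2 * ‖y‖ / (κ * h))) *
              (i T * volume (convexHull ℝ (T : Set (Eu d)))) := by ring
          _ ≤ _ := by gcongr
    _ ≤ 3 * ENNReal.ofReal (d * (2 * ‖y‖ / (κ * h))) *
          ∫⁻ x, k * localError f G a b h x := by
        rw [← Finset.mul_sum]
        gcongr
        exact sum_setLIntegral_cells_le S.isTriangulation _
    _ ≤ 3 * ENNReal.ofReal (d * (2 * ‖y‖ / (κ * h))) *
          (k * (m * (ENNReal.ofReal ((6 / κ) ^ d) * (2 * M)))) := by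
        rw [lintegral_const_mul' _ _ hkt]
        gcongr
        exact S.lintegral_localError_le
    _ = _ := by
        congr 1
        rw [hk, mul_assoc _ m⁻¹, ← mul_assoc m⁻¹, ENNReal.inv_mul_cancel hm0 hmt, one_mul]
        ring

end MeshApprox

end ScottZhang

/-! ### Stability and error estimates -/

namespace ScottZhang

variable {d : ℕ} {K : Geometry.SimplicialComplex ℝ (Eu d)} {D : Set (Eu d)}

theorem sobolevENorm_zero (r : ℝ) : sobolevENorm r (fun _ : Eu d => 0) = 0 := by
  have hf : MemLp (fun x : Eu d => (((fun _ : Eu d => (0 : ℝ)) x : ℝ) : ℂ)) 2 := by simp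
  refine pow_eq_zero_iff two_ne_zero |>.1 ?_
  rw [sobolevENorm_sq hf]
  have h0 := lintegral_fourier_toLp hf
  simp only [enorm_zero, ne_eq, OfNat.ofNat_ne_zero, not_false_eq_true, zero_pow,
    lintegral_zero] at h0
  have hm := (Lp.aestronglyMeasurable
    (𝓕 (hf.toLp _) : Lp ℂ 2 (volume : Measure (Eu d)))).enorm.pow_const 2
  have h1 := (lintegral_eq_zero_iff' hm).1 h0
  refine (lintegral_congr_ae (g := fun _ => 0) ?_).trans lintegral_zero
  filter_upwards [h1] with ξ hξ
  have : ‖(𝓕 (hf.toLp _) : Lp ℂ 2 (volume : Measure (Eu d))) ξ‖ₑ ^ 2 = 0 := hξ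
  rw [this, mul_zero]

theorem sobolevENorm_sub_sq_le {r : ℝ} {u f : Eu d → ℝ} (hu : MemLp (fun x => (u x : ℂ)) 2)
    (hf : MemLp (fun x => (f x : ℂ)) 2) :
    sobolevENorm r (fun x => u x - f x) ^ 2 ≤
      2 * sobolevENorm r u ^ 2 + 2 * sobolevENorm r f ^ 2 := by
  have huf := memLp_ofReal_sub hu hf
  rw [sobolevENorm_sq huf, sobolevENorm_sq hu, sobolevENorm_sq hf,
    ← lintegral_const_mul' _ _ (by norm_num), ← lintegral_const_mul' _ _ (by norm_num),
    ← lintegral_add_left']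
  · refine lintegral_mono_ae ?_
    filter_upwards [fourier_toLp_sub_ae hu hf huf] with ξ hξ
    rw [hξ]
    rw [mul_left_comm 2, mul_left_comm 2, ← mul_add]
    gcongr
    calc _ ≤ (‖(𝓕 (hu.toLp _) : Lp ℂ 2 (volume : Measure (Eu d))) ξ‖ₑ +
          ‖(𝓕 (hf.toLp _) : Lp ℂ 2 (volume : Measure (Eu d))) ξ‖ₑ) ^ 2 := by
          gcongr; exact enorm_sub_le
      _ ≤ _ := by
          have := sq_add_mul_le ‖(𝓕 (hu.toLp _) : Lp ℂ 2 (volume : Measure (Eu d))) ξ‖ₑ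
            ‖(𝓕 (hf.toLp _) : Lp ℂ 2 (volume : Measure (Eu d))) ξ‖ₑ 1
          simpa [mul_add] using this
  · have hc : Continuous fun ξ : Eu d => (1 + (2 * Real.pi * ‖ξ‖) ^ 2) ^ r :=
      Continuous.rpow_const (by fun_prop) fun ξ => Or.inl (by positivity)
    exact (hc.measurable.ennreal_ofReal.aemeasurable.mul
      ((Lp.aestronglyMeasurable _).enorm.pow_const 2)).const_mul 2

/-- The constant in the `L²` error estimate. -/
noncomputable def constL2 (d : ℕ) (κ : ℝ) : ℝ≥0∞ :=
  (2 * (4 * 4 ^ d * (ENNReal.ofReal ((6 / κ) ^ d) * 2)) + 2) * ENNReal.ofReal (4 * 6 ^ 4)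

/-- The constant in the estimate of the second differences. -/
noncomputable def constDiff (d : ℕ) (κ : ℝ) : ℝ≥0∞ :=
  3 * ENNReal.ofReal (8 * d / κ ^ 3) * (4 * 4 ^ d * (ENNReal.ofReal ((6 / κ) ^ d) * 2)) *
    ENNReal.ofReal (4 * 6 ^ 4)

/-- The constant in the squared stability estimate. -/
noncomputable def constStab (d : ℕ) (κ β : ℝ) : ℝ≥0∞ :=
  ENNReal.ofReal (2 * (1 + Real.pi ^ 2 * d) ^ β) *
    (constL2 d κ + 1 + d * (constDiff d κ * (1 - ENNReal.ofReal (2 ^ (2 * β - 3)))⁻¹))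

theorem constL2_ne_top (d : ℕ) (κ : ℝ) : constL2 d κ ≠ ∞ := by
  have h4 : (4 : ℝ≥0∞) ^ d ≠ ∞ := ENNReal.pow_ne_top (by norm_num)
  unfold constL2
  finiteness

theorem constDiff_ne_top (d : ℕ) (κ : ℝ) : constDiff d κ ≠ ∞ := by
  have h4 : (4 : ℝ≥0∞) ^ d ≠ ∞ := ENNReal.pow_ne_top (by norm_num)
  unfold constDiff
  finiteness

/-- Here the upper bound on `β` is essential: it makes the ratio of the geometric series less than
one. -/
theorem constStab_ne_top (d : ℕ) (κ : ℝ) {β : ℝ} (hβ : β < 3 / 2) : constStab d κ β ≠ ∞ := by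
  have hr : ENNReal.ofReal (2 ^ (2 * β - 3)) < 1 := by
    rw [ENNReal.ofReal_lt_one]
    exact Real.rpow_lt_one_of_one_lt_of_neg (by norm_num) (by linarith)
  have h1 : (1 - ENNReal.ofReal (2 ^ (2 * β - 3)))⁻¹ ≠ ∞ :=
    ENNReal.inv_ne_top.2 (tsub_pos_of_lt hr).ne'
  refine ENNReal.mul_ne_top ENNReal.ofReal_ne_top (ENNReal.add_ne_top.2 ⟨ENNReal.add_ne_top.2
    ⟨constL2_ne_top d κ, by norm_num⟩, ?_⟩)
  exact ENNReal.mul_ne_top (by simp) (ENNReal.mul_ne_top (constDiff_ne_top d κ) h1)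

namespace MeshApprox

variable {w f₀ f : Eu d → ℝ} {G : Eu d → Eu d →L[ℝ] ℝ} {a : Eu d → ℝ} {b : Eu d → Eu d →L[ℝ] ℝ}
  {h κ β : ℝ} {M N : ℝ≥0∞}

theorem hasCompactSupport (S : MeshApprox D K w f₀ G a b h κ M) :
    HasCompactSupport (D.indicator w) :=
  HasCompactSupport.intro (Metric.isCompact_of_isClosed_isBounded isClosed_closure
    S.isBounded.closure) fun _ hx => indicator_of_notMem (fun h => hx (subset_closure h)) _

theorem memLp_indicator (S : MeshApprox D K w f₀ G a b h κ M) : MemLp (D.indicator w) 2 :=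
  S.continuous_indicator.memLp_of_hasCompactSupport S.hasCompactSupport

theorem lintegral_sub_le' (S : MeshApprox D K w f₀ G a b h κ M) (hff : f₀ =ᵐ[volume] f)
    (hM : M = ENNReal.ofReal (4 * 6 ^ 4 * h ^ (2 * β)) * N ^ 2) :
    ∫⁻ x, ‖D.indicator w x - f x‖ₑ ^ 2 ≤
      constL2 d κ * ENNReal.ofReal (h ^ (2 * β)) * N ^ 2 := by
  have h0 : ∫⁻ x, ‖D.indicator w x - f x‖ₑ ^ 2 = ∫⁻ x, ‖D.indicator w x - f₀ x‖ₑ ^ 2 := by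
    refine lintegral_congr_ae ?_
    filter_upwards [hff] with x hx
    rw [hx]
  rw [h0]
  refine S.lintegral_sub_le.trans_eq ?_
  rw [hM, constL2, ENNReal.ofReal_mul (by norm_num)]
  ring

/-- With step `t = h 2^(-k)` the powers combine to `t^(-2β) (t/h)³ h^(2β) = 2^((2β-3)k)`, up to
constants: one factor `t/h` from the strip, two from the squared second difference. -/
theorem lintegral_secDiff_le' (S : MeshApprox D K w f₀ G a b h κ M)
    (hM : M = ENNReal.ofReal (4 * 6 ^ 4 * h ^ (2 * β)) * N ^ 2) (j : Fin d) (k : ℕ) :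
    ENNReal.ofReal (((h / 2 ^ k) ^ 2) ^ (-β)) *
      ∫⁻ x, ‖secDiff ((h / 2 ^ k) • EuclideanSpace.single j (1 : ℝ)) (D.indicator w) x‖ₑ ^ 2 ≤
      constDiff d κ * N ^ 2 * ENNReal.ofReal (2 ^ (2 * β - 3)) ^ k := by
  have hh := S.h_pos
  have hκ := S.κ_pos
  set t : ℝ := h / 2 ^ k with ht
  have ht0 : 0 < t := by positivity
  set y : Eu d := t • EuclideanSpace.single j (1 : ℝ) with hy
  have hyn : ‖y‖ = t := by
    rw [hy, norm_smul, PiLp.norm_single, norm_one, mul_one, Real.norm_of_nonneg ht0.le]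
  have hth : t ≤ h := div_le_self hh.le (one_le_pow₀ (by norm_num))
  have h1 := S.lintegral_secDiff_le (y := y) (by rw [hyn]; exact hth)
    (by rw [← norm_pos_iff, hyn]; exact ht0)
  rw [hyn] at h1
  refine (mul_le_mul_right h1 _).trans_eq ?_
  have e : ENNReal.ofReal ((t ^ 2) ^ (-β)) * (ENNReal.ofReal (d * (2 * t / (κ * h))) *
      ENNReal.ofReal ((2 * (t / (κ * h))) ^ 2)) * ENNReal.ofReal (4 * 6 ^ 4 * h ^ (2 * β)) =
      ENNReal.ofReal (8 * d / κ ^ 3) * ENNReal.ofReal (4 * 6 ^ 4) *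
        ENNReal.ofReal (2 ^ (2 * β - 3)) ^ k := by
    rw [← ENNReal.ofReal_mul (by positivity), ← ENNReal.ofReal_mul (by positivity),
      ← ENNReal.ofReal_mul (by positivity), ← ENNReal.ofReal_mul (by positivity),
      ← ENNReal.ofReal_pow (by positivity), ← ENNReal.ofReal_mul (by positivity)]
    congr 1
    have e1 : (t ^ 2) ^ (-β) = (2 ^ (2 * β)) ^ k * h ^ (-(2 * β)) := by
      rw [← Real.rpow_natCast t 2, ← Real.rpow_mul ht0.le, ht,
        Real.div_rpow hh.le (by positivity), div_eq_mul_inv, ← Real.rpow_neg (by positivity),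
        ← Real.rpow_natCast 2 k, ← Real.rpow_mul (by norm_num), ← Real.rpow_natCast (2 ^ (2 * β)),
        ← Real.rpow_mul (by norm_num), mul_comm]
      congr 2 <;> push_cast <;> ring
    have e2 : (2 : ℝ) ^ (2 * β - 3) = 2 ^ (2 * β) / 8 := by
      rw [Real.rpow_sub (by norm_num)]; norm_num
    have e3 : h ^ (-(2 * β)) * h ^ (2 * β) = 1 := by
      rw [← Real.rpow_add hh]; simp
    have e4 : (8 : ℝ) ^ k = (2 ^ k) ^ 3 := by
      rw [← pow_mul, mul_comm, pow_mul]; norm_num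
    rw [e1, e2, div_pow, e4]
    have e5 : t / h = 1 / 2 ^ k := by rw [ht]; field_simp
    calc (2 ^ (2 * β)) ^ k * h ^ (-(2 * β)) * (d * (2 * t / (κ * h)) * (2 * (t / (κ * h))) ^ 2) *
          (4 * 6 ^ 4 * h ^ (2 * β))
        = (h ^ (-(2 * β)) * h ^ (2 * β)) * (2 ^ (2 * β)) ^ k * (8 * d / κ ^ 3) * (t / h) ^ 3 *
          (4 * 6 ^ 4) := by
          field_simp
          ring
      _ = _ := by
          rw [e3, e5]
          field_simp
  calc _ = 3 * (ENNReal.ofReal ((t ^ 2) ^ (-β)) * (ENNReal.ofReal (d * (2 * t / (κ * h))) *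
      ENNReal.ofReal ((2 * (t / (κ * h))) ^ 2)) * ENNReal.ofReal (4 * 6 ^ 4 * h ^ (2 * β))) *
      (4 * 4 ^ d * (ENNReal.ofReal ((6 / κ) ^ d) * 2)) * N ^ 2 := by
        rw [hM]; ring
    _ = _ := by rw [e, constDiff]; ring

/-- Stability of the interpolant. -/
theorem stability (S : MeshApprox D K w f₀ G a b h κ M) (hh1 : h ≤ 1) (hβ : 0 ≤ β)
    (hff : f₀ =ᵐ[volume] f) (hf : MemLp (fun x => (f x : ℂ)) 2)
    (hM : M = ENNReal.ofReal (4 * 6 ^ 4 * h ^ (2 * β)) * sobolevENorm β f ^ 2) :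
    sobolevENorm β (D.indicator w) ^ 2 ≤ constStab d κ β * sobolevENorm β f ^ 2 := by
  have hh := S.h_pos
  refine (sobolevENorm_sq_le_secDiff S.dim_pos hβ hh hh1
    (S.continuous_indicator.integrable_of_hasCompactSupport S.hasCompactSupport)
    S.memLp_indicator hf).trans ?_
  rw [constStab, mul_assoc]
  refine mul_le_mul_right ?_ _
  rw [add_mul, add_mul, one_mul]
  refine add_le_add (add_le_add ?_ le_rfl) ?_
  · refine (mul_le_mul_right (S.lintegral_sub_le' hff hM) _).trans_eq ?_
    have e : ENNReal.ofReal ((h ^ 2) ^ (-β)) * ENNReal.ofReal (h ^ (2 * β)) = 1 := by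
      rw [← ENNReal.ofReal_mul (by positivity), ← Real.rpow_natCast h 2, ← Real.rpow_mul hh.le,
        ← Real.rpow_add hh]
      simp
    calc _ = (ENNReal.ofReal ((h ^ 2) ^ (-β)) * ENNReal.ofReal (h ^ (2 * β))) * constL2 d κ *
          sobolevENorm β f ^ 2 := by ring
      _ = _ := by rw [e, one_mul]
  · calc _ ≤ ∑ _j : Fin d, ∑' k : ℕ, constDiff d κ * sobolevENorm β f ^ 2 *
          ENNReal.ofReal (2 ^ (2 * β - 3)) ^ k :=
        Finset.sum_le_sum fun j _ => ENNReal.tsum_le_tsum fun k =>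
          S.lintegral_secDiff_le' hM j k
      _ = _ := by
        rw [ENNReal.tsum_mul_left, ENNReal.tsum_geometric, Finset.sum_const, Finset.card_univ,
          Fintype.card_fin, nsmul_eq_mul]
        ring

/-- The error estimates. -/
theorem error_le (S : MeshApprox D K w f₀ G a b h κ M) (hh1 : h ≤ 1) (hβ : 1 ≤ β)
    (hff : f₀ =ᵐ[volume] f) (hf : MemLp (fun x => (f x : ℂ)) 2)
    (hM : M = ENNReal.ofReal (4 * 6 ^ 4 * h ^ (2 * β)) * sobolevENorm β f ^ 2) {s : ℝ}
    (hs : s ∈ Icc (0 : ℝ) 1) :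
    sobolevENorm s (fun x => D.indicator w x - f x) ^ 2 ≤
      (constL2 d κ + (2 * constStab d κ β + 2)) *
        (ENNReal.ofReal (h ^ (β - s)) * sobolevENorm β f) ^ 2 := by
  have hh := S.h_pos
  have hw := memLp_ofReal_iff.2 S.memLp_indicator
  have e0 : ENNReal.ofReal (h ^ (β - s)) ^ 2 = ENNReal.ofReal (h ^ (2 * (β - s))) := by
    rw [← ENNReal.ofReal_pow (by positivity), ← Real.rpow_natCast, ← Real.rpow_mul hh.le]
    congr 2; push_cast; ring
  have e1 : ENNReal.ofReal ((h ^ 2) ^ (-s)) * ENNReal.ofReal (h ^ (2 * β)) =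
      ENNReal.ofReal (h ^ (2 * (β - s))) := by
    rw [← ENNReal.ofReal_mul (by positivity), ← Real.rpow_natCast h 2, ← Real.rpow_mul hh.le,
      ← Real.rpow_add hh]
    congr 2; push_cast; ring
  have e2 : ENNReal.ofReal ((h ^ 2) ^ (β - s)) = ENNReal.ofReal (h ^ (2 * (β - s))) := by
    rw [← Real.rpow_natCast h 2, ← Real.rpow_mul hh.le]
    congr 2
  refine (sobolevENorm_sq_le_interp hh hs.1 (hs.2.trans hβ) (memLp_ofReal_sub hw hf)).trans ?_
  have h1 := S.lintegral_sub_le' hff hM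
  have h2 := (sobolevENorm_sub_sq_le (r := β) hw hf).trans
    (add_le_add_left (mul_le_mul_right (S.stability hh1 (by linarith) hff hf hM) 2) _)
  refine (add_le_add (mul_le_mul_right h1 _) (mul_le_mul_right h2 _)).trans_eq ?_
  rw [e2, mul_pow, e0]
  calc _ = (ENNReal.ofReal ((h ^ 2) ^ (-s)) * ENNReal.ofReal (h ^ (2 * β))) * constL2 d κ *
        sobolevENorm β f ^ 2 + ENNReal.ofReal (h ^ (2 * (β - s))) *
        (2 * (constStab d κ β * sobolevENorm β f ^ 2) + 2 * sobolevENorm β f ^ 2) := by ring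
    _ = _ := by rw [e1]; ring

end MeshApprox

/-- Using `1 + C` in place of a square root of `C` keeps the constants simple. -/
theorem le_one_add_mul_of_sq_le {X Y C : ℝ≥0∞} (h : X ^ 2 ≤ C * Y ^ 2) : X ≤ (1 + C) * Y := by
  refine (ENNReal.pow_le_pow_left_iff two_ne_zero).1 (h.trans ?_)
  rw [mul_pow]
  gcongr
  calc C ≤ (1 + C) * 1 := by rw [mul_one]; exact le_add_self
    _ ≤ (1 + C) * (1 + C) := by gcongr; exact le_self_add
    _ = (1 + C) ^ 2 := by ring

end ScottZhang

/-! ### The interpolant -/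

namespace ScottZhang

variable {d : ℕ} {K : Geometry.SimplicialComplex ℝ (Eu d)} {D : Set (Eu d)}

theorem sobolevENorm_one_lt_top {f : Eu d → ℝ} {β : ℝ} (hβ : 1 ≤ β) (hf : sobolevENorm β f < ∞) :
    sobolevENorm 1 f < ∞ := by
  have hm := memLp_of_sobolevENorm_lt_top hf
  have h := sobolevENorm_sq_le_interp one_pos zero_le_one hβ hm
  have h2 : ∫⁻ x, ‖f x‖ₑ ^ 2 < ∞ := MemLp.lintegral_sq_lt_top (memLp_ofReal_iff.1 hm)
  have h3 : sobolevENorm 1 f ^ 2 < ∞ := by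
    refine h.trans_lt (ENNReal.add_lt_top.2 ⟨ENNReal.mul_lt_top ENNReal.ofReal_lt_top h2,
      ENNReal.mul_lt_top ENNReal.ofReal_lt_top (ENNReal.pow_lt_top hf)⟩)
  by_contra hcon
  rw [not_lt, top_le_iff] at hcon
  rw [hcon] at h3
  simp at h3

theorem exists_cell_of_face_of_vertex (hK : IsTriangulation D K) {z : Eu d}
    (hz : z ∈ K.vertices) : ∃ T ∈ cells K, z ∈ T := by
  obtain ⟨T, hT, hzT⟩ := hK.pure {z} hz
  exact ⟨T, hT, hzT (Finset.mem_singleton_self z)⟩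

theorem isInterpolant_eqOn (hK : IsTriangulation D K)
    {w w' : Eu d → ℝ} (hw : w ∈ lagrangeSpace K) (hw' : w' ∈ lagrangeSpace K)
    (h : ∀ z ∈ K.vertices, w' z = w z) : EqOn w' w (closure D) := by
  intro x hx
  obtain ⟨T, hT, hxT⟩ := hK.exists_cell hx
  rw [lagrange_eqOn_cellInterp hw hT (φ := w) (fun _ _ => rfl) hxT,
    lagrange_eqOn_cellInterp hw' hT (φ := w) (fun z hz => h z (mem_vertices_of_mem hT.1 hz)) hxT]

/-- A boundary point lies in a face with all its vertices on the boundary, and `w` is affine on that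
face. -/
theorem lagrange_eq_zero_on_frontier (hDo : IsOpen D) (hDl : HasLipschitzBoundary D)
    (hK : IsTriangulation D K) {w : Eu d → ℝ} (hw : w ∈ lagrangeSpace K)
    (h : ∀ z ∈ K.vertices, z ∈ frontier D → w z = 0) : ∀ x ∈ frontier D, w x = 0 := by
  intro x hx
  obtain ⟨S, hS, hxS, hSD⟩ := hK.exists_boundary_face hDo hDl hx
  obtain ⟨T, hT, hST⟩ := hK.pure S hS
  obtain ⟨p, hp⟩ := hw.2 T hT
  have hsub : convexHull ℝ (S : Set (Eu d)) ⊆ convexHull ℝ (T : Set (Eu d)) :=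
    convexHull_mono (by exact_mod_cast hST)
  have hp0 : EqOn p (0 : Eu d →ᵃ[ℝ] ℝ) (convexHull ℝ (S : Set (Eu d))) := by
    refine affine_eqOn_convexHull fun z hz => ?_
    have hzS : z ∈ S := by exact_mod_cast hz
    rw [← hp (hsub (subset_convexHull ℝ _ hz)), h z (mem_vertices_of_mem hS hzS) (hSD z hzS)]
    rfl
  rw [hp (hsub hxS), hp0 hxS]
  rfl

theorem volume_cell_ne_zero (hd : 1 ≤ d) (hK : IsTriangulation D K) {σ ρ : ℝ}
    (hσ : ShapeRegular σ K) (hρ : QuasiUniform ρ K) {T : Finset (Eu d)} (hT : T ∈ cells K) :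
    volume (convexHull ℝ (T : Set (Eu d))) ≠ 0 := by
  obtain ⟨c, hc⟩ := exists_ball_subset_cell hd hK hσ hρ hT
  have h0 := meshSize_pos hd hK hT
  exact fun h => (Metric.measure_closedBall_pos volume c (by positivity)).ne'
    (measure_mono_null hc h)

theorem lintegral_comp_add_congr {f f₀ : Eu d → ℝ} (hff : f₀ =ᵐ[volume] f) (y : Eu d)
    (φ : Eu d → ℝ → ℝ≥0∞) : ∫⁻ x, φ x (f₀ (x + y)) = ∫⁻ x, φ x (f (x + y)) := by
  refine lintegral_congr_ae ?_
  have := (measurePreserving_add_right (volume : Measure (Eu d)) y).quasiMeasurePreserving.ae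
    (p := fun x => f₀ x = f x) hff
  filter_upwards [this] with x hx
  rw [hx]

/-- Functions in `H^β` and their interpolants satisfy the assumptions of `MeshApprox`. -/
theorem exists_meshApprox (hd : 1 ≤ d) (hDo : IsOpen D) (hDb : Bornology.IsBounded D)
    (hK : IsTriangulation D K) {σ ρ : ℝ} (hσ : ShapeRegular σ K) (hρ : QuasiUniform ρ K)
    (hh1 : meshSize K ≤ 1) (hh0 : 0 < meshSize K) {κ₀ κ : ℝ}
    (hext : ∀ x ∈ frontier D, ∀ r : ℝ, 0 < r → r ≤ 1 →
      ∃ c, Metric.closedBall c (κ₀ * r) ⊆ Metric.closedBall x r \ D)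
    (hκ : 0 < κ) (hκ1 : κ ≤ 1) (hκ₀ : κ ≤ κ₀) (hκ₂ : κ ≤ 1 / (2 * (|σ * ρ| + 1)))
    {f : Eu d → ℝ} (hfD : ∀ x ∉ D, f x = 0) (hf : MemLp (fun x => (f x : ℂ)) 2)
    {G : Eu d → (Eu d →L[ℝ] ℝ)} (hG : Measurable G) {β : ℝ}
    (happ : ∃ (a : Eu d → ℝ) (b : Eu d → (Eu d →L[ℝ] ℝ)), Measurable a ∧ Measurable b ∧
      ∀ y, ‖y‖ ≤ 6 * meshSize K →
        ∫⁻ x, ‖f (x + y) - a x - b x y‖ₑ ^ 2 ≤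
          ENNReal.ofReal (4 * 6 ^ 4 * meshSize K ^ (2 * β)) * sobolevENorm β f ^ 2 ∧
        ∫⁻ x, ‖G (x + y) - b x‖ₑ ^ 2 ≤
          ENNReal.ofReal (4 * 6 ^ 4 * meshSize K ^ (2 * β - 2)) * sobolevENorm β f ^ 2)
    {w : Eu d → ℝ} (hw : w ∈ lagrangeSpace K) (hwD : ∀ x ∈ frontier D, w x = 0)
    (hnod : ∀ z ∈ K.vertices, ∃ T ∈ cells K, ∀ p : Eu d →ᵃ[ℝ] ℝ,
      ‖w z - p z‖ₑ ^ 2 * volume (convexHull ℝ (T : Set (Eu d))) ≤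
        ENNReal.ofReal (16 * 4 ^ (d - 1)) *
          ∫⁻ x in Metric.closedBall z (2 * meshSize K), (‖f x - p x‖ₑ ^ 2 +
            ENNReal.ofReal (meshSize K ^ 2) *
              ‖G x - LinearMap.toContinuousLinearMap p.linear‖ₑ ^ 2)) :
    ∃ f₀ a b, f₀ =ᵐ[volume] f ∧ MeshApprox D K w f₀ G a b (meshSize K) κ
      (ENNReal.ofReal (4 * 6 ^ 4 * meshSize K ^ (2 * β)) * sobolevENorm β f ^ 2) := by
  -- Tonelli's theorem for the local errors needs joint measurability in `x` and `y`, so `f` is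
  -- replaced by a Borel representative.
  have hfm := (memLp_ofReal_iff.1 hf).aestronglyMeasurable.aemeasurable
  have hff : hfm.mk f =ᵐ[volume] f := hfm.ae_eq_mk.symm
  obtain ⟨a, b, ha, hb, hab⟩ := happ
  have hball : ∀ T ∈ cells K, ∃ c, Metric.closedBall c (κ * meshSize K) ⊆
      convexHull ℝ (T : Set (Eu d)) := by
    intro T hT
    obtain ⟨c, hc⟩ := exists_ball_subset_cell hd hK hσ hρ hT
    exact ⟨c, (Metric.closedBall_subset_closedBall (by gcongr)).trans hc⟩
  refine ⟨hfm.mk f, a, b, hff, ?_⟩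
  exact
  { dim_pos := hd
    isOpen := hDo
    isBounded := hDb
    isTriangulation := hK
    h_pos := hh0
    κ_pos := hκ
    κ_le := hκ1
    diam_le := fun T hT x hx y hy => norm_sub_le_meshSize hK hT hx hy
    ball := hball
    ext_ball := fun x hx => by
      obtain ⟨c, hc⟩ := hext x hx _ hh0 hh1
      exact ⟨c, (Metric.closedBall_subset_closedBall (by gcongr)).trans hc⟩
    w_mem := hw
    w_bdry := hwD
    f_meas := hfm.measurable_mk
    G_meas := hG
    a_meas := ha
    b_meas := hb
    f_zero := by
      filter_upwards [hff] with x hx hxD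
      rw [hx, hfD x hxD]
    approx := fun y hy => by
      rw [lintegral_comp_add_congr hff y fun x t => ‖t - a x - b x y‖ₑ ^ 2]
      exact (hab y hy).1
    approx_grad := fun y hy => by
      refine (mul_le_mul_right (hab y hy).2 _).trans_eq ?_
      rw [← mul_assoc, ← ENNReal.ofReal_mul (by positivity)]
      congr 2
      rw [Real.rpow_sub hh0]
      have : meshSize K ^ (2 : ℝ) = meshSize K ^ 2 := by norm_cast
      rw [this]
      field_simp
    nodal := fun z hz p => by
      obtain ⟨T, hT, h⟩ := hnod z hz
      obtain ⟨c, hc⟩ := hball T hT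
      have h16 : ENNReal.ofReal (16 * 4 ^ (d - 1)) = 4 * 4 ^ d := by
        obtain ⟨n, rfl⟩ : ∃ n, d = n + 1 := ⟨d - 1, by omega⟩
        rw [Nat.add_sub_cancel, ENNReal.ofReal_mul (by norm_num),
          ENNReal.ofReal_pow (by norm_num), ENNReal.ofReal_ofNat, ENNReal.ofReal_ofNat, pow_succ]
        rw [show (16 : ℝ≥0∞) = 4 * 4 by norm_num]
        ring
      have hI : ∫⁻ x in Metric.closedBall z (2 * meshSize K), (‖hfm.mk f x - p x‖ₑ ^ 2 +
            ENNReal.ofReal (meshSize K ^ 2) *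
              ‖G x - LinearMap.toContinuousLinearMap p.linear‖ₑ ^ 2) =
          ∫⁻ x in Metric.closedBall z (2 * meshSize K), (‖f x - p x‖ₑ ^ 2 +
            ENNReal.ofReal (meshSize K ^ 2) *
              ‖G x - LinearMap.toContinuousLinearMap p.linear‖ₑ ^ 2) := by
        refine lintegral_congr_ae (ae_restrict_of_ae ?_)
        filter_upwards [hff] with x hx
        rw [hx]
      rw [hI, ← h16]
      refine le_trans (mul_le_mul_right ?_ _) (h p)
      rw [← Measure.addHaar_closedBall_center volume c]
      exact measure_mono hc }

end ScottZhang

open ScottZhang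

theorem mainTheorem7 (d : ℕ) (hd : 1 ≤ d) (D : Set (EuclideanSpace ℝ (Fin d)))
    (hDo : IsOpen D) (hDb : Bornology.IsBounded D) (hDl : ScottZhang.HasLipschitzBoundary D)
    (σ ρ β : ℝ) (hβ : 1 < β) (hβ' : β < 3 / 2) :
    ∃ C : ℝ≥0,
      ∀ K : Geometry.SimplicialComplex ℝ (EuclideanSpace ℝ (Fin d)),
        ScottZhang.IsTriangulation D K → ScottZhang.ShapeRegular σ K →
        ScottZhang.QuasiUniform ρ K → ScottZhang.meshSize K ≤ 1 →
      ∀ F : EuclideanSpace ℝ (Fin d) → Finset (EuclideanSpace ℝ (Fin d)),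
        ScottZhang.IsFaceChoice D K F →
      ∀ v : EuclideanSpace ℝ (Fin d) → ℝ, ScottZhang.MemTilde D β v →
        ∃ w : EuclideanSpace ℝ (Fin d) → ℝ,
          ScottZhang.IsInterpolant D K F v w ∧
          (∀ w', ScottZhang.IsInterpolant D K F v w' → EqOn w' w (closure D)) ∧
          w ∈ ScottZhang.femSpace D K ∧
          ScottZhang.tildeENorm D β w ≤ C * ScottZhang.tildeENorm D β v ∧
          ∀ s ∈ Icc (0 : ℝ) 1,
            ScottZhang.tildeENorm D s (fun x => w x - v x) ≤
              C * ENNReal.ofReal (ScottZhang.meshSize K ^ (β - s)) *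
                ScottZhang.tildeENorm D β v := by
  classical
  obtain ⟨κ₀, hκ₀, hκ₀1, hext⟩ := HasLipschitzBoundary.exterior_ball hDo hDb hDl
  -- One relative radius for both the exterior balls and the balls inscribed in cells; it depends
  -- only on `D`, `σ` and `ρ`.
  set κ := min κ₀ (1 / (2 * (|σ * ρ| + 1))) with hκ
  have hκpos : 0 < κ := lt_min hκ₀ (by positivity)
  set C₁ : ℝ≥0∞ := 1 + (constL2 d κ + (2 * constStab d κ β + 2)) with hC₁
  have hStab := constStab_ne_top d κ hβ'
  have hL2 := constL2_ne_top d κ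
  have hC₁t : C₁ ≠ ∞ := by rw [hC₁]; finiteness
  refine ⟨C₁.toNNReal, ?_⟩
  intro K hK hσ hρ hh1 F hF v hv
  rw [ENNReal.coe_toNNReal hC₁t]
  set f := D.indicator v with hfdef
  have hfN : sobolevENorm β f < ∞ := hv
  have hf := memLp_of_sobolevENorm_lt_top hfN
  have hf1 := sobolevENorm_one_lt_top hβ.le hfN
  have hfD : ∀ x ∉ D, f x = 0 := fun x hx => indicator_of_notMem hx _
  obtain ⟨G, hGm, hGu, happ⟩ := exists_weakGradient hf hf1
  obtain ⟨u, hu, hulim, hu0⟩ := exists_mollification hDb hfD hf1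
  have huL : IsH1Limit f G u := isH1Limit_of_sobolev hf hGm hGu hu hulim
  -- faces, traces and dual functions
  have hdata : ∀ z, ∃ (T : Finset (Eu d)) (g : Eu d → ℝ) (ψ : Eu d →ᵃ[ℝ] ℝ), z ∈ K.vertices →
      T ∈ cells K ∧ F z ⊆ T ∧ MemLp g 2 (faceMeasure (F z)) ∧
      Tendsto (fun n => eLpNorm (fun x => u n x - g x) 2 (faceMeasure (F z))) atTop (𝓝 0) ∧
      IsDualFunction (F z) z ψ := by
    intro z
    by_cases hz : z ∈ K.vertices
    · obtain ⟨T, hT, hFT⟩ := hK.pure _ (hF.mem_faces z hz)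
      obtain ⟨g, hg, hglim⟩ := exists_trace hd (K.indep (hF.mem_faces z hz)) (hF.card_eq z hz) huL
      obtain ⟨ψ, hψ⟩ := exists_dualFunction hd hT hFT (hF.card_eq z hz) (hF.mem_faces z hz)
        (volume_cell_ne_zero hd hK hσ hρ hT) (hF.mem z hz)
      exact ⟨T, g, ψ, fun _ => ⟨hT, hFT, hg, hglim, hψ⟩⟩
    · exact ⟨∅, 0, 0, fun h => absurd h hz⟩
  choose T g ψ hTg using hdata
  obtain ⟨w, hwc, hwT⟩ := hK.exists_lagrange fun z => ∫ x, ψ z x * g z x ∂(faceMeasure (F z))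
  have hw : w ∈ lagrangeSpace K := ⟨hwc, fun T hT => ⟨_, hwT T hT⟩⟩
  have hwz : ∀ z ∈ K.vertices, w z = ∫ x, ψ z x * g z x ∂(faceMeasure (F z)) := by
    intro z hz
    obtain ⟨T, hT, hzT⟩ := exists_cell_of_face_of_vertex hK hz
    rw [hwT T hT (subset_convexHull ℝ _ (by exact_mod_cast hzT)), cellInterp_vertex hT _ hzT]
  have hint : IsInterpolant D K F v w := by
    refine ⟨hw, fun z hz => ?_⟩
    obtain ⟨hT, hFT, hg, hglim, hψ⟩ := hTg z hz
    exact ⟨g z, ψ z, ⟨hg, u, hu, hulim, hglim⟩, hψ, hwz z hz⟩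
  have huniq : ∀ w', IsInterpolant D K F v w' → EqOn w' w (closure D) := by
    rintro w' ⟨hw', hw'z⟩
    refine isInterpolant_eqOn hK hw hw' fun z hz => ?_
    -- Another interpolant may use another trace, approximating sequence and dual function; trace
    -- and dual function are unique almost everywhere on the face, so the nodal value is the same.
    obtain ⟨g', ψ', ⟨hg', u', hu', hulim', hglim'⟩, hψ', hval⟩ := hw'z z hz
    obtain ⟨hT, hFT, hg, hglim, hψ⟩ := hTg z hz
    rw [hval, hwz z hz]
    refine integral_congr_ae ?_
    have h1 := trace_ae_unique hd (K.indep (hF.mem_faces z hz)) (hF.card_eq z hz)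
      (isH1Limit_of_sobolev hf hGm hGu hu' hulim') huL hg'.aestronglyMeasurable
      hg.aestronglyMeasurable hglim' hglim
    have h2 := hψ'.ae_unique hd hT hFT (hF.card_eq z hz) (hF.mem_faces z hz)
      (volume_cell_ne_zero hd hK hσ hρ hT) hψ
    filter_upwards [h1, h2] with x hx1 hx2
    rw [hx1, hx2]
  have hwD : ∀ x ∈ frontier D, w x = 0 := by
    refine lagrange_eq_zero_on_frontier hDo hDl hK hw fun z hz hzD => ?_
    obtain ⟨hT, hFT, hg, hglim, hψ⟩ := hTg z hz
    have h1 := trace_eq_zero_of_boundary hd hDo hDl (K.indep (hF.mem_faces z hz))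
      (hF.card_eq z hz) (hF.boundary z hz hzD) huL hfD hu0 hg.aestronglyMeasurable hglim
    rw [hwz z hz]
    refine (integral_congr_ae (g := fun _ => (0 : ℝ)) ?_).trans (by simp)
    filter_upwards [h1] with x hx
    rw [hx, Pi.zero_apply, mul_zero]
  refine ⟨w, hint, huniq, ⟨hw, hwD⟩, ?_⟩
  have hsub : ∀ s, tildeENorm D s (fun x => w x - v x) =
      sobolevENorm s (fun x => D.indicator w x - f x) := by
    intro s
    rw [tildeENorm, hfdef]
    congr 1
    ext x
    by_cases hx : x ∈ D <;> simp [hx]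
  -- For empty `D` there need not be a cell to make the mesh size positive, but all norms vanish.
  rcases D.eq_empty_or_nonempty with rfl | ⟨x₀, hx₀⟩
  · have hz : ∀ φ : Eu d → ℝ, (∅ : Set (Eu d)).indicator φ = fun _ => 0 := by
      intro φ; ext x; simp
    refine ⟨?_, fun s _ => ?_⟩
    · rw [tildeENorm, hz, sobolevENorm_zero]; exact zero_le
    · rw [tildeENorm, hz, sobolevENorm_zero]; exact zero_le
  obtain ⟨T₀, hT₀, -⟩ := hK.exists_cell (subset_closure hx₀)
  have hh0 := meshSize_pos hd hK hT₀
  obtain ⟨f₀, a, b, hff, S⟩ := exists_meshApprox hd hDo hDb hK hσ hρ hh1 hh0 hext hκpos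
    ((min_le_left _ _).trans hκ₀1) (min_le_left _ _) (min_le_right _ _) hfD hf hGm
    (happ β 6 (meshSize K) hβ.le (by linarith) (by norm_num) hh0) hw hwD (fun z hz => by
      obtain ⟨hT, hFT, hg, hglim, hψ⟩ := hTg z hz
      refine ⟨T z, hT, fun p => ?_⟩
      rw [hwz z hz]
      exact nodal_value_estimate hd hK hT hFT (hF.card_eq z hz) (hF.mem_faces z hz)
        (hF.mem z hz) huL hg hglim hψ p)
  refine ⟨?_, fun s hs => ?_⟩
  · refine (le_one_add_mul_of_sq_le (S.stability hh1 (by linarith) hff hf rfl)).trans ?_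
    refine mul_le_mul_left ?_ _
    rw [hC₁]
    gcongr
    calc constStab d κ β ≤ 2 * constStab d κ β := le_mul_of_one_le_left' (by norm_num)
      _ ≤ 2 * constStab d κ β + 2 := le_self_add
      _ ≤ _ := le_add_self
  · rw [hsub, mul_assoc]
    exact le_one_add_mul_of_sq_le (S.error_le hh1 hβ.le hff hf rfl hs)
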